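/- Let $n\ge 1$, let $h_\beta(R)$ be the elementary symmetric functions, $\prod_{k=1}^n(1+\lambda R^k)=\sum_{\beta}\lambda^\beta h_\beta$, and put $\tilde\upsilon^i_\beta=(-1)^{\beta+1}\partial_i h_\beta$ for $1\le\beta\le n$, where $\partial_i=\partial/\partial R^i$. **1. The system and its linearization.** $\tilde\upsilon_2^i=R^i-\sum_m R^m$. The flows $R^i_{\tilde t^\beta}=\tilde\upsilon^i_\beta R^i_{\tilde t^1}$ commute pairwise and are linearly degenerate ($\partial_i\tilde\upsilon^i_\beta=0$), and the system $R^i_{\tilde t^2}=(R^i-\sum_m R^m)R^i_{\tilde t^1}$ is semi-Hamiltonian where the $R^i$ are pairwise distinct. Let $\varepsilon^1,\dots,\varepsilon^n$ be pairwise distinct real constants and $$a^\beta_\gamma=\sum_{k=1}^n(\varepsilon^k)^{\gamma-1}(R^k)^{n-\beta},\qquad A^\beta_\gamma=\sum_{k=1}^n(-1)^{n+\gamma+\beta+1}\,\frac{\partial_k\tilde\varepsilon_{n+1-\beta}}{\prod_{m\ne k}(\varepsilon^k-\varepsilon^m)}\;\frac{\partial_k h_\gamma}{\prod_{s\neq k}(R^k-R^s)},$$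 where $\tilde\varepsilon_\beta$ are the elementary symmetric functions of the $\varepsilon^k$ (and $\partial_k\tilde\varepsilon_\beta=\partial\tilde\varepsilon_\beta/\partial\varepsilon^k$). At points with pairwise distinct $R^i$ the matrices $a$ and $A$ are inverse to each other. Along every $C^1$ solution, with pairwise distinct $R^i$, of the linear flows $R^i_{t^\beta}=(\varepsilon^i)^{\beta-1}R^i_{t^1}$ $(1\le\beta\le n)$ the forms $a^\beta_\gamma dt^\gamma$ are closed, and locally there are new independent variables with $d\tilde t^\beta=a^\beta_\gamma dt^\gamma$; along every such solution of the flows $R^i_{\tilde t^\beta}=\tilde\upsilon^i_\beta R^i_{\tilde t^1}$ the forms $A^\beta_\gamma d\tilde t^\gamma$ are closed, and locally there are variables with $dt^\beta=A^\beta_\gamma d\tilde t^\gamma$. Under a change of variables with $d\tilde t^\beta=a^\beta_\gamma dt^\gamma$ (equivalently $dt^\beta=A^\beta_\gamma d\tilde t^\gamma$), $R$ solves the linear flows if and only if it solves the flows $R^i_{\tilde t^\beta}=\tilde\upsilon^i_\beta R^i_{\tilde t^1}$, $1\le\beta\le n$. The flat metric $\sum_i (dR^i)^2/f^i(R^i)$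 transforms to $\sum_i \big(\sum_\nu A^\nu_1(\varepsilon^i)^{\nu-1}\big)^2(dR^i)^2/f^i(R^i)$, which is the metric in part 2. **2. Hamiltonian operators.** Let $I^1,\dots,I^n$ be open intervals and let $f^i$ be smooth, nowhere zero functions on $I^i$, arbitrary otherwise. On the set $D$ of points with $R^i\in I^i$ pairwise distinct consider the metric $$\sum_{i=1}^n g_{ii}(dR^i)^2=\sum_{i=1}^n\frac{(dR^i)^2}{\prod_{k\ne i}(R^i-R^k)^2\,f^i(R^i)} .$$ It satisfies $\partial_j\ln\sqrt{|g_{ii}|}=\partial_j\upsilon^i/(\upsilon^j-\upsilon^i)$ for $i\ne j$, where $\upsilon^i=\tilde\upsilon^i_2$. There are functions $c^\gamma_\beta$ on $D$, $1\le\beta,\gamma\le n-1$, with $$\partial_i c^\gamma_\beta=(n-\beta)(n-\gamma)\left[\tfrac12 (f^i)'(R^i)(R^i)^{2n-\beta-\gamma-2}+(n-\beta-1)f^i(R^i)(R^i)^{2n-\beta-\gamma-3}\right],$$ $$c^\gamma_\beta+c^\beta_\gamma=(n-\beta)(n-\gamma)\sum_k f^k(R^k)(R^k)^{2n-\beta-\gamma-2}$$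 (a power with coefficient $0$ is omitted). For any such functions put $$\tilde w^i_\beta=(n-\beta)\prod_{k\ne i}(R^i-R^k)\left[\tfrac12 (f^i)'(R^i)(R^i)^{n-\beta-1}+(n-\beta-1)f^i(R^i)(R^i)^{n-\beta-2}\right]-\sum_{\gamma=1}^{n-1}\tilde\upsilon^i_\gamma c^\gamma_\beta .$$ Then: (a) The flows with speeds $\tilde w_\beta$ $(1\le\beta\le n-1)$ commute with each other and with all the flows with speeds $\tilde\upsilon_\gamma$ $(1\le\gamma\le n)$. (b) The curvature tensor of the metric is $$R^{ij}_{kl}=\sum_{\beta=1}^{n-1}\left(\tilde\upsilon^i_\beta\tilde w^j_\beta+\tilde\upsilon^j_\beta\tilde w^i_\beta\right)\left(\delta^i_k\delta^j_l-\delta^i_l\delta^j_k\right).$$ (c) The nonlocal operator $$A^{ij}=g^{ii}\delta^{ij}\frac{d}{dx}-g^{ii}\Gamma^j_{ik}R^k_x+\sum_{\beta=1}^{n-1}\left[\tilde\upsilon^i_\beta R^i_x\Big(\frac d{dx}\Big)^{-1}\tilde w^j_\beta R^j_x+\tilde w^i_\beta R^i_x\Big(\frac d{dx}\Big)^{-1}\tilde\upsilon^j_\beta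 R^j_x\right],$$ with $\Gamma$ the Levi-Civita connection and $(d/dx)^{-1}=\frac12\big(\int_{-\infty}^x-\int_x^\infty\big)$, is Hamiltonian on smooth fields $R:\mathbb R\to D$: the bracket $\{R^i(x),R^j(y)\}=A^{ij}\delta(x-y)$, smeared with smooth compactly supported test functions, is skew-symmetric and satisfies the Jacobi identity. (d) The system $R^i_t=(R^i-\sum_m R^m)R^i_x$ is of the form $R^i_t=A^{ij}\partial_j h$ for some density $h(R)$, where $(d/dx)^{-1}$ of a total derivative $\partial_x P(R)$ is $P(R)$, up to a suitable constant of integration. (e) All these operators are mutually compatible: for any two families $f$, $\bar f$ of parameters on the same intervals, every linear combination of the corresponding operators is Hamiltonian in the sense of (c). -/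

import Mathlib

open scoped ContDiff

noncomputable section

namespace Hydro

/-- Points `(R^1, ..., R^n)`; also used for the independent variables `(t^1, ..., t^n)`. -/
abbrev Vec (n : ℕ) : Type := Fin n → ℝ

/-- Fields `x ↦ R(x)` and covector fields `x ↦ ψ(x)` on the line. -/
abbrev Field (n : ℕ) : Type := ℝ → Vec n

/-- The partial derivative `∂F/∂R^i` at `R`. -/
def pd {n : ℕ} (i : Fin n) (F : Vec n → ℝ) (R : Vec n) : ℝ :=
  fderiv ℝ F R (Pi.single i 1)

/-! ### Diagonal systems of hydrodynamic type -/

/-- The right hand side `v^i(R) R^i_x` of the diagonal system `R^i_t = v^i(R) R^i_x`. -/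
def velocity {n : ℕ} (v : Vec n → Vec n) (R : Field n) : Field n :=
  fun x i => v (R x) i * deriv (fun y => R y i) x

/-- Smooth fields with values in `D`. -/
def IsFieldIn {n : ℕ} (D : Set (Vec n)) (R : Field n) : Prop :=
  ContDiff ℝ ∞ R ∧ ∀ x, R x ∈ D

/-- The flows `R^i_t = v^i R^i_x` and `R^i_τ = w^i R^i_x` commute: `(R_t)_τ = (R_τ)_t`,
where each derivative is the derivative of one right hand side along the other. -/
def FlowsCommute {n : ℕ} (D : Set (Vec n)) (v w : Vec n → Vec n) : Prop :=
  ∀ R : Field n, IsFieldIn D R → ∀ (x : ℝ) (i : Fin n), ∃ d : ℝ,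
    HasDerivAt (fun s : ℝ => velocity w (R + s • velocity v R) x i) d 0 ∧
    HasDerivAt (fun s : ℝ => velocity v (R + s • velocity w R) x i) d 0

/-- Linear degeneracy `∂_i v^i = 0`. -/
def LinearlyDegenerate {n : ℕ} (v : Vec n → Vec n) : Prop :=
  ∀ (R : Vec n) (i : Fin n), pd i (fun S => v S i) R = 0

/-- The semi-Hamiltonian property on `D`, with the speeds `v^i` pairwise distinct there. -/
def SemiHamiltonian {n : ℕ} (D : Set (Vec n)) (v : Vec n → Vec n) : Prop :=
  ∀ R ∈ D, Function.Injective (v R) ∧ ∀ i j k : Fin n, i ≠ j → j ≠ k → i ≠ k →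
    pd k (fun S => pd j (fun T => v T i) S / (v S j - v S i)) R =
      pd j (fun S => pd k (fun T => v T i) S / (v S k - v S i)) R

/-- On `U`, the function `R` of `(t^1, ..., t^n)` solves
`∂R^i/∂t^β = v_β^i(R) ∂R^i/∂t^1` for `β = 1, ..., n`.
The elements `0, ..., n-1` of `Fin n` stand for the indices `1, ..., n` of the variables. -/
def SolvesFlows {n : ℕ} [NeZero n] (v : ℕ → Vec n → Vec n) (U : Set (Vec n))
    (R : Vec n → Vec n) : Prop :=
  ∀ t ∈ U, ∀ β i : Fin n,
    pd β (fun s => R s i) t = v (β + 1) (R t) i * pd 0 (fun s => R s i) t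

/-! ### The linear flows, the reciprocal transformation, the transformed flows -/

/-- Elementary symmetric functions: `∏_k (1 + z R^k) = ∑_β z^β h_β(R)`. -/
def elemSymm (n β : ℕ) (R : Vec n) : ℝ :=
  ∑ s ∈ Finset.powersetCard β (Finset.univ : Finset (Fin n)), ∏ k ∈ s, R k

theorem prod_one_add_eq_sum_elemSymm (n : ℕ) (z : ℝ) (R : Vec n) :
    ∏ k, (1 + z * R k) = ∑ β ∈ Finset.range (n + 1), z ^ β * elemSymm n β R := by
  rw [Finset.prod_one_add, Finset.sum_powerset, Finset.card_univ, Fintype.card_fin]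
  refine Finset.sum_congr rfl fun β _ => ?_
  rw [elemSymm, Finset.mul_sum]
  refine Finset.sum_congr rfl fun s hs => ?_
  rw [Finset.prod_mul_distrib, Finset.prod_const, (Finset.mem_powersetCard.mp hs).2]

/-- The product `∏_{k ≠ i} (R^i - R^k)`. -/
def diffProd {n : ℕ} (R : Vec n) (i : Fin n) : ℝ :=
  ∏ k ∈ Finset.univ.erase i, (R i - R k)

/-- Speeds `(ε^i)^(β-1)` of the linear flows. -/
def linSpeed {n : ℕ} (ε : Fin n → ℝ) (β : ℕ) (_R : Vec n) : Vec n :=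
  fun i => ε i ^ (β - 1)

/-- Speeds `v_β^i = (-1)^(β+1) ∂_i h_β`. -/
def speed (n β : ℕ) (R : Vec n) : Vec n :=
  fun i => (-1) ^ (β + 1) * pd i (elemSymm n β) R

/-- The coefficients `a^β_γ = ∑_k (ε^k)^(γ-1) (R^k)^(n-β)`; row `β`, column `γ`, both counted
from `0` in the code. -/
def recip {n : ℕ} (ε : Fin n → ℝ) (R : Vec n) : Matrix (Fin n) (Fin n) ℝ :=
  Matrix.of fun β γ => ∑ k, ε k ^ ((γ + 1 : ℕ) - 1) * R k ^ (n - (β + 1 : ℕ))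

/-- The coefficients `A^β_γ` of the inverse transformation,
`∑_k (-1)^(n+β+γ+1) (∂_k e_{n+1-β})(ε) / ∏_{m≠k} (ε^k-ε^m) * (∂_k h_γ)(R) / ∏_{s≠k} (R^k-R^s)`,
where `e` denotes the elementary symmetric functions of `ε^1, ..., ε^n`. -/
def recipInv {n : ℕ} (ε : Fin n → ℝ) (R : Vec n) : Matrix (Fin n) (Fin n) ℝ :=
  Matrix.of fun β γ => ∑ k, (-1) ^ (n + (β + 1 : ℕ) + (γ + 1 : ℕ) + 1) *
    (pd k (elemSymm n (n + 1 - (β + 1 : ℕ))) ε / diffProd ε k) *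
    (pd k (elemSymm n (γ + 1 : ℕ)) R / diffProd R k)

/-- The one-forms `∑_γ a^β_γ(R(t)) dt^γ` are closed on `U`. -/
def FormsClosed {n : ℕ} (a : Vec n → Matrix (Fin n) (Fin n) ℝ) (U : Set (Vec n))
    (R : Vec n → Vec n) : Prop :=
  ∀ t ∈ U, ∀ β γ δ : Fin n,
    pd δ (fun s => a (R s) β γ) t = pd γ (fun s => a (R s) β δ) t

/-- `Φ : t ↦ t'` is a change of independent variables with `dt'^β = ∑_γ a^β_γ(R(t)) dt^γ`. -/
def IsReciprocal {n : ℕ} (a : Vec n → Matrix (Fin n) (Fin n) ℝ) (R : Vec n → Vec n)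
    (Φ : OpenPartialHomeomorph (Vec n) (Vec n)) : Prop :=
  ∀ t ∈ Φ.source,
    HasFDerivAt Φ (LinearMap.toContinuousLinearMap (Matrix.toLin' (a (R t)))) t

/-! ### Hamiltonian operators -/

/-- Test covectors: smooth and compactly supported. -/
def IsTest {n : ℕ} (φ : Field n) : Prop :=
  ContDiff ℝ ∞ φ ∧ HasCompactSupport φ

/-- The bracket `{F_φ, F_ψ}(R) = ∫ ∑_i φ_i (A_R ψ)^i dx` of the functionals
`F_φ(R) = ∫ ∑_i φ_i R^i dx` and `F_ψ`, in other words
`{R^i(x), R^j(y)} = A^{ij} δ(x-y)` smeared with `φ` and `ψ`. -/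
def bracket {n : ℕ} (A : Field n → Field n → Field n) (R φ ψ : Field n) : ℝ :=
  ∫ x, ∑ i, φ x i * A R ψ x i

/-- `A` is a Hamiltonian operator on fields with values in `D`: linear on test covectors, with
smooth values, skew-symmetric, and with a bracket that satisfies the Jacobi identity. The bracket
`{{F_φ, F_ψ}, F_χ}` at `R` is the derivative of `{F_φ, F_ψ}` at `R` in the direction `A_R χ`. -/
def IsHamiltonian {n : ℕ} (D : Set (Vec n)) (A : Field n → Field n → Field n) : Prop :=
  ∀ R : Field n, IsFieldIn D R →
    (∀ ψ : Field n, IsTest ψ → ContDiff ℝ ∞ (A R ψ)) ∧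
    (∀ ψ χ : Field n, IsTest ψ → IsTest χ → ∀ p q : ℝ,
      A R (p • ψ + q • χ) = p • A R ψ + q • A R χ) ∧
    (∀ φ ψ : Field n, IsTest φ → IsTest ψ → bracket A R φ ψ = -bracket A R ψ φ) ∧
    (∀ φ ψ χ : Field n, IsTest φ → IsTest ψ → IsTest χ → ∃ a b c : ℝ,
      HasDerivAt (fun s : ℝ => bracket A (R + s • A R χ) φ ψ) a 0 ∧
      HasDerivAt (fun s : ℝ => bracket A (R + s • A R φ) ψ χ) b 0 ∧
      HasDerivAt (fun s : ℝ => bracket A (R + s • A R ψ) χ φ) c 0 ∧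
      a + b + c = 0)

/-- Compatibility: every linear combination is again Hamiltonian. -/
def Compatible {n : ℕ} (D : Set (Vec n)) (A B : Field n → Field n → Field n) : Prop :=
  ∀ p q : ℝ, IsHamiltonian D (fun R ψ => p • A R ψ + q • B R ψ)

/-- `(d/dx)⁻¹`, the skew-symmetric choice `½ (∫_{-∞}^x - ∫_x^∞)` with kernel `½ sgn(x - y)`. -/
def dInv (u : ℝ → ℝ) (x : ℝ) : ℝ :=
  (1 / 2) * ((∫ y in Set.Iic x, u y) - ∫ y in Set.Ioi x, u y)

/-! ### Metrics and their curvature, in coordinates -/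

/-- Christoffel symbols `Γ^j_{sk}` of the Levi-Civita connection of the metric `g_{ij}`. -/
def christoffel {n : ℕ} (g : Vec n → Matrix (Fin n) (Fin n) ℝ) (j s k : Fin n)
    (R : Vec n) : ℝ :=
  (1 / 2) * ∑ m, (g R)⁻¹ j m *
    (pd s (fun S => g S m k) R + pd k (fun S => g S m s) R - pd m (fun S => g S s k) R)

/-- The components `R^i_{skl}` defined by `R(∂_k, ∂_l) ∂_s = ∑_i R^i_{skl} ∂_i`. -/
def riemann {n : ℕ} (g : Vec n → Matrix (Fin n) (Fin n) ℝ) (i s k l : Fin n)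
    (R : Vec n) : ℝ :=
  pd k (christoffel g i l s) R - pd l (christoffel g i k s) R +
    ∑ m, (christoffel g i k m R * christoffel g m l s R -
      christoffel g i l m R * christoffel g m k s R)

/-- `R^{ij}_{kl}`, with the sign for which a metric of constant curvature `c` has
`R^{ij}_{kl} = c (δ^i_k δ^j_l - δ^i_l δ^j_k)`. -/
def curvature {n : ℕ} (g : Vec n → Matrix (Fin n) (Fin n) ℝ) (i j k l : Fin n)
    (R : Vec n) : ℝ :=
  ∑ s, (g R)⁻¹ j s * riemann g i s k l R

/-- `∇^i ∇_j h`. -/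
def hessian {n : ℕ} (g : Vec n → Matrix (Fin n) (Fin n) ℝ) (h : Vec n → ℝ) (i j : Fin n)
    (R : Vec n) : ℝ :=
  ∑ s, (g R)⁻¹ i s * (pd s (pd j h) R - ∑ m, christoffel g m s j R * pd m h R)

/-- The operator
`A^{ij} = g^{ij} d/dx - g^{is} Γ^j_{sk} R^k_x
  + ∑_{β=1}^m [v_β^i R^i_x (d/dx)⁻¹ w_β^j R^j_x + w_β^i R^i_x (d/dx)⁻¹ v_β^j R^j_x]`. -/
def nonlocalOp {n : ℕ} (g : Vec n → Matrix (Fin n) (Fin n) ℝ) (m : ℕ)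
    (v w : ℕ → Vec n → Vec n) : Field n → Field n → Field n :=
  fun R ψ x i =>
    (∑ j, (g (R x))⁻¹ i j * deriv (fun y => ψ y j) x) -
    (∑ j, ∑ s, ∑ k,
      (g (R x))⁻¹ i s * christoffel g j s k (R x) * deriv (fun y => R y k) x * ψ x j) +
    ∑ β ∈ Finset.Icc 1 m,
      (velocity (v β) R x i * dInv (fun y => ∑ j, velocity (w β) R y j * ψ y j) x +
       velocity (w β) R x i * dInv (fun y => ∑ j, velocity (v β) R y j * ψ y j) x)

/-- The system `R^i_t = u^i(R) R^i_x` is `R^i_t = ∑_j A^{ij} ∂_j h` for a density `h(R)`, where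
`A = nonlocalOp g m v w`. Here `(d/dx)⁻¹ (∑_j v_β^j R^j_x ∂_j h) = P_β` and
`(d/dx)⁻¹ (∑_j w_β^j R^j_x ∂_j h) = Q_β` for functions `P_β(R)`, `Q_β(R)` with
`∂_j P_β = v_β^j ∂_j h` and `∂_j Q_β = w_β^j ∂_j h`. -/
def IsHamiltonianSystem {n : ℕ} (D : Set (Vec n)) (g : Vec n → Matrix (Fin n) (Fin n) ℝ)
    (m : ℕ) (v w : ℕ → Vec n → Vec n) (u : Vec n → Vec n) : Prop :=
  ∃ (h : Vec n → ℝ) (P Q : ℕ → Vec n → ℝ),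
    ContDiffOn ℝ ∞ h D ∧
    (∀ β ∈ Finset.Icc 1 m, ContDiffOn ℝ ∞ (P β) D ∧ ContDiffOn ℝ ∞ (Q β) D ∧
      ∀ R ∈ D, ∀ j, pd j (P β) R = v β R j * pd j h R ∧ pd j (Q β) R = w β R j * pd j h R) ∧
    ∀ R ∈ D, ∀ i j, (if i = j then u R i else 0) =
      hessian g h i j R +
        if i = j then ∑ β ∈ Finset.Icc 1 m, (v β R i * Q β R + w β R i * P β R) else 0

/-! ### The family of operators -/

/-- Points with pairwise distinct coordinates `R^i ∈ I^i`. -/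
def domain {n : ℕ} (I : Fin n → Set ℝ) : Set (Vec n) :=
  {R | (∀ i, R i ∈ I i) ∧ Function.Injective R}

/-- Admissible functional parameters: each `f^i` is smooth and nowhere zero on the open
interval `I^i`. -/
def Admissible {n : ℕ} (I : Fin n → Set ℝ) (f : Fin n → ℝ → ℝ) : Prop :=
  ∀ i, ContDiffOn ℝ ∞ (f i) (I i) ∧ ∀ r ∈ I i, f i r ≠ 0

/-- The metric `∑_i (dR^i)^2 / (∏_{k≠i} (R^i - R^k)^2 f^i(R^i))`. -/
def metric {n : ℕ} (f : Fin n → ℝ → ℝ) (R : Vec n) : Matrix (Fin n) (Fin n) ℝ :=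
  Matrix.diagonal fun i => 1 / (diffProd R i ^ 2 * f i (R i))

/-- The functions `c β γ = c_β^γ`, `1 ≤ β, γ ≤ n - 1`, have the derivatives
`∂_i c_β^γ = (n-β)(n-γ) [½ f_i' (R^i)^(2n-β-γ-2) + (n-β-1) f_i (R^i)^(2n-β-γ-3)]` and the
normalization `c_β^γ + c_γ^β = ∑_k f_k (n-β)(n-γ) (R^k)^(2n-β-γ-2)`. -/
def IsFlux {n : ℕ} (D : Set (Vec n)) (f : Fin n → ℝ → ℝ) (c : ℕ → ℕ → Vec n → ℝ) : Prop :=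
  ∀ β ∈ Finset.Icc 1 (n - 1), ∀ γ ∈ Finset.Icc 1 (n - 1), ∀ R ∈ D,
    DifferentiableAt ℝ (c β γ) R ∧
    (∀ i, pd i (c β γ) R = ((n : ℝ) - β) * ((n : ℝ) - γ) *
      ((1 / 2) * deriv (f i) (R i) * R i ^ (2 * n - β - γ - 2) +
        ((n : ℝ) - β - 1) * f i (R i) * R i ^ (2 * n - β - γ - 3))) ∧
    c β γ R + c γ β R =
      ∑ k, f k (R k) * ((n : ℝ) - β) * ((n : ℝ) - γ) * R k ^ (2 * n - β - γ - 2)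

/-- `w_β^i = (n-β) ∏_{k≠i}(R^i-R^k) [½ f_i' (R^i)^(n-β-1) + (n-β-1) f_i (R^i)^(n-β-2)]
  - ∑_{γ=1}^{n-1} v_γ^i c_β^γ`. -/
def tailSpeed {n : ℕ} (f : Fin n → ℝ → ℝ) (c : ℕ → ℕ → Vec n → ℝ) (β : ℕ) (R : Vec n) :
    Vec n :=
  fun i => ((n : ℝ) - β) * diffProd R i *
      ((1 / 2) * deriv (f i) (R i) * R i ^ (n - β - 1) +
        ((n : ℝ) - β - 1) * f i (R i) * R i ^ (n - β - 2)) -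
    ∑ γ ∈ Finset.Icc 1 (n - 1), speed n γ R i * c β γ R

/-- The nonlocal operator with parameters `f` and `n - 1` pairs of tails. -/
def familyOp {n : ℕ} (f : Fin n → ℝ → ℝ) (c : ℕ → ℕ → Vec n → ℝ) :
    Field n → Field n → Field n :=
  nonlocalOp (metric f) (n - 1) (speed n) (tailSpeed f c)

end Hydro

end

/-! ### Elementary symmetric functions, the speeds and the nodal polynomials `∏_{k ≠ i} (z - R^k)`.
-/

namespace Hydro

open Finset

variable {n : ℕ}

/-! ### Partial derivatives -/

/-! Write `ω_i(z) = ∏_{k≠i} (z - R^k)`. Its coefficients are the speeds, `ω_i(z) = ∑_β v_β^i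
z^(n-β)` (`nodal_eq_sum`), so sums over `β` become values of `ω_i`, `ω_i'`, `ω_i''` at the nodes
`R^j`, that is, Lagrange interpolation (`sum_speed_mul_pow`, `sum_speed_mul_deriv`,
`sum_speed_mul_deriv2`). Differentiation kills the term `β = n`, whence `n - 1` pairs of tails.

Reciprocal transformation: `a` is a product of two Vandermonde matrices, one in `R` and one in `ε`,
and Lagrange interpolation inverts both. The chain rule then exchanges the two hierarchies
(`solvesFlows_iff`), and the changes of variables come from the Poincaré lemma and the inverse
function theorem.

Commutation: all speeds, including those of the tails, satisfy `(R^i - R^k) ∂_k v^i = v^k - v^i`,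
and any two solutions of this system commute (`flowsCommute_of_isInvolutive`). Curvature: only the
components with `{k, l} = {i, j}` survive; they match the tails because `c + cᵀ` is the Gram matrix
`∑_k f^k (z^(n-β))' (z^(n-γ))'` at the nodes.

Hamiltonian property: it is proved from a factorization. For a covector `ψ` let `p_β = (d/dx)⁻¹ ∑_j
v_β^j R^j_x ψ_j` and `P(z) = ∑_β p_β z^(n-β)`, and let the momenta be `Φ_i = ω_i(R^i) ψ_i +
P'(R^i)`; thus `R^i_x Φ_i` is the total derivative of `P(x, R^i(x))`. With the forces `η_i = (f^i
d/dx + ½ f^i_x) Φ_i` the operator is `(Aψ)^i = ω_i(R^i) η_i - R^i_x ∑_β v_β^i s_β`, where `s_β' =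
∑_l (n-β) (R^l)^(n-β-1) η_l` (`locOp_add_tails`, `hasDerivAt_shiftLoc`). The same weights occur in
`P'(R^l)`, so integration by parts turns the bracket into `∫ ∑_i Φ_i^φ (f^i d/dx + ½ f^i_x) Φ_i^ψ`
up to boundary terms (`bracket_eq`), and `f d/dx + ½ f_x` is skew.

For the Jacobi identity, the variation of this density along `Aχ` consists of a total derivative,
terms whose cyclic sum vanishes pointwise, and pairings of relative variations of momenta with
forces. After cyclic regrouping the latter form total derivatives (`sum_variation_sub`). Nonlocal
primitives do not vanish at the ends of the support: the boundary terms cancel through the symmetric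
part of `c`, and because `(d/dx)⁻¹` of a density supported in `[-L, L]` takes opposite values at
`±L`.

The factorized form is linear in `(f, c)` and its momenta do not involve `f`; `f ≠ 0` is needed only
to read it as a metric operator. Hence every linear combination is Hamiltonian, even where the
combined parameters vanish.

The system itself is the case where `P` is, up to its constant term, the Lagrange interpolation
polynomial of functions `κ_j` at the nodes; then `Φ_i = κ_i'(R^i)` (`mom_potential`), and an
ordinary differential equation for `κ_i` makes the forces constant multiples of `R^i_x`. -/

theorem pd_eq_of_hasDerivAt {F : Vec n → ℝ} {R : Vec n} {i : Fin n} {d : ℝ}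
    (hF : DifferentiableAt ℝ F R)
    (h : HasDerivAt (fun t : ℝ => F (R + t • Pi.single i 1)) d 0) : pd i F R = d := by
  have h1 : HasLineDerivAt ℝ F d R (Pi.single i 1) := h
  rw [pd, ← hF.lineDeriv_eq_fderiv, h1.lineDeriv]

theorem hasDerivAt_line {F : Vec n → ℝ} {R : Vec n} (hF : DifferentiableAt ℝ F R) (i : Fin n) :
    HasDerivAt (fun t : ℝ => F (R + t • Pi.single i 1)) (pd i F R) 0 :=
  hF.hasFDerivAt.hasLineDerivAt (Pi.single i 1)

theorem fderiv_eq_sum_pd (F : Vec n → ℝ) (R a : Vec n) :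
    fderiv ℝ F R a = ∑ i, pd i F R * a i := by
  conv_lhs => rw [← Finset.univ_sum_single a, map_sum]
  refine Finset.sum_congr rfl fun i _ => ?_
  rw [pd, mul_comm, ← smul_eq_mul, ← map_smul, ← Pi.single_smul, smul_eq_mul, mul_one]

theorem hasDerivAt_comp {F : Vec n → ℝ} {S : ℝ → Vec n} {a : Vec n} {x : ℝ}
    (hF : DifferentiableAt ℝ F (S x)) (hS : HasDerivAt S a x) :
    HasDerivAt (fun y => F (S y)) (∑ i, pd i F (S x) * a i) x := by
  rw [← fderiv_eq_sum_pd]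
  exact hF.hasFDerivAt.comp_hasDerivAt x hS

theorem pd_congr {F G : Vec n → ℝ} {R : Vec n} (h : F =ᶠ[nhds R] G) (i : Fin n) :
    pd i F R = pd i G R := by
  rw [pd, pd, h.fderiv_eq]

/-! ### Elementary symmetric functions of some of the variables -/

/-- The elementary symmetric functions of the variables with index in `s`. -/
def esymmOn (s : Finset (Fin n)) (β : ℕ) (R : Vec n) : ℝ :=
  ∑ t ∈ powersetCard β s, ∏ k ∈ t, R k

theorem esymmOn_zero (s : Finset (Fin n)) (R : Vec n) : esymmOn s 0 R = 1 := by
  simp [esymmOn]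

theorem esymmOn_succ {s : Finset (Fin n)} {i : Fin n} (hi : i ∈ s) (β : ℕ) (R : Vec n) :
    esymmOn s (β + 1) R = R i * esymmOn (s.erase i) β R + esymmOn (s.erase i) (β + 1) R := by
  have hs : insert i (s.erase i) = s := insert_erase hi
  have hni : i ∉ s.erase i := notMem_erase i s
  conv_lhs => rw [esymmOn, ← hs, powersetCard_succ_insert hni]
  rw [sum_union, add_comm]
  · congr 1
    rw [sum_image, esymmOn, mul_sum]
    · refine sum_congr rfl fun t ht => ?_
      rw [prod_insert fun h => hni ((mem_powersetCard.mp ht).1 h)]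
    · intro t ht t' ht' h
      have h1 : i ∉ t := fun h => hni ((mem_powersetCard.mp ht).1 h)
      have h2 : i ∉ t' := fun h => hni ((mem_powersetCard.mp ht').1 h)
      rw [← erase_insert h1, ← erase_insert h2, h]
  · rw [disjoint_left]
    intro t ht ht'
    obtain ⟨t', -, rfl⟩ := mem_image.mp ht'
    exact hni ((mem_powersetCard.mp ht).1 (mem_insert_self i t'))

theorem esymmOn_congr {s : Finset (Fin n)} {R S : Vec n} (h : ∀ k ∈ s, R k = S k) (β : ℕ) :
    esymmOn s β R = esymmOn s β S :=
  sum_congr rfl fun _ ht => prod_congr rfl fun k hk => h k ((mem_powersetCard.mp ht).1 hk)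

theorem contDiff_esymmOn (s : Finset (Fin n)) (β : ℕ) {m : WithTop ℕ∞} :
    ContDiff ℝ m (esymmOn s β : Vec n → ℝ) := by
  unfold esymmOn
  fun_prop

theorem pd_esymmOn_of_notMem {s : Finset (Fin n)} {i : Fin n} (hi : i ∉ s) (β : ℕ) (R : Vec n) :
    pd i (esymmOn s β) R = 0 := by
  refine pd_eq_of_hasDerivAt ((contDiff_esymmOn s β (m := 1)).differentiable one_ne_zero R) ?_
  have : (fun t : ℝ => esymmOn s β (R + t • Pi.single i 1)) = fun _ => esymmOn s β R := by
    funext t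
    refine esymmOn_congr (fun k hk => ?_) β
    have : k ≠ i := fun h => hi (h ▸ hk)
    simp [this]
  rw [this]
  exact hasDerivAt_const _ _

/-- An elementary symmetric function is affine in each variable, and the slope is read off from
`esymmOn_succ`. -/
theorem pd_esymmOn_succ {s : Finset (Fin n)} {i : Fin n} (hi : i ∈ s) (β : ℕ) (R : Vec n) :
    pd i (esymmOn s (β + 1)) R = esymmOn (s.erase i) β R := by
  refine pd_eq_of_hasDerivAt
    ((contDiff_esymmOn s (β + 1) (m := 1)).differentiable one_ne_zero R) ?_
  have : (fun t : ℝ => esymmOn s (β + 1) (R + t • Pi.single i 1)) =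
      fun t => (R i + t) * esymmOn (s.erase i) β R + esymmOn (s.erase i) (β + 1) R := by
    funext t
    have h : ∀ k ∈ s.erase i, (R + t • (Pi.single i 1 : Vec n)) k = R k := by
      intro k hk
      simp [ne_of_mem_erase hk]
    rw [esymmOn_succ hi, esymmOn_congr h, esymmOn_congr h]
    simp
  rw [this]
  have := (((hasDerivAt_id (0 : ℝ)).const_add (R i)).mul_const
    (esymmOn (s.erase i) β R)).add_const (esymmOn (s.erase i) (β + 1) R)
  simpa using this

theorem pd_esymmOn_zero (s : Finset (Fin n)) (i : Fin n) (R : Vec n) :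
    pd i (esymmOn s 0) R = 0 := by
  have : (esymmOn s 0 : Vec n → ℝ) = fun _ => 1 := funext fun R => esymmOn_zero s R
  simp [pd, this]

/-! ### The speeds -/

theorem elemSymm_eq (β : ℕ) : elemSymm n β = esymmOn univ β := rfl

theorem pd_elemSymm_succ (β : ℕ) (R : Vec n) (i : Fin n) :
    pd i (elemSymm n (β + 1)) R = esymmOn (univ.erase i) β R :=
  pd_esymmOn_succ (mem_univ i) β R

theorem speed_zero (R : Vec n) (i : Fin n) : speed n 0 R i = 0 := by
  rw [speed, elemSymm_eq, pd_esymmOn_zero, mul_zero]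

theorem speed_succ (β : ℕ) (R : Vec n) (i : Fin n) :
    speed n (β + 1) R i = (-1) ^ β * esymmOn (univ.erase i) β R := by
  rw [speed, pd_elemSymm_succ, pow_succ, pow_succ]
  ring

theorem speed_one (R : Vec n) (i : Fin n) : speed n 1 R i = 1 := by
  simp [speed_succ 0, esymmOn_zero]

theorem speed_two (R : Vec n) (i : Fin n) : speed n 2 R i = R i - ∑ m, R m := by
  rw [speed_succ 1, ← add_sum_erase univ R (mem_univ i)]
  simp [esymmOn, powersetCard_one]

theorem contDiff_speed (β : ℕ) (i : Fin n) {m : WithTop ℕ∞} :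
    ContDiff ℝ m (fun R : Vec n => speed n β R i) := by
  cases β with
  | zero => simpa only [speed_zero] using contDiff_const
  | succ β =>
    simp only [speed_succ]
    exact contDiff_const.mul (contDiff_esymmOn _ _)

theorem differentiable_speed (β : ℕ) (i : Fin n) :
    Differentiable ℝ (fun R : Vec n => speed n β R i) :=
  (contDiff_speed β i (m := 1)).differentiable one_ne_zero

theorem pd_const_mul {F : Vec n → ℝ} {R : Vec n} (hF : DifferentiableAt ℝ F R) (a : ℝ)
    (i : Fin n) : pd i (fun S => a * F S) R = a * pd i F R := by
  rw [pd, fderiv_const_mul hF, pd]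
  rfl

theorem pd_speed_succ (β : ℕ) (R : Vec n) (i k : Fin n) :
    pd k (fun S => speed n (β + 1) S i) R =
      (-1) ^ β * pd k (esymmOn (univ.erase i) β) R := by
  simp only [speed_succ]
  exact pd_const_mul ((contDiff_esymmOn _ β (m := 1)).differentiable one_ne_zero R) _ k

theorem linearlyDegenerate_speed (β : ℕ) : LinearlyDegenerate (speed n β) := by
  intro R i
  cases β with
  | zero => simp [speed_zero, pd]
  | succ β => rw [pd_speed_succ, pd_esymmOn_of_notMem (notMem_erase i univ), mul_zero]

/-- Splitting `R^k` off the symmetric function without `R^i`, and `R^i` off the one without `R^k`,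
leaves the same functions of the remaining variables. The form without division needs no distinct
coordinates, so the flows `speed n β` commute on the whole space. -/
theorem sub_mul_pd_speed (β : ℕ) (R : Vec n) (i k : Fin n) :
    (R i - R k) * pd k (fun S => speed n β S i) R = speed n β R k - speed n β R i := by
  rcases eq_or_ne k i with rfl | hki
  · simp
  rcases β with _ | _ | β
  · simp [speed_zero, pd]
  · simp [speed_one, pd]
  · have hk : k ∈ univ.erase i := mem_erase.mpr ⟨hki, mem_univ k⟩
    have hi : i ∈ univ.erase k := mem_erase.mpr ⟨hki.symm, mem_univ i⟩
    rw [pd_speed_succ, pd_esymmOn_succ hk, speed_succ, speed_succ, esymmOn_succ hk,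
      esymmOn_succ hi, erase_right_comm (a := k)]
    ring

/-- For `k = i` the convention `0⁻¹ = 0` agrees with linear degeneracy. The same convention lets
sums of `(R^i - R^k)⁻¹` run over all `k` below. -/
theorem pd_speed {R : Vec n} (hR : Function.Injective R) (β : ℕ) (i k : Fin n) :
    pd k (fun S => speed n β S i) R = (speed n β R k - speed n β R i) * (R i - R k)⁻¹ := by
  rcases eq_or_ne k i with rfl | hki
  · simpa using linearlyDegenerate_speed β R k
  · rw [← sub_mul_pd_speed]
    have : R i - R k ≠ 0 := sub_ne_zero.mpr fun h => hki (hR h).symm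
    field_simp

/-! ### The polynomials `∏_{k ≠ i} (z - R^k)` -/

open Polynomial in
/-- The polynomial `∏_{k ≠ i} (z - R^k)`. -/
noncomputable def nodal (R : Vec n) (i : Fin n) : ℝ[X] := ∏ k ∈ univ.erase i, (X - C (R k))

open Polynomial in
-- Vieta's formula: the signs `(-1)^(β+1)` in the speeds are those of the coefficients of a product
-- of `z - R^k`.
theorem nodal_eq_sum (R : Vec n) (i : Fin n) :
    nodal R i = ∑ β ∈ Icc 1 n, C (speed n β R i) * X ^ (n - β) := by
  have hn : 0 < n := i.pos
  have hcard : (univ.erase i).card = n - 1 := by simp [card_erase_of_mem (mem_univ i)]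
  have h0 : nodal R i = ∏ k ∈ univ.erase i, (X + C (-R k)) := by
    simp [nodal, sub_eq_add_neg]
  have hdeg : (nodal R i).natDegree = n - 1 := by
    rw [nodal, natDegree_finsetProd_X_sub_C_eq_card, hcard]
  rw [(nodal R i).as_sum_range_C_mul_X_pow, hdeg, Nat.sub_add_cancel hn]
  refine sum_bij' (fun m _ => n - m) (fun β _ => n - β) ?_ ?_ ?_ ?_ ?_
  · intro m hm; simp at hm ⊢; omega
  · intro m hm; simp at hm ⊢; omega
  · intro m hm; simp at hm ⊢; omega
  · intro m hm; simp at hm ⊢; omega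
  · intro m hm
    rw [mem_range] at hm
    have e : n - (n - m) = m := by omega
    simp only [e]
    congr 2
    obtain ⟨β, hβ⟩ : ∃ β, n - m = β + 1 := ⟨n - m - 1, by omega⟩
    have hb : n - 1 - m = β := by omega
    rw [hβ, speed_succ, h0, Finset.prod_X_add_C_coeff _ _ (by omega), hcard, hb, esymmOn, mul_sum]
    refine sum_congr rfl fun t ht => ?_
    rw [prod_neg, (mem_powersetCard.mp ht).2]

theorem eval_nodal (R : Vec n) (i : Fin n) (z : ℝ) :
    (nodal R i).eval z = ∏ k ∈ univ.erase i, (z - R k) := by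
  simp [nodal, Polynomial.eval_prod]

theorem eval_nodal_self (R : Vec n) (i : Fin n) : (nodal R i).eval (R i) = diffProd R i :=
  eval_nodal R i _

theorem eval_nodal_of_ne (R : Vec n) {i j : Fin n} (h : j ≠ i) : (nodal R i).eval (R j) = 0 := by
  rw [eval_nodal]
  exact prod_eq_zero (mem_erase.mpr ⟨h, mem_univ j⟩) (sub_self _)

theorem diffProd_ne_zero {R : Vec n} (hR : Function.Injective R) (i : Fin n) :
    diffProd R i ≠ 0 :=
  prod_ne_zero_iff.mpr fun _ hk => sub_ne_zero.mpr fun h => ne_of_mem_erase hk (hR h).symm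

/-- `ω_i` at `R^j`: the biorthogonality behind the inverses of both Vandermonde matrices. -/
theorem sum_speed_mul_pow (R : Vec n) (i j : Fin n) :
    ∑ β ∈ Icc 1 n, speed n β R i * R j ^ (n - β) = if i = j then diffProd R i else 0 := by
  have h : (nodal R i).eval (R j) = ∑ β ∈ Icc 1 n, speed n β R i * R j ^ (n - β) := by
    simp [nodal_eq_sum, Polynomial.eval_finsetSum]
  rw [← h]
  split_ifs with hij
  · rw [← hij, eval_nodal_self]
  · exact eval_nodal_of_ne R (Ne.symm hij)

theorem sum_Icc_pred_of_top {F : ℕ → ℝ} (hn : 0 < n) (h : F n = 0) :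
    ∑ β ∈ Icc 1 n, F β = ∑ β ∈ Icc 1 (n - 1), F β := by
  obtain ⟨m, rfl⟩ : ∃ m, n = m + 1 := ⟨n - 1, by omega⟩
  rw [sum_Icc_succ_top (by omega), h, add_zero, Nat.add_sub_cancel]

open Polynomial in
theorem eval_derivative_nodal (R : Vec n) (i : Fin n) (z : ℝ) :
    (derivative (nodal R i)).eval z =
      ∑ β ∈ Icc 1 (n - 1), speed n β R i * (((n : ℝ) - β) * z ^ (n - β - 1)) := by
  rw [nodal_eq_sum]
  simp only [derivative_sum, derivative_C_mul_X_pow, eval_finsetSum, eval_mul, eval_C, eval_pow,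
    eval_X]
  rw [sum_Icc_pred_of_top i.pos (by simp)]
  refine sum_congr rfl fun β hβ => ?_
  rw [Nat.cast_sub (by simp at hβ; omega)]
  ring

open Polynomial in
theorem eval_derivative2_nodal (R : Vec n) (i : Fin n) (z : ℝ) :
    (derivative (derivative (nodal R i))).eval z =
      ∑ β ∈ Icc 1 (n - 1), speed n β R i *
        (((n : ℝ) - β) * (((n : ℝ) - β - 1) * z ^ (n - β - 2))) := by
  rw [nodal_eq_sum]
  simp only [derivative_sum, derivative_C_mul_X_pow, eval_finsetSum, eval_mul, eval_C, eval_pow,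
    eval_X]
  rw [sum_Icc_pred_of_top i.pos (by simp)]
  refine sum_congr rfl fun β hβ => ?_
  have hb : 1 ≤ n - β := by simp at hβ; omega
  rw [Nat.cast_sub hb, Nat.cast_sub (by simp at hβ; omega), Nat.sub_sub]
  push_cast
  ring

open Polynomial in
theorem nodal_eq_mul (R : Vec n) {i j : Fin n} (h : j ≠ i) :
    nodal R i = (X - C (R j)) * ∏ k ∈ (univ.erase i).erase j, (X - C (R k)) := by
  exact (mul_prod_erase _ (fun k => X - C (R k)) (mem_erase.mpr ⟨h, mem_univ j⟩)).symm

theorem diffProd_eq_mul (R : Vec n) {i j : Fin n} (h : j ≠ i) :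
    diffProd R i = (R i - R j) * ∏ k ∈ (univ.erase i).erase j, (R i - R k) := by
  exact (mul_prod_erase _ (fun k => R i - R k) (mem_erase.mpr ⟨h, mem_univ j⟩)).symm

open Polynomial in
theorem eval_derivative_prod_X_sub_C (s : Finset (Fin n)) (R : Vec n) (z : ℝ)
    (h : ∀ k ∈ s, z ≠ R k) :
    (derivative (∏ k ∈ s, (X - C (R k)))).eval z =
      (∏ k ∈ s, (z - R k)) * ∑ k ∈ s, (z - R k)⁻¹ := by
  rw [derivative_prod_finset]
  simp only [eval_finsetSum, derivative_X_sub_C, mul_one, eval_prod, eval_sub, eval_X, eval_C]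
  rw [mul_sum]
  refine sum_congr rfl fun k hk => ?_
  rw [← mul_prod_erase s _ hk]
  have := sub_ne_zero.mpr (h k hk)
  field_simp

theorem sum_erase_inv (R : Vec n) (i : Fin n) :
    ∑ k ∈ univ.erase i, (R i - R k)⁻¹ = ∑ k, (R i - R k)⁻¹ :=
  sum_erase _ (by simp)

/-- This is `ω_i'(R^j)`. For `j ≠ i` only the factor `z - R^j` can be differentiated; for `j = i` it
is a logarithmic derivative. -/
theorem sum_speed_mul_deriv {R : Vec n} (hR : Function.Injective R) (i j : Fin n) :
    ∑ β ∈ Icc 1 (n - 1), speed n β R i * (((n : ℝ) - β) * R j ^ (n - β - 1)) =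
      diffProd R j * ((R j - R i)⁻¹ + if i = j then ∑ k, (R j - R k)⁻¹ else 0) := by
  rw [← eval_derivative_nodal]
  split_ifs with hij
  · subst hij
    rw [nodal, eval_derivative_prod_X_sub_C, sum_erase_inv]
    · simp [diffProd]
    · exact fun k hk h => ne_of_mem_erase hk (hR h).symm
  · have hji : j ≠ i := Ne.symm hij
    have h0 : R j - R i ≠ 0 := sub_ne_zero.mpr fun h => hji (hR h)
    rw [nodal_eq_mul R hji, diffProd_eq_mul R hij, erase_right_comm]
    simp [Polynomial.eval_prod]
    field_simp

/-- With `ω_i = (z - R^j) q`, the second derivative at `R^j` is `2 q'(R^j)`, again a logarithmic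
derivative. -/
theorem sum_speed_mul_deriv2 {R : Vec n} (hR : Function.Injective R) {i j : Fin n} (hij : i ≠ j) :
    ∑ β ∈ Icc 1 (n - 1), speed n β R i *
        (((n : ℝ) - β) * (((n : ℝ) - β - 1) * R j ^ (n - β - 2))) =
      2 * diffProd R j * (R j - R i)⁻¹ * (∑ k, (R j - R k)⁻¹ - (R j - R i)⁻¹) := by
  have hji : j ≠ i := hij.symm
  have h0 : R j - R i ≠ 0 := sub_ne_zero.mpr fun h => hji (hR h)
  rw [← eval_derivative2_nodal, nodal_eq_mul R hji, diffProd_eq_mul R hij, ← sum_erase_inv,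
    ← add_sum_erase _ _ (mem_erase.mpr ⟨hij, mem_univ i⟩), erase_right_comm]
  simp only [Polynomial.derivative_mul, Polynomial.derivative_X_sub_C, one_mul,
    Polynomial.derivative_add, Polynomial.eval_add, Polynomial.eval_mul, Polynomial.eval_sub,
    Polynomial.eval_X, Polynomial.eval_C, sub_self, zero_mul, add_zero]
  rw [eval_derivative_prod_X_sub_C]
  · field_simp
    ring
  · intro k hk h
    exact ne_of_mem_erase (mem_of_mem_erase hk) (hR h).symm

/-! ### The products `∏_{k ≠ i} (R^i - R^k)` -/

theorem contDiff_diffProd (i : Fin n) {m : WithTop ℕ∞} :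
    ContDiff ℝ m (fun R : Vec n => diffProd R i) := by
  unfold diffProd
  fun_prop

theorem differentiable_diffProd (i : Fin n) :
    Differentiable ℝ (fun R : Vec n => diffProd R i) :=
  (contDiff_diffProd i (m := 1)).differentiable one_ne_zero

theorem hasDerivAt_diffProd {S : ℝ → Vec n} {a : Vec n} {x : ℝ} (hS : HasDerivAt S a x)
    (hR : Function.Injective (S x)) (i : Fin n) :
    HasDerivAt (fun y => diffProd (S y) i)
      (diffProd (S x) i * ∑ k, (a i - a k) * (S x i - S x k)⁻¹) x := by
  have hS' := hasDerivAt_pi.mp hS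
  have h := HasDerivAt.fun_finsetProd (u := univ.erase i) (fun k _ => (hS' i).sub (hS' k))
  refine h.congr_deriv ?_
  rw [← sum_erase univ (a := i) (by simp), mul_sum]
  refine sum_congr rfl fun k hk => ?_
  have h0 : S x i - S x k ≠ 0 := sub_ne_zero.mpr fun h => ne_of_mem_erase hk (hR h).symm
  rw [diffProd, ← mul_prod_erase _ _ hk, smul_eq_mul]
  field_simp
  simp [mul_comm]

theorem pd_diffProd {R : Vec n} (hR : Function.Injective R) (i k : Fin n) :
    pd k (fun S => diffProd S i) R =
      diffProd R i * ((if i = k then ∑ m, (R i - R m)⁻¹ else 0) - (R i - R k)⁻¹) := by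
  refine pd_eq_of_hasDerivAt (differentiable_diffProd i R) ?_
  have h1 : HasDerivAt (fun t : ℝ => R + t • (Pi.single k 1 : Vec n)) (Pi.single k 1) 0 := by
    simpa using ((hasDerivAt_id (0 : ℝ)).smul_const (Pi.single k 1 : Vec n)).const_add R
  have h0 : R + (0 : ℝ) • (Pi.single k 1 : Vec n) = R := by simp
  have h2 := hasDerivAt_diffProd h1 (by rwa [h0]) i
  simp only [h0] at h2
  refine h2.congr_deriv ?_
  congr 1
  simp only [sub_mul, sum_sub_distrib, ← mul_sum]
  congr 1
  · rw [Pi.single_apply]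
    split_ifs <;> simp
  · simp [Pi.single_apply]

end Hydro

namespace Hydro

open Finset

variable {n : ℕ}

/-! ### The reciprocal transformation -/

theorem pd_comp {F : Vec n → ℝ} {R : Vec n → Vec n} {t : Vec n}
    (hF : DifferentiableAt ℝ F (R t)) (hR : DifferentiableAt ℝ R t) (δ : Fin n) :
    pd δ (fun s => F (R s)) t = ∑ j, pd j F (R t) * pd δ (fun s => R s j) t := by
  have h : HasFDerivAt (fun s => F (R s)) _ t := hF.hasFDerivAt.comp t hR.hasFDerivAt
  rw [pd, h.fderiv, ContinuousLinearMap.comp_apply, fderiv_eq_sum_pd]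
  refine sum_congr rfl fun j _ => ?_
  have hj := hasFDerivAt_pi'.mp hR.hasFDerivAt j
  rw [pd, pd, hj.fderiv]
  rfl

theorem sum_fin_add_one (F : ℕ → ℝ) : ∑ γ : Fin n, F (γ + 1) = ∑ β ∈ Icc 1 n, F β := by
  rw [Fin.sum_univ_eq_sum_range (fun m => F (m + 1)), range_eq_Ico, sum_Ico_add']
  rfl

theorem sum_fin_sub (F : ℕ → ℝ) : ∑ γ : Fin n, F (n - γ) = ∑ β ∈ Icc 1 n, F β := by
  rw [← sum_fin_add_one, ← Equiv.sum_comp Fin.revPerm]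
  refine sum_congr rfl fun γ _ => ?_
  rw [Fin.revPerm_apply, Fin.val_rev]
  congr 1
  omega

/-- The Vandermonde matrix of `ε`. -/
def vand (ε : Fin n → ℝ) : Matrix (Fin n) (Fin n) ℝ := Matrix.of fun k γ => ε k ^ (γ : ℕ)

/-- The inverse of `vand ε`. -/
noncomputable def vandInv (ε : Fin n → ℝ) : Matrix (Fin n) (Fin n) ℝ :=
  Matrix.of fun β k => speed n (n - β) ε k / diffProd ε k

/-- The matrix of the powers `(R^k)^(n-β)`. -/
def node (R : Vec n) : Matrix (Fin n) (Fin n) ℝ :=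
  Matrix.of fun β k => R k ^ (n - (β + 1 : ℕ))

/-- The inverse of `node R`. -/
noncomputable def nodeInv (R : Vec n) : Matrix (Fin n) (Fin n) ℝ :=
  Matrix.of fun k γ => speed n (γ + 1) R k / diffProd R k

theorem nodeInv_mul_node {R : Vec n} (hR : Function.Injective R) : nodeInv R * node R = 1 := by
  ext i j
  rw [Matrix.mul_apply, Matrix.one_apply]
  simp only [nodeInv, node, Matrix.of_apply]
  rw [sum_fin_add_one (fun β => speed n β R i / diffProd R i * R j ^ (n - β))]
  simp only [div_mul_eq_mul_div]
  rw [← sum_div, sum_speed_mul_pow]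
  have := diffProd_ne_zero hR i
  split_ifs <;> simp [this]

theorem vand_mul_vandInv {ε : Fin n → ℝ} (hε : Function.Injective ε) :
    vand ε * vandInv ε = 1 := by
  ext i j
  rw [Matrix.mul_apply, Matrix.one_apply]
  simp only [vand, vandInv, Matrix.of_apply]
  have h : ∀ γ : Fin n, ε i ^ (γ : ℕ) * (speed n (n - γ) ε j / diffProd ε j) =
      (fun β => speed n β ε j * ε i ^ (n - β) / diffProd ε j) (n - γ) := by
    intro γ
    have : n - (n - (γ : ℕ)) = γ := by omega
    simp only [this]
    ring
  rw [sum_congr rfl fun γ _ => h γ, sum_fin_sub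
    (fun β => speed n β ε j * ε i ^ (n - β) / diffProd ε j), ← sum_div, sum_speed_mul_pow]
  have := diffProd_ne_zero hε j
  by_cases hij : i = j
  · subst hij; simp [this]
  · simp [hij, Ne.symm hij]

/-- The two factors separate the roles of `R` and `ε`: what depends on the solution is `node R`,
with inverse `nodeInv R`, while `vand ε` is constant and diagonalizes the linear flows. -/
theorem recip_eq (ε : Fin n → ℝ) (R : Vec n) : recip ε R = node R * vand ε := by
  ext β γ
  rw [Matrix.mul_apply]
  simp [recip, node, vand, mul_comm]

theorem recipInv_eq (ε : Fin n → ℝ) (R : Vec n) : recipInv ε R = vandInv ε * nodeInv R := by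
  ext β γ
  rw [Matrix.mul_apply]
  simp only [recipInv, vandInv, nodeInv, Matrix.of_apply]
  refine sum_congr rfl fun k _ => ?_
  obtain ⟨m, hm⟩ : ∃ m, n - (β : ℕ) = m + 1 := ⟨n - β - 1, by omega⟩
  have e : n + 1 - ((β : ℕ) + 1) = m + 1 := by omega
  have e2 : n = β + m + 1 := by omega
  rw [e, hm, speed_succ, speed_succ, pd_elemSymm_succ, pd_elemSymm_succ]
  -- With `n = β + m + 1` the exponent is `m + γ` plus an even number, which splits the sign between
  -- the two factors.
  have h1 : (-1 : ℝ) ^ (n + ((β : ℕ) + 1) + ((γ : ℕ) + 1) + 1) = (-1) ^ m * (-1) ^ (γ : ℕ) := by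
    rw [← pow_add]
    have : n + ((β : ℕ) + 1) + ((γ : ℕ) + 1) + 1 = m + γ + 2 * (β + 2) := by omega
    rw [this, pow_add, pow_mul]
    simp
  rw [h1]
  ring

theorem recip_mul_recipInv {ε : Fin n → ℝ} (hε : Function.Injective ε) {R : Vec n}
    (hR : Function.Injective R) : recip ε R * recipInv ε R = 1 := by
  rw [recip_eq, recipInv_eq, Matrix.mul_assoc, ← Matrix.mul_assoc (vand ε), vand_mul_vandInv hε,
    Matrix.one_mul, mul_eq_one_comm]
  exact nodeInv_mul_node hR

theorem vand_mul_recipInv {ε : Fin n → ℝ} (hε : Function.Injective ε) (R : Vec n) :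
    vand ε * recipInv ε R = nodeInv R := by
  rw [recipInv_eq, ← Matrix.mul_assoc, vand_mul_vandInv hε, Matrix.one_mul]

theorem nodeInv_mul_recip (ε : Fin n → ℝ) {R : Vec n} (hR : Function.Injective R) :
    nodeInv R * recip ε R = vand ε := by
  rw [recip_eq, ← Matrix.mul_assoc, nodeInv_mul_node hR, Matrix.one_mul]

/-- The factor that multiplies `dR^i` is an entry of `vand ε * recipInv ε R = nodeInv R`; in the
first column it is `1 / ω_i(R^i)`. -/
theorem metric_eq_recipInv [NeZero n] {ε : Fin n → ℝ} (hε : Function.Injective ε)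
    (R : Vec n) (f : Fin n → ℝ → ℝ) (i : Fin n) :
    metric f R i i =
      (∑ ν : Fin n, recipInv ε R ν 0 * linSpeed ε (ν + 1) R i) ^ 2 / f i (R i) := by
  have h : ∑ ν : Fin n, recipInv ε R ν 0 * linSpeed ε (ν + 1) R i = nodeInv R i 0 := by
    rw [← vand_mul_recipInv hε, Matrix.mul_apply]
    refine sum_congr rfl fun ν _ => ?_
    rw [mul_comm]
    rfl
  have h1 : nodeInv R i 0 = 1 / diffProd R i := by simp [nodeInv, speed_one]
  rw [h, h1, metric, Matrix.diagonal_apply_eq, one_div_pow, div_div]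

/-- Along the linear flows the `δ`-derivative of the `γ`-th coefficient contains `γ` and `δ` only
through the symmetric product `ε_j^γ ε_j^δ` (indices from `0`). -/
theorem formsClosed_recip [NeZero n] {ε : Fin n → ℝ} {U : Set (Vec n)} {R : Vec n → Vec n}
    (hU : IsOpen U) (hR : ContDiffOn ℝ 1 R U) (h : SolvesFlows (linSpeed ε) U R) :
    FormsClosed (recip ε) U R := by
  intro t ht β γ δ
  have hd : DifferentiableAt ℝ R t :=
    (hR.contDiffAt (hU.mem_nhds ht)).differentiableAt one_ne_zero
  have key : ∀ γ δ : Fin n, pd δ (fun s => recip ε (R s) β γ) t =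
      ∑ j, ε j ^ (γ : ℕ) * ε j ^ (δ : ℕ) *
        (((n - (β + 1) : ℕ) : ℝ) * R t j ^ (n - (β + 1) - 1) * pd 0 (fun s => R s j) t) := by
    intro γ δ
    rw [pd_comp (F := fun S => recip ε S β γ) (by simp only [recip, Matrix.of_apply]; fun_prop) hd]
    refine sum_congr rfl fun j _ => ?_
    rw [h t ht δ j]
    have hp : pd j (fun S : Vec n => recip ε S β γ) (R t) =
        ε j ^ (γ : ℕ) * (((n - (β + 1) : ℕ) : ℝ) * R t j ^ (n - (β + 1) - 1)) := by
      refine pd_eq_of_hasDerivAt (by simp only [recip, Matrix.of_apply]; fun_prop) ?_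
      simp only [recip, Matrix.of_apply]
      have hk : ∀ k ∈ univ, HasDerivAt (fun u : ℝ => ε k ^ ((γ + 1 : ℕ) - 1) *
          (R t + u • (Pi.single j 1 : Vec n)) k ^ (n - (β + 1 : ℕ)))
          (ε k ^ (γ : ℕ) * (((n - (β + 1) : ℕ) : ℝ) * R t k ^ (n - (β + 1) - 1) *
            (Pi.single j 1 : Vec n) k)) 0 := by
        intro k _
        have h1 : HasDerivAt (fun u : ℝ => (R t + u • (Pi.single j 1 : Vec n)) k)
            ((Pi.single j 1 : Vec n) k) 0 := by
          simpa using ((hasDerivAt_id (0 : ℝ)).mul_const ((Pi.single j 1 : Vec n) k)).const_add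
            (R t k)
        have h2 := (h1.fun_pow (n - (β + 1 : ℕ))).const_mul (ε k ^ ((γ + 1 : ℕ) - 1))
        simpa using h2
      refine (HasDerivAt.fun_sum hk).congr_deriv ?_
      simp [Pi.single_apply]
    rw [hp, linSpeed, Nat.add_sub_cancel]
    ring
  rw [key, key]
  refine sum_congr rfl fun j _ => ?_
  ring

theorem contDiffAt_nodeInv {S : Vec n} (hS : Function.Injective S) (k γ : Fin n)
    {m : WithTop ℕ∞} : ContDiffAt ℝ m (fun S : Vec n => nodeInv S k γ) S := by
  simp only [nodeInv, Matrix.of_apply]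
  exact (contDiff_speed _ _).contDiffAt.div (contDiff_diffProd _).contDiffAt
    (diffProd_ne_zero hS k)

theorem contDiffAt_recip (ε : Fin n → ℝ) (S : Vec n) (β γ : Fin n) {m : WithTop ℕ∞} :
    ContDiffAt ℝ m (fun S : Vec n => recip ε S β γ) S := by
  simp only [recip, Matrix.of_apply]
  fun_prop

theorem contDiffAt_recipInv (ε : Fin n → ℝ) {S : Vec n} (hS : Function.Injective S) (β γ : Fin n)
    {m : WithTop ℕ∞} : ContDiffAt ℝ m (fun S : Vec n => recipInv ε S β γ) S := by
  simp only [recipInv_eq, Matrix.mul_apply]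
  exact ContDiffAt.sum fun k _ => contDiffAt_const.mul (contDiffAt_nodeInv hS k γ)

theorem pd_nodeInv {S : Vec n} (hS : Function.Injective S) (k γ j : Fin n) :
    pd j (fun S => nodeInv S k γ) S =
      (speed n (γ + 1) S j * (S k - S j)⁻¹ -
        if k = j then speed n (γ + 1) S k * ∑ m, (S k - S m)⁻¹ else 0) / diffProd S k := by
  have h0 := diffProd_ne_zero hS k
  have e : S + (0 : ℝ) • (Pi.single j 1 : Vec n) = S := by simp
  refine pd_eq_of_hasDerivAt ((contDiffAt_nodeInv hS k γ (m := 1)).differentiableAt one_ne_zero) ?_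
  have h1 := (hasDerivAt_line (differentiable_speed (γ + 1) k S) j).fun_div
    (hasDerivAt_line (differentiable_diffProd k S) j) (by rwa [e])
  refine h1.congr_deriv ?_
  rw [e, pd_speed hS, pd_diffProd hS]
  split_ifs <;> field_simp <;> ring

/-- By `pd_nodeInv`, `∂_j` of the entry of `nodeInv` in column `γ` is `v_γ^j` times a factor
independent of `γ`. Along the flows `∂_δ R^j` brings in `v_δ^j`, so the result is symmetric in `γ`
and `δ`. -/
theorem formsClosed_recipInv [NeZero n] (ε : Fin n → ℝ) {U : Set (Vec n)} {R : Vec n → Vec n}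
    (hU : IsOpen U) (hR : ContDiffOn ℝ 1 R U) (hinj : ∀ t ∈ U, Function.Injective (R t))
    (h : SolvesFlows (speed n) U R) :
    FormsClosed (recipInv ε) U R := by
  intro t ht β γ δ
  have hd : DifferentiableAt ℝ R t :=
    (hR.contDiffAt (hU.mem_nhds ht)).differentiableAt one_ne_zero
  have hn : ∀ k γ : Fin n, DifferentiableAt ℝ (fun S : Vec n => nodeInv S k γ) (R t) :=
    fun k γ => (contDiffAt_nodeInv (hinj t ht) k γ (m := 1)).differentiableAt one_ne_zero
  have key : ∀ γ δ k : Fin n, pd δ (fun s => nodeInv (R s) k γ) t =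
      pd γ (fun s => nodeInv (R s) k δ) t := by
    intro γ δ k
    rw [pd_comp (F := fun S => nodeInv S k γ) (hn k γ) hd,
      pd_comp (F := fun S => nodeInv S k δ) (hn k δ) hd]
    refine sum_congr rfl fun j _ => ?_
    rw [h t ht δ j, h t ht γ j, pd_nodeInv (hinj t ht), pd_nodeInv (hinj t ht)]
    split_ifs with hkj
    · subst hkj; ring
    · ring
  have hsum : ∀ γ δ : Fin n, pd δ (fun s => recipInv ε (R s) β γ) t =
      ∑ k, vandInv ε β k * pd δ (fun s => nodeInv (R s) k γ) t := by
    intro γ δ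
    have h1 : HasFDerivAt (fun s => ∑ k, vandInv ε β k * nodeInv (R s) k γ) _ t :=
      HasFDerivAt.fun_sum (u := univ) fun k _ =>
        (((hn k γ).hasFDerivAt.comp t hd.hasFDerivAt).differentiableAt.hasFDerivAt.const_mul
          (vandInv ε β k))
    have h2 : (fun s => recipInv ε (R s) β γ) =
        fun s => ∑ k, vandInv ε β k * nodeInv (R s) k γ := by
      funext s
      rw [recipInv_eq, Matrix.mul_apply]
    rw [h2, pd, h1.fderiv]
    simp only [_root_.sum_apply, _root_.smul_apply, smul_eq_mul]
    rfl
  rw [hsum, hsum]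
  exact sum_congr rfl fun k _ => by rw [key]

/-- A matrix as a continuous linear map. -/
noncomputable abbrev toCLM (M : Matrix (Fin n) (Fin n) ℝ) : Vec n →L[ℝ] Vec n :=
  LinearMap.toContinuousLinearMap (Matrix.toLin' M)

theorem toCLM_apply (M : Matrix (Fin n) (Fin n) ℝ) (x : Vec n) (β : Fin n) :
    toCLM M x β = ∑ γ, M β γ * x γ := by
  simp [toCLM, Matrix.mulVec, dotProduct]

theorem toCLM_mul_apply (M N : Matrix (Fin n) (Fin n) ℝ) (x : Vec n) :
    toCLM M (toCLM N x) = toCLM (M * N) x := by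
  simp [toCLM]

/-- An invertible matrix as a continuous linear equivalence. -/
noncomputable def toCLE {M N : Matrix (Fin n) (Fin n) ℝ} (h : M * N = 1) : Vec n ≃L[ℝ] Vec n :=
  ContinuousLinearEquiv.equivOfInverse (toCLM M) (toCLM N)
    (fun x => by rw [toCLM_mul_apply, mul_eq_one_comm.mp h]; simp [toCLM])
    (fun x => by rw [toCLM_mul_apply, h]; simp [toCLM])

/-- The Poincaré lemma on a ball gives the new variables. Their derivative is continuous and
invertible at `t`, so the inverse function theorem applies; restriction to the ball keeps the
derivative formula on the whole source. -/
theorem exists_isReciprocal {a b : Vec n → Matrix (Fin n) (Fin n) ℝ} {U : Set (Vec n)}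
    {R : Vec n → Vec n} (hU : IsOpen U) (hR : ContDiffOn ℝ 1 R U)
    (ha : ∀ t ∈ U, ∀ β γ, ContDiffAt ℝ 1 (fun S => a S β γ) (R t))
    (hab : ∀ t ∈ U, a (R t) * b (R t) = 1) (hcl : FormsClosed a U R) {t : Vec n} (ht : t ∈ U) :
    ∃ Φ : OpenPartialHomeomorph (Vec n) (Vec n),
      t ∈ Φ.source ∧ Φ.source ⊆ U ∧ IsReciprocal a R Φ := by
  obtain ⟨r, hr, hball⟩ := Metric.isOpen_iff.mp hU t ht
  have hdiff : ∀ s ∈ U, ∀ β γ, DifferentiableAt ℝ (fun s => a (R s) β γ) s := by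
    intro s hs β γ
    have h1 := (ha s hs β γ).differentiableAt one_ne_zero
    have h2 := (hR.contDiffAt (hU.mem_nhds hs)).differentiableAt one_ne_zero
    exact h1.comp s h2
  let w : Fin n → Vec n → (Vec n →L[ℝ] ℝ) := fun β s =>
    ∑ γ, a (R s) β γ • (ContinuousLinearMap.proj γ : Vec n →L[ℝ] ℝ)
  have hw' : ∀ β, ∃ F : Vec n → ℝ, ∀ s ∈ Metric.ball t r, HasFDerivAt F (w β s) s := by
    intro β
    have hder : ∀ s ∈ U, HasFDerivAt (w β)
        (∑ γ, (fderiv ℝ (fun s => a (R s) β γ) s).smulRight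
          (ContinuousLinearMap.proj γ : Vec n →L[ℝ] ℝ)) s := by
      intro s hs
      exact HasFDerivAt.fun_sum fun γ _ => (hdiff s hs β γ).hasFDerivAt.smul_const
        (ContinuousLinearMap.proj γ : Vec n →L[ℝ] ℝ)
    refine (convex_ball t r).exists_forall_hasFDerivAt_of_fderiv_symmetric Metric.isOpen_ball
      (fun s hs => (hder s (hball hs)).differentiableAt.differentiableWithinAt) ?_
    intro s hs x y
    rw [(hder s (hball hs)).fderiv]
    simp only [_root_.sum_apply, ContinuousLinearMap.smulRight_apply,
      _root_.smul_apply, ContinuousLinearMap.proj_apply, smul_eq_mul,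
      fderiv_eq_sum_pd, sum_mul]
    rw [sum_comm]
    refine sum_congr rfl fun δ _ => sum_congr rfl fun γ _ => ?_
    rw [hcl s (hball hs) β γ δ]
    ring
  choose F hF using hw'
  have hΦ : ∀ s ∈ Metric.ball t r, HasFDerivAt (fun s β => F β s) (toCLM (a (R s))) s := by
    intro s hs
    rw [hasFDerivAt_pi']
    intro β
    have h1 : (ContinuousLinearMap.proj β : Vec n →L[ℝ] ℝ).comp (toCLM (a (R s))) = w β s := by
      refine ContinuousLinearMap.ext fun x => ?_
      rw [ContinuousLinearMap.comp_apply, ContinuousLinearMap.proj_apply, toCLM_apply]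
      simp [w]
    rw [h1]
    exact hF β s hs
  have hcont : ContinuousAt (fun s => toCLM (a (R s))) t := by
    have h1 : ContinuousOn (fun s => toCLM (a (R s))) U := by
      rw [continuousOn_clm_apply]
      intro x
      rw [continuousOn_pi]
      intro β
      simp only [toCLM_apply]
      exact continuousOn_finsetSum _ fun γ _ => ContinuousOn.mul
        (fun s hs => (hdiff s hs β γ).continuousAt.continuousWithinAt) continuousOn_const
    exact h1.continuousAt (hU.mem_nhds ht)
  have hstrict : HasStrictFDerivAt (fun s β => F β s)
      ((toCLE (hab t ht) : Vec n ≃L[ℝ] Vec n) : Vec n →L[ℝ] Vec n) t :=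
    hasStrictFDerivAt_of_hasFDerivAt_of_continuousAt
      (Filter.eventually_of_mem (Metric.ball_mem_nhds t hr) hΦ) hcont
  refine ⟨(hstrict.toOpenPartialHomeomorph _).restrOpen _ (Metric.isOpen_ball (x := t) (ε := r)),
    ?_, ?_, ?_⟩
  · rw [OpenPartialHomeomorph.restrOpen_source]
    exact ⟨hstrict.mem_toOpenPartialHomeomorph_source, Metric.mem_ball_self hr⟩
  · rw [OpenPartialHomeomorph.restrOpen_source]
    exact fun s hs => hball hs.2
  · intro s hs
    rw [OpenPartialHomeomorph.restrOpen_source] at hs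
    exact hΦ s hs.2

theorem IsReciprocal.symm {a b : Vec n → Matrix (Fin n) (Fin n) ℝ} {R : Vec n → Vec n}
    {Φ : OpenPartialHomeomorph (Vec n) (Vec n)} (h : IsReciprocal a R Φ)
    (hab : ∀ t ∈ Φ.source, a (R t) * b (R t) = 1) : IsReciprocal b (R ∘ Φ.symm) Φ.symm := by
  intro t ht
  have hs : Φ.symm t ∈ Φ.source := Φ.map_target ht
  exact Φ.hasFDerivAt_symm (f' := toCLE (hab _ hs)) ht (h _ hs)

theorem pd_comp_map {R : Vec n → Vec n} {Ψ : Vec n → Vec n} {M : Matrix (Fin n) (Fin n) ℝ}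
    {t : Vec n} (hR : DifferentiableAt ℝ R (Ψ t)) (hΨ : HasFDerivAt Ψ (toCLM M) t)
    (γ i : Fin n) :
    pd γ (fun s => R (Ψ s) i) t = ∑ ν, pd ν (fun s => R s i) (Ψ t) * (M ν γ) := by
  have hRi : DifferentiableAt ℝ (fun s => R s i) (Ψ t) := differentiableAt_pi.mp hR i
  rw [pd_comp (F := fun s => R s i) hRi hΨ.differentiableAt]
  refine sum_congr rfl fun ν _ => ?_
  have hν := hasFDerivAt_pi'.mp hΨ ν
  have h1 : pd γ (fun s => Ψ s ν) t = M ν γ := by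
    unfold pd
    rw [hν.fderiv, ContinuousLinearMap.comp_apply, ContinuousLinearMap.proj_apply, toCLM_apply]
    simp [Pi.single_apply]
  rw [h1]

/-- For a solution of the linear flows the chain rule gives `∂R^i/∂t'^γ = R^i_{t^1} (vand ε *
recipInv ε R)_{iγ} = R^i_{t^1} v_γ^i / ω_i(R^i)`; since `v_1^i = 1`, the ratio to the first
derivative is `v_γ^i`. Conversely `nodeInv R * recip ε R = vand ε`, whose first column is `1`. -/
theorem solvesFlows_iff [NeZero n] {ε : Fin n → ℝ} (hε : Function.Injective ε)
    {Φ : OpenPartialHomeomorph (Vec n) (Vec n)} {R : Vec n → Vec n}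
    (hR : ContDiffOn ℝ 1 R Φ.source) (hinj : ∀ t ∈ Φ.source, Function.Injective (R t))
    (hΦ : IsReciprocal (recip ε) R Φ) :
    SolvesFlows (linSpeed ε) Φ.source R ↔ SolvesFlows (speed n) Φ.target (R ∘ Φ.symm) := by
  have hsymm : IsReciprocal (recipInv ε) (R ∘ Φ.symm) Φ.symm :=
    hΦ.symm fun t ht => recip_mul_recipInv hε (hinj t ht)
  have hd : ∀ t ∈ Φ.source, DifferentiableAt ℝ R t := fun t ht =>
    (hR.contDiffAt (Φ.open_source.mem_nhds ht)).differentiableAt one_ne_zero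
  constructor
  · intro h t ht β i
    have hs : Φ.symm t ∈ Φ.source := Φ.map_target ht
    have key : ∀ γ : Fin n, pd γ (fun s => (R ∘ Φ.symm) s i) t =
        pd 0 (fun s => R s i) (Φ.symm t) * nodeInv (R (Φ.symm t)) i γ := by
      intro γ
      refine (pd_comp_map (hd _ hs) (hsymm t ht) γ i).trans ?_
      rw [← vand_mul_recipInv hε, Matrix.mul_apply, mul_sum]
      refine sum_congr rfl fun ν _ => ?_
      rw [h _ hs ν i, linSpeed, Nat.add_sub_cancel]
      simp only [vand, Matrix.of_apply, Function.comp_apply]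
      ring
    rw [key, key]
    simp only [nodeInv, Matrix.of_apply, Fin.val_zero, zero_add, speed_one, Function.comp_apply]
    ring
  · intro h t ht β i
    have hs : Φ t ∈ Φ.target := Φ.map_source ht
    have hd' : DifferentiableAt ℝ (R ∘ Φ.symm) (Φ t) := by
      have h1 := (hsymm _ hs).differentiableAt
      refine DifferentiableAt.comp _ ?_ h1
      rw [Φ.left_inv ht]
      exact hd t ht
    have hloc : ∀ γ : Fin n, pd γ (fun s => R s i) t =
        pd γ (fun s => (R ∘ Φ.symm) (Φ s) i) t := by
      intro γ
      refine pd_congr ?_ γ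
      filter_upwards [Φ.open_source.mem_nhds ht] with s hs
      simp [Φ.left_inv hs]
    have key : ∀ γ : Fin n, pd γ (fun s => R s i) t =
        pd 0 (fun s => (R ∘ Φ.symm) s i) (Φ t) * diffProd (R t) i * vand ε i γ := by
      intro γ
      rw [hloc, pd_comp_map hd' (hΦ t ht) γ i, ← nodeInv_mul_recip ε (hinj t ht),
        Matrix.mul_apply, mul_sum]
      refine sum_congr rfl fun ν _ => ?_
      rw [h _ hs ν i]
      have := diffProd_ne_zero (hinj t ht) i
      simp only [nodeInv, Matrix.of_apply, Function.comp_apply, Φ.left_inv ht]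
      field_simp
    rw [key, key]
    simp only [vand, Matrix.of_apply, Fin.val_zero, pow_zero, linSpeed, Nat.add_sub_cancel]
    ring

end Hydro

/-! ### Commuting flows, the semi-Hamiltonian property, existence and smoothness of the functions
`c`. -/

namespace Hydro

open Finset

variable {n : ℕ}

/-! ### Commuting flows -/

theorem IsFieldIn.differentiable {D : Set (Vec n)} {R : Field n} (hR : IsFieldIn D R) :
    Differentiable ℝ R :=
  hR.1.differentiable (by simp)

theorem contDiff_deriv_apply {R : Field n} (hR : ContDiff ℝ ∞ R) (i : Fin n) :
    ContDiff ℝ ∞ (deriv fun y => R y i) :=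
  (contDiff_infty_iff_deriv.mp (contDiff_pi.mp hR i)).2

theorem deriv_line_apply {R ξ : Field n} (hR : Differentiable ℝ R) {x : ℝ} {i : Fin n}
    (hξ : DifferentiableAt ℝ (fun y => ξ y i) x) (s : ℝ) :
    deriv (fun y => (R + s • ξ) y i) x = deriv (fun y => R y i) x + s * deriv (fun y => ξ y i) x :=
  ((differentiableAt_pi.mp (hR x) i).hasDerivAt.add (hξ.hasDerivAt.const_mul s)).deriv

theorem hasDerivAt_line_apply (R ξ : Field n) (x : ℝ) (s : ℝ) :
    HasDerivAt (fun s : ℝ => (R + s • ξ) x) (ξ x) s := by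
  simpa using ((hasDerivAt_id s).smul_const (ξ x)).const_add (R x)

/-- The speeds satisfy `(R^i - R^k) ∂_k v^i = v^k - v^i` on `D`. -/
def IsInvolutive (D : Set (Vec n)) (v : Vec n → Vec n) : Prop :=
  ∀ R ∈ D, ∀ i, DifferentiableAt ℝ (fun S => v S i) R ∧
    ∀ k, (R i - R k) * pd k (fun S => v S i) R = v R k - v R i

theorem hasDerivAt_velocity {D : Set (Vec n)} {v w : Vec n → Vec n} (hv : IsInvolutive D v)
    (hw : IsInvolutive D w) {R : Field n} (hR : IsFieldIn D R) (x : ℝ) (i : Fin n) :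
    HasDerivAt (fun s : ℝ => velocity w (R + s • velocity v R) x i)
      ((∑ k, pd k (fun S => w S i) (R x) * velocity v R x k) * deriv (fun y => R y i) x +
        w (R x) i * ((∑ k, pd k (fun S => v S i) (R x) * deriv (fun y => R y k) x) *
          deriv (fun y => R y i) x + v (R x) i * deriv (deriv fun y => R y i) x)) 0 := by
  have hd := hR.differentiable
  have hRi : ∀ i, HasDerivAt (fun y => R y i) (deriv (fun y => R y i) x) x := fun i =>
    (differentiableAt_pi.mp (hd x) i).hasDerivAt
  have hR2 : HasDerivAt (deriv fun y => R y i) (deriv (deriv fun y => R y i) x) x :=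
    ((contDiff_deriv_apply hR.1 i).differentiable (by simp) x).hasDerivAt
  have hV : HasDerivAt (fun y => velocity v R y i)
      ((∑ k, pd k (fun S => v S i) (R x) * deriv (fun y => R y k) x) *
          deriv (fun y => R y i) x + v (R x) i * deriv (deriv fun y => R y i) x) x :=
    (hasDerivAt_comp (hv _ (hR.2 x) i).1 (hasDerivAt_pi.mpr hRi)).mul hR2
  have h0 : (R + (0 : ℝ) • velocity v R) x = R x := by simp
  have h1 := hasDerivAt_comp (S := fun s : ℝ => (R + s • velocity v R) x)
    (F := fun S => w S i) (x := 0) (by rw [h0]; exact (hw _ (hR.2 x) i).1)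
    (hasDerivAt_line_apply R _ x 0)
  have h2 : HasDerivAt (fun s : ℝ => deriv (fun y => (R + s • velocity v R) y i) x)
      (deriv (fun y => velocity v R y i) x) 0 := by
    simp only [deriv_line_apply hd hV.differentiableAt]
    simpa using ((hasDerivAt_id (0 : ℝ)).mul_const
      (deriv (fun y => velocity v R y i) x)).const_add (deriv (fun y => R y i) x)
  refine (h1.mul h2).congr_deriv ?_
  simp only [h0, hV.deriv]
  simp

/-- The second derivatives of `R` enter both mixed derivatives as `v^i w^i R^i_xx`. What remains is
`∂_k v^i (w^k - w^i) = ∂_k w^i (v^k - v^i)`, and by involutivity both sides are `(R^i - R^k) ∂_k v^i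
∂_k w^i`. -/
theorem flowsCommute_of_isInvolutive {D : Set (Vec n)} {v w : Vec n → Vec n}
    (hv : IsInvolutive D v) (hw : IsInvolutive D w) : FlowsCommute D v w := by
  intro R hR x i
  refine ⟨_, hasDerivAt_velocity hv hw hR x i, (hasDerivAt_velocity hw hv hR x i).congr_deriv ?_⟩
  have key : ∀ k, pd k (fun S => v S i) (R x) * (w (R x) k - w (R x) i) =
      pd k (fun S => w S i) (R x) * (v (R x) k - v (R x) i) := by
    intro k
    rw [← ((hw _ (hR.2 x) i).2 k), ← ((hv _ (hR.2 x) i).2 k)]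
    ring
  have h : ∑ k, pd k (fun S => v S i) (R x) * (w (R x) k - w (R x) i) * deriv (fun y => R y k) x =
      ∑ k, pd k (fun S => w S i) (R x) * (v (R x) k - v (R x) i) * deriv (fun y => R y k) x :=
    sum_congr rfl fun k _ => by rw [key]
  simp only [mul_sub, sub_mul, sum_sub_distrib] at h
  have e : ∀ a b : Vec n → Vec n, ∑ k, pd k (fun S => a S i) (R x) * velocity b R x k =
      ∑ k, pd k (fun S => a S i) (R x) * b (R x) k * deriv (fun y => R y k) x :=
    fun a b => sum_congr rfl fun k _ => by rw [velocity]; ring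
  have e2 : ∀ a b : Vec n → Vec n, ∑ k, pd k (fun S => a S i) (R x) * b (R x) i *
      deriv (fun y => R y k) x =
      b (R x) i * ∑ k, pd k (fun S => a S i) (R x) * deriv (fun y => R y k) x := fun a b => by
    rw [mul_sum]
    exact sum_congr rfl fun k _ => by ring
  rw [e2, e2] at h
  rw [e, e]
  linear_combination (deriv (fun y => R y i) x) * h

theorem isInvolutive_speed (D : Set (Vec n)) (β : ℕ) : IsInvolutive D (speed n β) :=
  fun R _ i => ⟨differentiable_speed β i R, fun k => sub_mul_pd_speed β R i k⟩

theorem flowsCommute_speed (D : Set (Vec n)) (β γ : ℕ) :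
    FlowsCommute D (speed n β) (speed n γ) :=
  flowsCommute_of_isInvolutive (isInvolutive_speed D β) (isInvolutive_speed D γ)

/-! ### The semi-Hamiltonian property -/

theorem speed_two_sub (R : Vec n) (i j : Fin n) :
    speed n 2 R j - speed n 2 R i = R j - R i := by
  rw [speed_two, speed_two]
  ring

theorem isOpen_injective : IsOpen {R : Vec n | Function.Injective R} := by
  have : {R : Vec n | Function.Injective R} =
      ⋂ i : Fin n, ⋂ j : Fin n, {R | i ≠ j → R i ≠ R j} := by
    ext R
    simp only [Set.mem_ofPred_eq, Set.mem_iInter]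
    exact ⟨fun h i j hij e => hij (h e), fun h i j e => by_contra fun hij => h i j hij e⟩
  rw [this]
  refine isOpen_iInter_of_finite fun i => isOpen_iInter_of_finite fun j => ?_
  by_cases hij : i = j
  · simp [hij]
  · simp only [ne_eq, hij, not_false_eq_true, true_implies]
    exact isOpen_ne_fun (continuous_apply i) (continuous_apply j)

theorem pd_speed_two {R : Vec n} {i j : Fin n} (hij : i ≠ j) :
    pd j (fun T => speed n 2 T i) R = -1 := by
  have hd := differentiable_speed (n := n) 2 i R
  refine pd_eq_of_hasDerivAt hd ?_
  simp only [speed_two]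
  have h := ((hasDerivAt_id (0 : ℝ)).const_sub (R i - ∑ m, R m))
  refine h.congr_of_eventuallyEq (Filter.Eventually.of_forall fun t => ?_)
  simp only [Pi.add_apply, Pi.smul_apply, smul_eq_mul, sum_add_distrib, ← mul_sum,
    Pi.single_apply, sum_ite_eq', mem_univ, if_true, hij, if_false, id]
  ring

/-- The quotient is `-1 / (R^a - R^i)`, which does not depend on a third coordinate. -/
theorem semiHamiltonian_speed_two :
    SemiHamiltonian {R : Vec n | Function.Injective R} (speed n 2) := by
  intro R hR
  refine ⟨fun i j h => hR ?_, fun i j k hij hjk hik => ?_⟩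
  · have := speed_two_sub R j i
    rw [h, sub_self] at this
    linarith
  · have key : ∀ a b : Fin n, i ≠ a → i ≠ b → a ≠ b → pd b (fun S =>
        pd a (fun T => speed n 2 T i) S / (speed n 2 S a - speed n 2 S i)) R = 0 := by
      intro a b hia hib hab
      have h0 : R a - R i ≠ 0 := sub_ne_zero.mpr fun h => hia (hR h).symm
      simp only [pd_speed_two hia, speed_two_sub]
      refine pd_eq_of_hasDerivAt ?_ ?_
      · simp only [div_eq_mul_inv]
        exact (DifferentiableAt.fun_inv (h := fun S : Vec n => S a - S i) (by fun_prop) h0).const_mul _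
      · have : (fun t : ℝ => (-1 : ℝ) / ((R + t • (Pi.single b 1 : Vec n)) a -
            (R + t • (Pi.single b 1 : Vec n)) i)) = fun _ => -1 / (R a - R i) := by
          funext t
          simp [hab, hib]
        rw [this]
        exact hasDerivAt_const _ _
    rw [key j k hij hik hjk, key k j hik hij hjk.symm]

/-! ### The domain and the functions `c` -/

theorem isOpen_domain {I : Fin n → Set ℝ} (hI : ∀ i, IsOpen (I i)) : IsOpen (domain I) := by
  have : domain I = Set.univ.pi I ∩ {R : Vec n | Function.Injective R} := by
    ext R
    simp [domain]
  rw [this]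
  exact (isOpen_set_pi Set.finite_univ fun i _ => hI i).inter isOpen_injective

/-- The local part of the tail speeds, as a function of one variable. -/
noncomputable def tailLoc (n : ℕ) (f : ℝ → ℝ) (β : ℕ) (r : ℝ) : ℝ :=
  ((n : ℝ) - β) * ((1 / 2) * deriv f r * r ^ (n - β - 1) +
    ((n : ℝ) - β - 1) * f r * r ^ (n - β - 2))

theorem tailSpeed_eq (f : Fin n → ℝ → ℝ) (c : ℕ → ℕ → Vec n → ℝ) (β : ℕ) (R : Vec n)
    (i : Fin n) :
    tailSpeed f c β R i = diffProd R i * tailLoc n (f i) β (R i) -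
      ∑ γ ∈ Icc 1 (n - 1), speed n γ R i * c β γ R := by
  rw [tailSpeed, tailLoc]
  ring

/-- The dependence on `β` and on `γ` factorizes, and the factor with `γ` is the derivative of
`z^(n-γ)`. Summation against `v_γ^i` therefore produces `ω_i'(R^k)`. -/
theorem IsFlux.pd_eq {D : Set (Vec n)} {f : Fin n → ℝ → ℝ} {c : ℕ → ℕ → Vec n → ℝ}
    (hc : IsFlux D f c) {β γ : ℕ} (hβ : β ∈ Icc 1 (n - 1)) (hγ : γ ∈ Icc 1 (n - 1)) {R : Vec n}
    (hR : R ∈ D) (i : Fin n) :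
    pd i (c β γ) R = tailLoc n (f i) β (R i) * (((n : ℝ) - γ) * R i ^ (n - γ - 1)) := by
  rw [(hc β hβ γ hγ R hR).2.1 i, tailLoc]
  rw [mem_Icc] at hβ hγ
  have e1 : 2 * n - β - γ - 2 = (n - β - 1) + (n - γ - 1) := by omega
  rw [e1, pow_add]
  -- For `β = n - 1` the exponents with the larger subtraction are truncated, but their coefficient
  -- `n - β - 1` is zero.
  by_cases h : β + 1 = n
  · have : (n : ℝ) - β - 1 = 0 := by rw [← h]; push_cast; ring
    rw [this]
    ring
  · have e2 : 2 * n - β - γ - 3 = (n - β - 2) + (n - γ - 1) := by omega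
    rw [e2, pow_add]
    ring

/-- The symmetric part of `c`. -/
theorem IsFlux.symm_eq {D : Set (Vec n)} {f : Fin n → ℝ → ℝ} {c : ℕ → ℕ → Vec n → ℝ}
    (hc : IsFlux D f c) {β γ : ℕ} (hβ : β ∈ Icc 1 (n - 1)) (hγ : γ ∈ Icc 1 (n - 1)) {R : Vec n}
    (hR : R ∈ D) : c β γ R + c γ β R =
      ∑ k, f k (R k) * (((n : ℝ) - β) * R k ^ (n - β - 1)) *
        (((n : ℝ) - γ) * R k ^ (n - γ - 1)) := by
  rw [(hc β hβ γ hγ R hR).2.2]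
  rw [mem_Icc] at hβ hγ
  refine sum_congr rfl fun k _ => ?_
  have e1 : 2 * n - β - γ - 2 = (n - β - 1) + (n - γ - 1) := by omega
  rw [e1, pow_add]
  ring

/-- `IsFlux` assumes only differentiability; this recovers smoothness of `c` from its prescribed
derivatives. -/
theorem contDiffOn_of_pd {D : Set (Vec n)} (hD : IsOpen D) {F : Vec n → ℝ}
    (hF : ∀ R ∈ D, DifferentiableAt ℝ F R) (h : ∀ i, ContDiffOn ℝ ∞ (pd i F) D) :
    ContDiffOn ℝ ∞ F D := by
  rw [contDiffOn_infty_iff_fderiv_of_isOpen hD]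
  refine ⟨fun R hR => (hF R hR).differentiableWithinAt, ?_⟩
  have : fderiv ℝ F = fun R => ∑ i, pd i F R • (ContinuousLinearMap.proj i : Vec n →L[ℝ] ℝ) := by
    funext R
    refine ContinuousLinearMap.ext fun a => ?_
    rw [fderiv_eq_sum_pd]
    simp
  rw [this]
  exact ContDiffOn.sum fun i _ => (h i).smul contDiffOn_const

theorem ContDiffOn.comp_apply_domain {I : Fin n → Set ℝ} {g : ℝ → ℝ} {i : Fin n}
    (hg : ContDiffOn ℝ ∞ g (I i)) : ContDiffOn ℝ ∞ (fun R : Vec n => g (R i)) (domain I) :=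
  hg.comp (contDiff_apply ℝ ℝ i).contDiffOn fun _ hR => hR.1 i

theorem contDiffOn_deriv {J : Set ℝ} (hJ : IsOpen J) {g : ℝ → ℝ} (hg : ContDiffOn ℝ ∞ g J) :
    ContDiffOn ℝ ∞ (deriv g) J :=
  ((contDiffOn_infty_iff_deriv_of_isOpen hJ).mp hg).2

theorem contDiffOn_tailLoc {J : Set ℝ} (hJ : IsOpen J) {g : ℝ → ℝ} (hg : ContDiffOn ℝ ∞ g J)
    (β : ℕ) : ContDiffOn ℝ ∞ (tailLoc n g β) J := by
  have := contDiffOn_deriv hJ hg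
  unfold tailLoc
  fun_prop

theorem IsFlux.contDiffOn {I : Fin n → Set ℝ} (hI : ∀ i, IsOpen (I i)) {f : Fin n → ℝ → ℝ}
    (hf : ∀ i, ContDiffOn ℝ ∞ (f i) (I i)) {c : ℕ → ℕ → Vec n → ℝ} (hc : IsFlux (domain I) f c)
    {β γ : ℕ} (hβ : β ∈ Icc 1 (n - 1)) (hγ : γ ∈ Icc 1 (n - 1)) :
    ContDiffOn ℝ ∞ (c β γ) (domain I) := by
  refine contDiffOn_of_pd (isOpen_domain hI) (fun R hR => (hc β hβ γ hγ R hR).1) fun i => ?_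
  have h1 : ContDiffOn ℝ ∞ (fun R : Vec n => tailLoc n (f i) β (R i) *
      (((n : ℝ) - γ) * R i ^ (n - γ - 1))) (domain I) :=
    (ContDiffOn.comp_apply_domain (contDiffOn_tailLoc (hI i) (hf i) β)).mul
      (by fun_prop)
  exact h1.congr fun R hR => hc.pd_eq hβ hγ hR i

theorem contDiffOn_tailSpeed {I : Fin n → Set ℝ} (hI : ∀ i, IsOpen (I i)) {f : Fin n → ℝ → ℝ}
    (hf : ∀ i, ContDiffOn ℝ ∞ (f i) (I i)) {c : ℕ → ℕ → Vec n → ℝ} (hc : IsFlux (domain I) f c)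
    {β : ℕ} (hβ : β ∈ Icc 1 (n - 1)) (i : Fin n) :
    ContDiffOn ℝ ∞ (fun R => tailSpeed f c β R i) (domain I) := by
  simp only [tailSpeed_eq]
  refine ((contDiff_diffProd i).contDiffOn.mul
    (ContDiffOn.comp_apply_domain (contDiffOn_tailLoc (hI i) (hf i) β))).sub ?_
  exact ContDiffOn.sum fun γ hγ => (contDiff_speed γ i).contDiffOn.mul (hc.contDiffOn hI hf hβ hγ)

/-- Write the local part as `ω_i(R^i) T_i`. After multiplication of `∂_k` by `R^i - R^k`,
differentiating `ω_i(R^i)` yields `-ω_i(R^i) T_i`, differentiating `c` yields `+ω_k(R^k) T_k`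
because `ω_i'(R^k) = ω_k(R^k) / (R^k - R^i)`, and the speeds in the sum contribute by their own
involutivity. -/
theorem isInvolutive_tailSpeed {I : Fin n → Set ℝ} (hI : ∀ i, IsOpen (I i)) {f : Fin n → ℝ → ℝ}
    (hf : ∀ i, ContDiffOn ℝ ∞ (f i) (I i)) {c : ℕ → ℕ → Vec n → ℝ} (hc : IsFlux (domain I) f c)
    {β : ℕ} (hβ : β ∈ Icc 1 (n - 1)) : IsInvolutive (domain I) (tailSpeed f c β) := by
  intro R hR i
  have hd : DifferentiableAt ℝ (fun S => tailSpeed f c β S i) R :=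
    ((contDiffOn_tailSpeed hI hf hc hβ i).contDiffAt
      ((isOpen_domain hI).mem_nhds hR)).differentiableAt (by simp)
  refine ⟨hd, fun k => ?_⟩
  rcases eq_or_ne i k with rfl | hik
  · simp
  have h0 : R i - R k ≠ 0 := sub_ne_zero.mpr fun h => hik (hR.2 h)
  have e0 : R + (0 : ℝ) • (Pi.single k 1 : Vec n) = R := by simp
  have hp : pd k (fun S => tailSpeed f c β S i) R =
      pd k (fun S => diffProd S i) R * tailLoc n (f i) β (R i) -
        ∑ γ ∈ Icc 1 (n - 1), (pd k (fun S => speed n γ S i) R * c β γ R +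
          speed n γ R i * pd k (c β γ) R) := by
    refine pd_eq_of_hasDerivAt hd ?_
    simp only [tailSpeed_eq]
    have hi : ∀ t : ℝ, (R + t • (Pi.single k 1 : Vec n)) i = R i := fun t => by
      simp [hik]
    simp only [hi]
    refine ((hasDerivAt_line (differentiable_diffProd i R) k).mul_const _).sub
      ((HasDerivAt.fun_sum fun γ hγ => (hasDerivAt_line (differentiable_speed γ i R) k).mul
        (hasDerivAt_line (hc β hβ γ hγ R hR).1 k)).congr_deriv ?_)
    simp only [e0]
  have h1 : ∑ γ ∈ Icc 1 (n - 1), speed n γ R i * pd k (c β γ) R =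
      tailLoc n (f k) β (R k) * (diffProd R k * (R k - R i)⁻¹) := by
    have := sum_speed_mul_deriv hR.2 i k
    rw [if_neg hik, add_zero] at this
    rw [← this, mul_sum]
    exact sum_congr rfl fun γ hγ => by rw [hc.pd_eq hβ hγ hR]; ring
  have h2 : (R i - R k) * ∑ γ ∈ Icc 1 (n - 1), pd k (fun S => speed n γ S i) R * c β γ R =
      ∑ γ ∈ Icc 1 (n - 1), speed n γ R k * c β γ R -
        ∑ γ ∈ Icc 1 (n - 1), speed n γ R i * c β γ R := by
    rw [mul_sum, ← sum_sub_distrib]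
    exact sum_congr rfl fun γ _ => by rw [← mul_assoc, sub_mul_pd_speed]; ring
  have h3 : R k - R i ≠ 0 := by rw [← neg_sub]; exact neg_ne_zero.mpr h0
  have h4 : (R i - R k) * (R k - R i)⁻¹ = -1 := by field_simp; ring
  rw [hp, pd_diffProd hR.2, if_neg hik, sum_add_distrib, h1, tailSpeed_eq, tailSpeed_eq]
  have h5 : (R i - R k) * (R i - R k)⁻¹ = 1 := mul_inv_cancel₀ h0
  linear_combination (-h2) - diffProd R i * tailLoc n (f i) β (R i) * h5 -
    tailLoc n (f k) β (R k) * diffProd R k * h4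

theorem exists_hasDerivAt_of_contDiffOn {J : Set ℝ} (hJ : IsOpen J) (hJ' : J.OrdConnected)
    {g : ℝ → ℝ} (hg : ContinuousOn g J) : ∃ G : ℝ → ℝ, ∀ r ∈ J, HasDerivAt G (g r) r := by
  rcases J.eq_empty_or_nonempty with rfl | ⟨r₀, h₀⟩
  · exact ⟨0, by simp⟩
  refine ⟨fun r => ∫ u in r₀..r, g u, fun r hr => ?_⟩
  refine intervalIntegral.integral_hasDerivAt_right
    ((hg.mono (hJ'.uIcc_subset h₀ hr)).intervalIntegrable) ?_
    (hg.continuousAt (hJ.mem_nhds hr))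
  exact hg.stronglyMeasurableAtFilter hJ r hr

/-- The prescribed derivative is `½ (f r^m)'` plus `½ (γ - β) f r^(m-1)`, with `m = 2n - β - γ - 2`.
The first part integrates to the normalization; the second is antisymmetric in `β, γ` and needs a
primitive of `f r^(m-1)`. -/
theorem exists_isFlux {I : Fin n → Set ℝ} (hI : ∀ i, IsOpen (I i) ∧ (I i).OrdConnected)
    {f : Fin n → ℝ → ℝ} (hf : ∀ i, ContDiffOn ℝ ∞ (f i) (I i)) :
    ∃ c, IsFlux (domain I) f c := by
  have hK : ∀ (i : Fin n) (m : ℕ), ∃ G : ℝ → ℝ, ∀ r ∈ I i,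
      HasDerivAt G (f i r * r ^ (m - 1)) r := fun i m =>
    exists_hasDerivAt_of_contDiffOn (hI i).1 (hI i).2
      ((hf i).continuousOn.mul (continuous_pow _).continuousOn)
  choose G hG using hK
  let c : ℕ → ℕ → Vec n → ℝ := fun β γ R => ((n : ℝ) - β) * ((n : ℝ) - γ) *
    ∑ i, ((1 / 2) * (f i (R i) * R i ^ (2 * n - β - γ - 2)) +
      (1 / 2) * (((γ : ℝ) - β) * G i (2 * n - β - γ - 2) (R i)))
  have hc : ∀ β ∈ Icc 1 (n - 1), ∀ γ ∈ Icc 1 (n - 1), ∀ R ∈ domain I, HasFDerivAt (c β γ)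
      (∑ i, (((n : ℝ) - β) * ((n : ℝ) - γ) * ((1 / 2) * deriv (f i) (R i) *
        R i ^ (2 * n - β - γ - 2) + ((n : ℝ) - β - 1) * f i (R i) * R i ^ (2 * n - β - γ - 3))) •
        (ContinuousLinearMap.proj i : Vec n →L[ℝ] ℝ)) R := by
    intro β hβ γ hγ R hR
    have h1 : ∀ i : Fin n, HasFDerivAt (fun R : Vec n =>
        ((1 / 2) * (f i (R i) * R i ^ (2 * n - β - γ - 2)) +
          (1 / 2) * (((γ : ℝ) - β) * G i (2 * n - β - γ - 2) (R i))))
        (((1 / 2) * deriv (f i) (R i) *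
        R i ^ (2 * n - β - γ - 2) + ((n : ℝ) - β - 1) * f i (R i) * R i ^ (2 * n - β - γ - 3)) •
        (ContinuousLinearMap.proj i : Vec n →L[ℝ] ℝ)) R := by
      intro i
      have hfi : HasDerivAt (f i) (deriv (f i) (R i)) (R i) :=
        (((hf i).contDiffAt ((hI i).1.mem_nhds (hR.1 i))).differentiableAt (by simp)).hasDerivAt
      have h2 := ((hfi.fun_mul (hasDerivAt_pow (2 * n - β - γ - 2) (R i))).const_mul
        (1 / 2 : ℝ)).fun_add (((hG i (2 * n - β - γ - 2) (R i) (hR.1 i)).const_mul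
          ((γ : ℝ) - β)).const_mul (1 / 2 : ℝ))
      have hp : HasFDerivAt (fun R : Vec n => R i)
        (ContinuousLinearMap.proj i : Vec n →L[ℝ] ℝ) R := hasFDerivAt_apply i R
      have h3 := h2.comp_hasFDerivAt R hp
      refine h3.congr_fderiv ?_
      congr 1
      rw [mem_Icc] at hβ hγ
      -- Only here is `m = 0`, so that `m - 1` is truncated; all the coefficients concerned vanish.
      by_cases h : β + 1 = n ∧ γ + 1 = n
      · have e1 : (n : ℝ) = β + 1 := by rw [← h.1]; push_cast; ring
        have e2 : (n : ℝ) = γ + 1 := by rw [← h.2]; push_cast; ring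
        have e3 : 2 * n - β - γ - 2 = 0 := by omega
        have e4 : (γ : ℝ) = β := by linarith
        rw [e3, e4, e1]
        simp
      · have e3 : 2 * n - β - γ - 2 - 1 = 2 * n - β - γ - 3 := by omega
        have e4 : ((2 * n - β - γ - 2 : ℕ) : ℝ) = 2 * n - β - γ - 2 := by
          have : 2 * n = (2 * n - β - γ - 2) + β + γ + 2 := by omega
          have h5 : (2 * n : ℝ) = ((2 * n - β - γ - 2 : ℕ) : ℝ) + β + γ + 2 := by
            exact_mod_cast this
          linarith
        rw [e3, e4]
        ring
    have h4 := (HasFDerivAt.fun_sum (u := univ) fun i _ => h1 i).const_mul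
      (((n : ℝ) - β) * ((n : ℝ) - γ))
    refine h4.congr_fderiv ?_
    rw [smul_sum]
    exact sum_congr rfl fun i _ => by rw [smul_smul]
  refine ⟨c, fun β hβ γ hγ R hR => ⟨(hc β hβ γ hγ R hR).differentiableAt, fun i => ?_, ?_⟩⟩
  · rw [pd, (hc β hβ γ hγ R hR).fderiv]
    simp [Pi.single_apply]
  · simp only [c]
    have e : 2 * n - γ - β - 2 = 2 * n - β - γ - 2 := by omega
    rw [e, mul_comm ((n : ℝ) - γ), ← mul_add, ← sum_add_distrib, mul_sum]
    exact sum_congr rfl fun i _ => by ring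

end Hydro

/-! ### The Levi-Civita connection of the metric and its curvature. -/

namespace Hydro

open Finset

variable {n : ℕ} {I : Fin n → Set ℝ} {f : Fin n → ℝ → ℝ}

/-! ### The metric and its connection -/

/-- The contravariant components `g^{ii}`. -/
noncomputable def cometric (f : Fin n → ℝ → ℝ) (R : Vec n) (i : Fin n) : ℝ :=
  diffProd R i ^ 2 * f i (R i)

/-- The logarithmic derivatives `∂_j ln √|g_ii|`. -/
noncomputable def logDer (f : Fin n → ℝ → ℝ) (R : Vec n) (i j : Fin n) : ℝ :=
  (R i - R j)⁻¹ - if i = j then ∑ k, (R i - R k)⁻¹ + (1 / 2) * deriv (f i) (R i) / f i (R i) else 0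

theorem cometric_ne_zero (hf : Admissible I f) {R : Vec n} (hR : R ∈ domain I) (i : Fin n) :
    cometric f R i ≠ 0 :=
  mul_ne_zero (pow_ne_zero 2 (diffProd_ne_zero hR.2 i)) ((hf i).2 _ (hR.1 i))

theorem differentiableAt_param (hI : ∀ i, IsOpen (I i)) (hf : ∀ i, ContDiffOn ℝ ∞ (f i) (I i))
    {R : Vec n} (hR : R ∈ domain I) (i : Fin n) : DifferentiableAt ℝ (f i) (R i) :=
  ((hf i).contDiffAt ((hI i).mem_nhds (hR.1 i))).differentiableAt (by simp)

theorem differentiableAt_cometric (hI : ∀ i, IsOpen (I i)) (hf : Admissible I f) {R : Vec n}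
    (hR : R ∈ domain I) (i : Fin n) : DifferentiableAt ℝ (fun S => cometric f S i) R := by
  have h1 : DifferentiableAt ℝ (fun S : Vec n => f i (S i)) R :=
    (differentiableAt_param hI (fun i => (hf i).1) hR i).comp R (differentiableAt_apply i R)
  exact ((differentiable_diffProd i R).fun_pow 2).fun_mul h1

theorem pd_cometric (hI : ∀ i, IsOpen (I i)) (hf : Admissible I f) {R : Vec n}
    (hR : R ∈ domain I) (i j : Fin n) :
    pd j (fun S => cometric f S i) R = -2 * cometric f R i * logDer f R i j := by
  have e : R + (0 : ℝ) • (Pi.single j 1 : Vec n) = R := by simp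
  have hfi : HasDerivAt (f i) (deriv (f i) (R i)) ((R + (0 : ℝ) • (Pi.single j 1 : Vec n)) i) := by
    rw [e]
    exact (differentiableAt_param hI (fun i => (hf i).1) hR i).hasDerivAt
  have h1 : HasDerivAt (fun u : ℝ => (R + u • (Pi.single j 1 : Vec n)) i)
      ((Pi.single j 1 : Vec n) i) 0 := by
    simpa using ((hasDerivAt_id (0 : ℝ)).mul_const ((Pi.single j 1 : Vec n) i)).const_add (R i)
  refine pd_eq_of_hasDerivAt (differentiableAt_cometric hI hf hR i) ?_
  refine (((hasDerivAt_line (differentiable_diffProd i R) j).fun_pow 2).fun_mul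
    (hfi.comp (0 : ℝ) h1)).congr_deriv ?_
  have hf0 := (hf i).2 _ (hR.1 i)
  simp only [Function.comp_apply]
  rw [e, pd_diffProd hR.2, cometric, logDer, Pi.single_apply]
  by_cases hij : i = j
  · simp only [hij, if_true]
    subst hij
    simp
    field_simp
    ring
  · simp [hij]
    ring

theorem metric_apply (R : Vec n) (i j : Fin n) :
    metric f R i j = if i = j then (cometric f R i)⁻¹ else 0 := by
  simp [metric, Matrix.diagonal_apply, cometric]

theorem metric_inv_apply (hf : Admissible I f) {R : Vec n} (hR : R ∈ domain I) (i j : Fin n) :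
    (metric f R)⁻¹ i j = if i = j then cometric f R i else 0 := by
  have h : metric f R * Matrix.diagonal (cometric f R) = 1 := by
    rw [metric, Matrix.diagonal_mul_diagonal, ← Matrix.diagonal_one]
    congr 1
    funext i
    exact one_div_mul_cancel (cometric_ne_zero hf hR i)
  rw [Matrix.inv_eq_right_inv h, Matrix.diagonal_apply]

theorem pd_metric (hI : ∀ i, IsOpen (I i)) (hf : Admissible I f) {R : Vec n}
    (hR : R ∈ domain I) (i j k : Fin n) :
    pd k (fun S => metric f S i j) R =
      if i = j then 2 * (cometric f R i)⁻¹ * logDer f R i k else 0 := by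
  simp only [metric_apply]
  split_ifs with hij
  · have hd := differentiableAt_cometric hI hf hR i
    have h0 := cometric_ne_zero hf hR i
    have e : R + (0 : ℝ) • (Pi.single k 1 : Vec n) = R := by simp
    refine pd_eq_of_hasDerivAt (hd.fun_inv h0) ?_
    refine ((hasDerivAt_line hd k).fun_inv (by rwa [e])).congr_deriv ?_
    rw [e, pd_cometric hI hf hR]
    field_simp
  · simp [pd]

theorem pd_log_sqrt_metric (hI : ∀ i, IsOpen (I i)) (hf : Admissible I f) {R : Vec n}
    (hR : R ∈ domain I) (i j : Fin n) :
    pd j (fun S => Real.log (Real.sqrt |metric f S i i|)) R = logDer f R i j := by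
  have h1 : ∀ S, Real.log (Real.sqrt |metric f S i i|) = (-1 / 2) * Real.log (cometric f S i) := by
    intro S
    rw [Real.log_sqrt (abs_nonneg _), Real.log_abs, metric_apply, if_pos rfl, Real.log_inv]
    ring
  simp only [h1]
  have hd := differentiableAt_cometric hI hf hR i
  have h0 := cometric_ne_zero hf hR i
  have e : R + (0 : ℝ) • (Pi.single j 1 : Vec n) = R := by simp
  refine pd_eq_of_hasDerivAt ((hd.log h0).const_mul _) ?_
  refine (((hasDerivAt_line hd j).log (by rwa [e])).const_mul (-1 / 2 : ℝ)).congr_deriv ?_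
  rw [e, pd_cometric hI hf hR]
  field_simp

/-- The Christoffel symbols, evaluated. -/
noncomputable def conn (f : Fin n → ℝ → ℝ) (j s k : Fin n) (R : Vec n) : ℝ :=
  (if j = k then logDer f R j s else 0) + (if j = s then logDer f R j k else 0) -
    if s = k then cometric f R j * (cometric f R s)⁻¹ * logDer f R s j else 0

theorem christoffel_metric (hI : ∀ i, IsOpen (I i)) (hf : Admissible I f) {R : Vec n}
    (hR : R ∈ domain I) (j s k : Fin n) :
    christoffel (metric f) j s k R = conn f j s k R := by
  rw [christoffel, conn]
  simp only [metric_inv_apply hf hR, pd_metric hI hf hR, ite_mul, zero_mul, sum_ite_eq, mem_univ,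
    if_true]
  have h0 := cometric_ne_zero hf hR j
  have h1 := cometric_ne_zero hf hR s
  split_ifs <;> field_simp <;> ring

theorem conn_self (hf : Admissible I f) {R : Vec n} (hR : R ∈ domain I) (i l : Fin n) :
    conn f i l i R = logDer f R i l := by
  have := cometric_ne_zero hf hR i
  rw [conn]
  by_cases h : i = l
  · subst h; simp [this]
  · simp [h, Ne.symm h]

theorem conn_of_ne {j s k : Fin n} (h1 : j ≠ s) (h2 : j ≠ k) (h3 : s ≠ k) (R : Vec n) :
    conn f j s k R = 0 := by
  simp [conn, h1, h2, h3]

theorem conn_diag {j s : Fin n} (h : j ≠ s) (R : Vec n) :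
    conn f j s s R = -(cometric f R j * (cometric f R s)⁻¹ * logDer f R s j) := by
  simp [conn, h]

theorem logDer_of_ne {i j : Fin n} (h : i ≠ j) (R : Vec n) :
    logDer f R i j = (R i - R j)⁻¹ := by
  simp [logDer, h]

/-- A Christoffel symbol of a diagonal metric is a sum of three delta terms, so the contraction
collapses; only the case `i = k`, `l = j` keeps a genuine sum. -/
theorem sum_conn_mul_conn (f : Fin n → ℝ → ℝ) (i j k l : Fin n) (R : Vec n) :
    ∑ m, conn f i k m R * conn f m l j R =
      logDer f R i k * conn f i l j R +
      (if i = k then logDer f R i j * logDer f R j l + logDer f R i l * logDer f R l j -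
        (if l = j then ∑ m, logDer f R i m * (cometric f R m * (cometric f R l)⁻¹) *
          logDer f R l m else 0) else 0) -
      cometric f R i * (cometric f R k)⁻¹ * logDer f R k i * conn f k l j R := by
  have h : ∀ m, conn f i k m R * conn f m l j R =
      (if i = m then logDer f R i k * conn f m l j R else 0) +
      (if i = k then (if m = j then logDer f R i m * logDer f R m l else 0) +
        (if m = l then logDer f R i m * logDer f R m j else 0) -
        (if l = j then logDer f R i m * (cometric f R m * (cometric f R l)⁻¹) *
          logDer f R l m else 0) else 0) -
      (if k = m then cometric f R i * (cometric f R k)⁻¹ * logDer f R k i * conn f m l j R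
        else 0) := by
    intro m
    rw [show conn f i k m R = (if i = m then logDer f R i k else 0) +
      (if i = k then logDer f R i m else 0) -
      if k = m then cometric f R i * (cometric f R k)⁻¹ * logDer f R k i else 0 from rfl]
    by_cases hik : i = k
    · simp only [if_pos hik]
      have : logDer f R i m * conn f m l j R =
          (if m = j then logDer f R i m * logDer f R m l else 0) +
        (if m = l then logDer f R i m * logDer f R m j else 0) -
        (if l = j then logDer f R i m * (cometric f R m * (cometric f R l)⁻¹) *
          logDer f R l m else 0) := by
        rw [conn]
        split_ifs <;> ring
      rw [← this]
      split_ifs <;> ring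
    · simp only [if_neg hik]
      split_ifs <;> ring
  rw [sum_congr rfl fun m _ => h m, sum_sub_distrib, sum_add_distrib]
  congr 1
  · congr 1
    · simp
    · by_cases hik : i = k
      · simp only [if_pos hik]
        rw [sum_sub_distrib, sum_add_distrib]
        congr 1
        · simp
        · split_ifs <;> simp
      · simp [hik]
  · simp

/-! ### The curvature -/

theorem eventually_mem_domain (hI : ∀ i, IsOpen (I i)) {R : Vec n} (hR : R ∈ domain I) :
    ∀ᶠ S in nhds R, S ∈ domain I :=
  (isOpen_domain hI).mem_nhds hR

theorem riemann_metric (hI : ∀ i, IsOpen (I i)) (hf : Admissible I f) {R : Vec n}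
    (hR : R ∈ domain I) (i j k l : Fin n) :
    riemann (metric f) i j k l R = pd k (conn f i l j) R - pd l (conn f i k j) R +
      (∑ m, conn f i k m R * conn f m l j R - ∑ m, conn f i l m R * conn f m k j R) := by
  have h : ∀ a b c, christoffel (metric f) a b c =ᶠ[nhds R] conn f a b c := fun a b c => by
    filter_upwards [eventually_mem_domain hI hR] with S hS
    exact christoffel_metric hI hf hS a b c
  rw [riemann, pd_congr (h i l j), pd_congr (h i k j), ← sum_sub_distrib]
  simp only [christoffel_metric hI hf hR]

theorem pd_logDer {R : Vec n} (hR : R ∈ domain I)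
    {i j : Fin n} (hij : i ≠ j) (l : Fin n) :
    pd l (fun S => logDer f S i j) R =
      -((if i = l then 1 else 0) - if j = l then 1 else 0) * (R i - R j)⁻¹ ^ 2 := by
  have h0 : R i - R j ≠ 0 := sub_ne_zero.mpr fun h => hij (hR.2 h)
  simp only [logDer_of_ne hij]
  refine pd_eq_of_hasDerivAt (DifferentiableAt.fun_inv (by fun_prop) h0) ?_
  have e : (R + (0 : ℝ) • (Pi.single l 1 : Vec n)) = R := by simp
  have h1 : ∀ i, HasDerivAt (fun u : ℝ => (R + u • (Pi.single l 1 : Vec n)) i)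
      (if i = l then 1 else 0) 0 := by
    intro i
    simpa [Pi.single_apply] using
      ((hasDerivAt_id (0 : ℝ)).mul_const ((Pi.single l 1 : Vec n) i)).const_add (R i)
  refine (((h1 i).fun_sub (h1 j)).fun_inv (by rwa [e])).congr_deriv ?_
  rw [e]
  field_simp

theorem pd_logDer_self (hI : ∀ i, IsOpen (I i)) (hf : Admissible I f) {R : Vec n}
    (hR : R ∈ domain I) {i l : Fin n} (hil : i ≠ l) :
    pd l (fun S => logDer f S i i) R = -(R i - R l)⁻¹ ^ 2 := by
  have hd : DifferentiableAt ℝ (fun S : Vec n => logDer f S i i) R := by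
    have h1 : DifferentiableAt ℝ (fun S : Vec n => f i (S i)) R :=
      (differentiableAt_param hI (fun i => (hf i).1) hR i).comp R (differentiableAt_apply i R)
    have h2 : DifferentiableAt ℝ (fun S : Vec n => deriv (f i) (S i)) R :=
      DifferentiableAt.comp (g := deriv (f i)) R (differentiableAt_param (f := fun i => deriv (f i)) hI
        (fun i => contDiffOn_deriv (hI i) (hf i).1) hR i) (differentiableAt_apply i R)
    simp only [logDer, if_true, sub_self, inv_zero, zero_sub, div_eq_mul_inv _ (f i _)]
    refine DifferentiableAt.fun_neg (DifferentiableAt.fun_add (DifferentiableAt.fun_sum fun k _ => ?_)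
      ((h2.const_mul _).fun_mul (h1.fun_inv ((hf i).2 _ (hR.1 i)))))
    by_cases hk : i = k
    · simp [hk]
    · exact DifferentiableAt.fun_inv (by fun_prop) (sub_ne_zero.mpr fun h => hk (hR.2 h))
  refine pd_eq_of_hasDerivAt hd ?_
  have e : (R + (0 : ℝ) • (Pi.single l 1 : Vec n)) = R := by simp
  have hi : ∀ t : ℝ, (R + t • (Pi.single l 1 : Vec n)) i = R i := fun t => by simp [hil]
  simp only [logDer, if_true, sub_self, inv_zero, zero_sub, hi]
  have h1 : ∀ k ∈ univ, HasDerivAt (fun u : ℝ => (R i - (R + u • (Pi.single l 1 : Vec n)) k)⁻¹)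
      (if k = l then (R i - R k)⁻¹ ^ 2 else 0) 0 := by
    intro k _
    by_cases hk : i = k
    · subst hk
      simp only [hi, sub_self, inv_zero, if_neg hil]
      exact hasDerivAt_const _ _
    · have h0 : R i - R k ≠ 0 := sub_ne_zero.mpr fun h => hk (hR.2 h)
      have h2 : HasDerivAt (fun u : ℝ => (R + u • (Pi.single l 1 : Vec n)) k)
          (if k = l then 1 else 0) 0 := by
        simpa [Pi.single_apply] using
          ((hasDerivAt_id (0 : ℝ)).mul_const ((Pi.single l 1 : Vec n) k)).const_add (R k)
      refine ((h2.const_sub (R i)).fun_inv (by rwa [e])).congr_deriv ?_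
      rw [e]
      split_ifs <;> simp [div_eq_inv_mul]
  refine (((HasDerivAt.fun_sum h1).add_const _).fun_neg).congr_deriv ?_
  simp

theorem curvature_metric (hf : Admissible I f) {R : Vec n} (hR : R ∈ domain I)
    (i j k l : Fin n) :
    curvature (metric f) i j k l R = cometric f R j * riemann (metric f) i j k l R := by
  simp [curvature, metric_inv_apply hf hR]

theorem riemann_swap (g : Vec n → Matrix (Fin n) (Fin n) ℝ) (i j k l : Fin n) (R : Vec n) :
    riemann g i j k l R = -riemann g i j l k R := by
  rw [riemann, riemann, sum_sub_distrib, sum_sub_distrib]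
  ring

/-- The derivative terms are mixed second derivatives of `ln √|g_ii|` and cancel; the quadratic
terms cancel as well. -/
theorem riemann_diag (hI : ∀ i, IsOpen (I i)) (hf : Admissible I f) {R : Vec n}
    (hR : R ∈ domain I) {i k l : Fin n} (hkl : k ≠ l) : riemann (metric f) i i k l R = 0 := by
  have hc : ∀ a : Fin n, conn f i a i =ᶠ[nhds R] fun S => logDer f S i a := fun a => by
    filter_upwards [eventually_mem_domain hI hR] with S hS
    exact conn_self hf hS i a
  rw [riemann_metric hI hf hR, pd_congr (hc l), pd_congr (hc k), sum_conn_mul_conn,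
    sum_conn_mul_conn, conn_self hf hR, conn_self hf hR]
  have h1 : ∀ l, i ≠ l → pd i (fun S => logDer f S i l) R = pd l (fun S => logDer f S i i) R := by
    intro l hl
    rw [pd_logDer hR hl, pd_logDer_self hI hf hR hl]
    simp [hl.symm]
  have h2 := cometric_ne_zero hf hR i
  by_cases hik : i = k
  · subst hik
    rw [h1 l hkl, conn_self hf hR, conn_diag (Ne.symm hkl)]
    have h3 := cometric_ne_zero hf hR l
    simp [hkl, Ne.symm hkl]
    field_simp
    ring
  · by_cases hil : i = l
    · subst hil
      rw [← h1 k hik, conn_self hf hR, conn_diag (Ne.symm hik)]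
      have h3 := cometric_ne_zero hf hR k
      simp [hkl, hik]
      field_simp
      ring
    · rw [pd_logDer hR hil, pd_logDer hR hik, conn_of_ne hkl (Ne.symm hik) (Ne.symm hil),
        conn_of_ne hkl.symm (Ne.symm hil) (Ne.symm hik)]
      simp [hik, hil, hkl, hkl.symm]
      ring

/-- Components with three distinct indices reduce to a partial fraction identity in `1/(R^i - R^j)`,
`1/(R^j - R^l)`, `1/(R^i - R^l)`, which is the semi-Hamiltonian property of the rotation-type
coefficients. With four distinct indices every term is zero. -/
theorem riemann_of_ne (hI : ∀ i, IsOpen (I i)) (hf : Admissible I f) {R : Vec n}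
    (hR : R ∈ domain I) {i j k l : Fin n} (hij : i ≠ j) (hkl : k ≠ l) (hli : l ≠ i)
    (hlj : l ≠ j) : riemann (metric f) i j k l R = 0 := by
  have hz : ∀ a b c : Fin n, a ≠ b → a ≠ c → b ≠ c → pd k (conn f a b c) R = 0 := by
    intro a b c h1 h2 h3
    have : conn f a b c = fun _ => 0 := funext fun S => conn_of_ne h1 h2 h3 S
    simp [this, pd]
  have hzl : ∀ a b c : Fin n, a ≠ b → a ≠ c → b ≠ c → pd l (conn f a b c) R = 0 := by
    intro a b c h1 h2 h3
    have : conn f a b c = fun _ => 0 := funext fun S => conn_of_ne h1 h2 h3 S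
    simp [this, pd]
  have e1 : R i - R j ≠ 0 := sub_ne_zero.mpr fun h => hij (hR.2 h)
  have e2 : R i - R l ≠ 0 := sub_ne_zero.mpr fun h => hli.symm (hR.2 h)
  have e3 : R j - R l ≠ 0 := sub_ne_zero.mpr fun h => hlj.symm (hR.2 h)
  have e1' : R j - R i ≠ 0 := by rw [← neg_sub]; exact neg_ne_zero.mpr e1
  have e2' : R l - R i ≠ 0 := by rw [← neg_sub]; exact neg_ne_zero.mpr e2
  have e3' : R l - R j ≠ 0 := by rw [← neg_sub]; exact neg_ne_zero.mpr e3
  rw [riemann_metric hI hf hR, sum_conn_mul_conn, sum_conn_mul_conn, hz i l j hli.symm hij hlj,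
    conn_of_ne hli.symm hij hlj]
  by_cases hik : i = k
  · subst hik
    have hc : conn f i i j = fun S => logDer f S i j := funext fun S => by
      simp [conn, hij]
    rw [hc, pd_logDer hR hij, conn_of_ne hli hlj hij,
      conn_of_ne hli.symm hij hlj]
    simp only [if_neg hli.symm, if_neg hlj.symm, if_neg hlj, logDer_of_ne hij, logDer_of_ne hlj,
      logDer_of_ne hlj.symm, logDer_of_ne hli.symm, if_true]
    field_simp
    ring
  · by_cases hjk : j = k
    · subst hjk
      have hc : conn f i j j = fun S => -(cometric f S i * (cometric f S j)⁻¹ * logDer f S j i) :=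
        funext fun S => conn_diag hij S
      have hp : pd l (conn f i j j) R = -(cometric f R i * (cometric f R j)⁻¹ *
          (2 * logDer f R j l - 2 * logDer f R i l) * logDer f R j i) := by
        have hi := differentiableAt_cometric hI hf hR i
        have hj := differentiableAt_cometric hI hf hR j
        have hj0 := cometric_ne_zero hf hR j
        have hd : DifferentiableAt ℝ (fun S => logDer f S j i) R := by
          simp only [logDer_of_ne hij.symm]
          exact DifferentiableAt.fun_inv (by fun_prop) e1'
        have e : (R + (0 : ℝ) • (Pi.single l 1 : Vec n)) = R := by simp
        rw [hc]
        refine pd_eq_of_hasDerivAt ((hi.fun_mul (hj.fun_inv hj0)).fun_mul hd).fun_neg ?_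
        refine ((((hasDerivAt_line hi l).fun_mul ((hasDerivAt_line hj l).fun_inv
          (by rwa [e]))).fun_mul (hasDerivAt_line hd l)).fun_neg).congr_deriv ?_
        rw [e, pd_cometric hI hf hR, pd_cometric hI hf hR, pd_logDer hR hij.symm]
        simp only [if_neg hlj.symm, if_neg hli.symm]
        field_simp
        ring
      have hl0 := cometric_ne_zero hf hR l
      rw [hp, conn_diag hij, conn_diag hlj]
      have : conn f j l j R = logDer f R j l := conn_self hf hR j l
      rw [this]
      simp only [if_neg hij, if_neg hli.symm, logDer_of_ne hij.symm, logDer_of_ne hlj.symm,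
        logDer_of_ne hli, logDer_of_ne hli.symm, logDer_of_ne hij]
      have hj0 := cometric_ne_zero hf hR j
      field_simp
      ring
    · have hkj : k ≠ j := Ne.symm hjk
      rw [hzl i k j hik hij hkj, conn_of_ne hik hij hkj, conn_of_ne hkl hkj hlj,
        conn_of_ne hkl.symm hlj hkj]
      simp [hik, hli.symm]

theorem riemann_main (hI : ∀ i, IsOpen (I i)) (hf : Admissible I f) {R : Vec n}
    (hR : R ∈ domain I) {i j : Fin n} (hij : i ≠ j) :
    cometric f R j * riemann (metric f) i j i j R =
      cometric f R i * (2 * logDer f R i i * (R j - R i)⁻¹ - 2 * (R i - R j)⁻¹ ^ 2) +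
      cometric f R j * (2 * logDer f R j j * (R i - R j)⁻¹ - 2 * (R i - R j)⁻¹ ^ 2) -
      ∑ m, cometric f R m * logDer f R i m * logDer f R j m := by
  have e1 : R i - R j ≠ 0 := sub_ne_zero.mpr fun h => hij (hR.2 h)
  have e1' : R j - R i ≠ 0 := by rw [← neg_sub]; exact neg_ne_zero.mpr e1
  have hj0 := cometric_ne_zero hf hR j
  have hi0 := cometric_ne_zero hf hR i
  have hc1 : conn f i i j = fun S => logDer f S i j := funext fun S => by simp [conn, hij]
  have hc : conn f i j j = fun S => -(cometric f S i * (cometric f S j)⁻¹ * logDer f S j i) :=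
    funext fun S => conn_diag hij S
  have hp : pd i (conn f i j j) R = -(cometric f R i * (cometric f R j)⁻¹ *
      (2 * logDer f R j i - 2 * logDer f R i i) * logDer f R j i +
      cometric f R i * (cometric f R j)⁻¹ * (R j - R i)⁻¹ ^ 2) := by
    have hi := differentiableAt_cometric hI hf hR i
    have hj := differentiableAt_cometric hI hf hR j
    have hd : DifferentiableAt ℝ (fun S => logDer f S j i) R := by
      simp only [logDer_of_ne hij.symm]
      exact DifferentiableAt.fun_inv (by fun_prop) e1'
    have e : (R + (0 : ℝ) • (Pi.single i 1 : Vec n)) = R := by simp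
    rw [hc]
    refine pd_eq_of_hasDerivAt ((hi.fun_mul (hj.fun_inv hj0)).fun_mul hd).fun_neg ?_
    refine ((((hasDerivAt_line hi i).fun_mul ((hasDerivAt_line hj i).fun_inv
      (by rwa [e]))).fun_mul (hasDerivAt_line hd i)).fun_neg).congr_deriv ?_
    rw [e, pd_cometric hI hf hR, pd_cometric hI hf hR, pd_logDer hR hij.symm]
    simp only [if_neg hij.symm, if_true]
    field_simp
    ring
  have hcj : conn f j i j R = logDer f R j i := conn_self hf hR j i
  have hs : ∑ m, logDer f R i m * (cometric f R m * (cometric f R j)⁻¹) * logDer f R j m =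
      (cometric f R j)⁻¹ * ∑ m, cometric f R m * logDer f R i m * logDer f R j m := by
    rw [mul_sum]
    exact sum_congr rfl fun m _ => by ring
  rw [riemann_metric hI hf hR, sum_conn_mul_conn, sum_conn_mul_conn, hp, hc1,
    pd_logDer hR hij, hs, conn_diag hij, hcj]
  simp only [if_true, if_neg hij, logDer_of_ne hij, logDer_of_ne hij.symm]
  rw [← neg_sub (R j) (R i)]
  field_simp
  ring

theorem sum_speed_mul_tailLoc {R : Vec n} (hR : Function.Injective R) {i j : Fin n} (hij : i ≠ j)
    (g : ℝ → ℝ) : ∑ β ∈ Icc 1 (n - 1), speed n β R i * tailLoc n g β (R j) =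
      (1 / 2) * deriv g (R j) * (diffProd R j * (R j - R i)⁻¹) +
        g (R j) * (2 * diffProd R j * (R j - R i)⁻¹ * (∑ k, (R j - R k)⁻¹ - (R j - R i)⁻¹)) := by
  have h1 := sum_speed_mul_deriv hR i j
  rw [if_neg hij, add_zero] at h1
  rw [← sum_speed_mul_deriv2 hR hij, ← h1, mul_sum, mul_sum, ← sum_add_distrib]
  refine sum_congr rfl fun β _ => ?_
  rw [tailLoc]
  ring

/-- The symmetric part of `c` is the Gram matrix, with weights `f^k`, of the derivatives of the
monomials `z^(n-β)` at the nodes. -/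
theorem IsFlux.sum_mul_symm {D : Set (Vec n)} {c : ℕ → ℕ → Vec n → ℝ} (hc : IsFlux D f c)
    {R : Vec n} (hR : R ∈ D) (a b : ℕ → ℝ) :
    ∑ β ∈ Icc 1 (n - 1), ∑ γ ∈ Icc 1 (n - 1), a β * b γ * (c β γ R + c γ β R) =
      ∑ k, f k (R k) * (∑ β ∈ Icc 1 (n - 1), a β * (((n : ℝ) - β) * R k ^ (n - β - 1))) *
        ∑ γ ∈ Icc 1 (n - 1), b γ * (((n : ℝ) - γ) * R k ^ (n - γ - 1)) := by
  have h : ∀ β ∈ Icc 1 (n - 1), ∀ γ ∈ Icc 1 (n - 1), a β * b γ * (c β γ R + c γ β R) =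
      ∑ k, f k (R k) * (a β * (((n : ℝ) - β) * R k ^ (n - β - 1))) *
        (b γ * (((n : ℝ) - γ) * R k ^ (n - γ - 1))) := by
    intro β hβ γ hγ
    rw [hc.symm_eq hβ hγ hR, mul_sum]
    exact sum_congr rfl fun k _ => by ring
  rw [sum_congr rfl fun β hβ => sum_congr rfl fun γ hγ => h β hβ γ hγ]
  simp only [mul_sum, sum_mul]
  rw [sum_congr rfl fun β _ => sum_comm, sum_comm]
  exact sum_congr rfl fun k _ => sum_comm

/-- The local parts of the tails give values of `ω'` and `ω''` at `R^i` and `R^j`, and the functions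
`c` enter only through `c + cᵀ`, giving `-∑_k f^k ω_i'(R^k) ω_j'(R^k)`. For `k ≠ i, j` these are the
corresponding terms of the sum in `riemann_main`; the terms `k = i, j` are compared separately. -/
theorem sum_speed_tailSpeed (hf : Admissible I f) {c : ℕ → ℕ → Vec n → ℝ}
    (hc : IsFlux (domain I) f c) {R : Vec n} (hR : R ∈ domain I) {i j : Fin n} (hij : i ≠ j) :
    ∑ β ∈ Icc 1 (n - 1), (speed n β R i * tailSpeed f c β R j +
      speed n β R j * tailSpeed f c β R i) =
      cometric f R i * (2 * logDer f R i i * (R j - R i)⁻¹ - 2 * (R i - R j)⁻¹ ^ 2) +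
      cometric f R j * (2 * logDer f R j j * (R i - R j)⁻¹ - 2 * (R i - R j)⁻¹ ^ 2) -
      ∑ m, cometric f R m * logDer f R i m * logDer f R j m := by
  have h1 : ∀ β, speed n β R i * tailSpeed f c β R j + speed n β R j * tailSpeed f c β R i =
      diffProd R j * (speed n β R i * tailLoc n (f j) β (R j)) +
      diffProd R i * (speed n β R j * tailLoc n (f i) β (R i)) -
      (∑ γ ∈ Icc 1 (n - 1), speed n β R i * speed n γ R j * c β γ R +
        ∑ γ ∈ Icc 1 (n - 1), speed n γ R i * speed n β R j * c β γ R) := by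
    intro β
    rw [tailSpeed_eq, tailSpeed_eq, mul_sub, mul_sub, mul_sum, mul_sum]
    rw [sum_congr rfl fun γ _ => (mul_assoc (speed n β R i) (speed n γ R j) (c β γ R)),
      sum_congr rfl fun γ _ => (show speed n γ R i * speed n β R j * c β γ R =
        speed n β R j * (speed n γ R i * c β γ R) by ring)]
    ring
  have h2 := hc.sum_mul_symm hR (fun β => speed n β R i) (fun β => speed n β R j)
  simp only [mul_add, sum_add_distrib] at h2
  have h3 : ∑ β ∈ Icc 1 (n - 1), ∑ γ ∈ Icc 1 (n - 1), speed n γ R i * speed n β R j * c β γ R =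
      ∑ β ∈ Icc 1 (n - 1), ∑ γ ∈ Icc 1 (n - 1), speed n β R i * speed n γ R j * c γ β R :=
    sum_comm
  rw [sum_congr rfl fun β _ => h1 β, sum_sub_distrib, sum_add_distrib, sum_add_distrib, h3, h2,
    ← mul_sum, ← mul_sum, sum_speed_mul_tailLoc hR.2 hij, sum_speed_mul_tailLoc hR.2 hij.symm]
  have hs : ∀ F : Fin n → ℝ, ∑ m, F m = F i + F j + ∑ m ∈ (univ.erase i).erase j, F m := by
    intro F
    rw [← add_sum_erase univ F (mem_univ i),
      ← add_sum_erase _ F (mem_erase.mpr ⟨hij.symm, mem_univ j⟩)]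
    ring
  rw [hs fun m => cometric f R m * logDer f R i m * logDer f R j m,
    hs fun k => f k (R k) * (∑ β ∈ Icc 1 (n - 1), speed n β R i *
      (((n : ℝ) - β) * R k ^ (n - β - 1))) * ∑ γ ∈ Icc 1 (n - 1), speed n γ R j *
      (((n : ℝ) - γ) * R k ^ (n - γ - 1))]
  have h4 : ∑ m ∈ (univ.erase i).erase j, cometric f R m * logDer f R i m * logDer f R j m =
      ∑ k ∈ (univ.erase i).erase j, f k (R k) * (∑ β ∈ Icc 1 (n - 1), speed n β R i *
      (((n : ℝ) - β) * R k ^ (n - β - 1))) * ∑ γ ∈ Icc 1 (n - 1), speed n γ R j *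
      (((n : ℝ) - γ) * R k ^ (n - γ - 1)) := by
    refine sum_congr rfl fun m hm => ?_
    have hmj : m ≠ j := ne_of_mem_erase hm
    have hmi : m ≠ i := ne_of_mem_erase (mem_of_mem_erase hm)
    rw [sum_speed_mul_deriv hR.2, sum_speed_mul_deriv hR.2, if_neg hmi.symm, if_neg hmj.symm,
      logDer_of_ne hmi.symm, logDer_of_ne hmj.symm, cometric, ← neg_sub (R m) (R i),
      ← neg_sub (R m) (R j), inv_neg, inv_neg]
    ring
  rw [h4, sum_speed_mul_deriv hR.2, sum_speed_mul_deriv hR.2, sum_speed_mul_deriv hR.2,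
    sum_speed_mul_deriv hR.2, if_pos rfl, if_neg hij, if_neg hij.symm, if_pos rfl,
    logDer_of_ne hij, logDer_of_ne hij.symm, logDer, logDer, if_pos rfl, if_pos rfl, cometric,
    cometric]
  have e1 : R i - R j ≠ 0 := sub_ne_zero.mpr fun h => hij (hR.2 h)
  have hfi := (hf i).2 _ (hR.1 i)
  have hfj := (hf j).2 _ (hR.1 j)
  rw [← neg_sub (R i) (R j)]
  simp only [sub_self, inv_zero, inv_neg]
  field_simp
  ring

theorem curvature_eq (hI : ∀ i, IsOpen (I i)) (hf : Admissible I f) {c : ℕ → ℕ → Vec n → ℝ}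
    (hc : IsFlux (domain I) f c) {R : Vec n} (hR : R ∈ domain I) (i j k l : Fin n) :
    curvature (metric f) i j k l R =
      (∑ β ∈ Icc 1 (n - 1), (speed n β R i * tailSpeed f c β R j +
        speed n β R j * tailSpeed f c β R i)) *
      ((if i = k then 1 else 0) * (if j = l then 1 else 0) -
        (if i = l then 1 else 0) * (if j = k then 1 else 0)) := by
  rw [curvature_metric hf hR]
  by_cases hkl : k = l
  · subst hkl
    have h := riemann_swap (metric f) i j k k R
    have h0 : riemann (metric f) i j k k R = 0 := by linarith
    rw [h0]
    simp
  by_cases hij : i = j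
  · subst hij
    rw [riemann_diag hI hf hR hkl]
    ring
  by_cases hl : l ≠ i ∧ l ≠ j
  · rw [riemann_of_ne hI hf hR hij hkl hl.1 hl.2]
    simp [Ne.symm hl.1, Ne.symm hl.2]
  by_cases hk : k ≠ i ∧ k ≠ j
  · rw [riemann_swap, riemann_of_ne hI hf hR hij (Ne.symm hkl) hk.1 hk.2]
    simp [Ne.symm hk.1, Ne.symm hk.2]
  by_cases hki : k = i
  · subst hki
    have hlj : l = j := by
      by_contra h
      exact hl ⟨Ne.symm hkl, h⟩
    subst hlj
    rw [riemann_main hI hf hR hkl, sum_speed_tailSpeed hf hc hR hkl]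
    simp [hkl]
  · have hkj : k = j := by
      by_contra h
      exact hk ⟨hki, h⟩
    subst hkj
    have hli : l = i := by
      by_contra h
      exact hl ⟨h, Ne.symm hkl⟩
    subst hli
    rw [riemann_swap, mul_neg, riemann_main hI hf hR (Ne.symm hkl),
      sum_speed_tailSpeed hf hc hR (Ne.symm hkl)]
    simp [Ne.symm hkl]

end Hydro

/-! ### The factorization of the operators, as algebra at a point. -/

namespace Hydro

open Finset

variable {n : ℕ} {I : Fin n → Set ℝ} {f : Fin n → ℝ → ℝ}

/-! ### Momenta

For a covector `ψ` along a curve with tangent `r` the numbers `p β` are primitives of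
`dens R r ψ β`; the momenta `mom R ψ p i` diagonalize the operators. -/

/-- The sums `∑_k a^k / (R^i - R^k)` over `k ≠ i`. -/
noncomputable def cauchySum (R a : Vec n) (i : Fin n) : ℝ := ∑ k, (R i - R k)⁻¹ * a k

/-- The derivative at `z` of the polynomial `∑_β p_β z^(n-β)`. -/
noncomputable def polyDer (n : ℕ) (p : ℕ → ℝ) (z : ℝ) : ℝ :=
  ∑ β ∈ Icc 1 (n - 1), ((n : ℝ) - β) * z ^ (n - β - 1) * p β

/-- The second derivative at `z` of the polynomial `∑_β p_β z^(n-β)`. -/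
noncomputable def polyDer2 (n : ℕ) (p : ℕ → ℝ) (z : ℝ) : ℝ :=
  ∑ β ∈ Icc 1 (n - 1), ((n : ℝ) - β) * (((n : ℝ) - β - 1) * z ^ (n - β - 2)) * p β

/-- The density `∑_j v_β^j r^j ψ_j`. -/
noncomputable def dens (R r ψ : Vec n) (β : ℕ) : ℝ := ∑ j, speed n β R j * r j * ψ j

/-- The momenta of a covector. -/
noncomputable def mom (R ψ : Vec n) (p : ℕ → ℝ) (i : Fin n) : ℝ :=
  diffProd R i * ψ i + polyDer n p (R i)

/-- The derivative of the momenta when `R, ψ, p` have the derivatives `r, ψ', p'`. -/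
noncomputable def momDer (R r ψ ψ' : Vec n) (p p' : ℕ → ℝ) (i : Fin n) : ℝ :=
  diffProd R i * (ψ' i + ψ i * (cauchySum R 1 i * r i - cauchySum R r i)) +
    polyDer2 n p (R i) * r i + polyDer n p' (R i)

theorem cauchySum_one (R : Vec n) (i : Fin n) : cauchySum R 1 i = ∑ k, (R i - R k)⁻¹ := by
  simp [cauchySum]

theorem sum_sub_mul_inv (R r : Vec n) (i : Fin n) :
    ∑ k, (r i - r k) * (R i - R k)⁻¹ = cauchySum R 1 i * r i - cauchySum R r i := by
  rw [cauchySum_one, cauchySum, sum_mul, ← sum_sub_distrib]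
  exact sum_congr rfl fun k _ => by ring

theorem hasDerivAt_polyDer {p : ℕ → ℝ → ℝ} {p' : ℕ → ℝ} {z : ℝ → ℝ} {r x : ℝ}
    (hp : ∀ β ∈ Icc 1 (n - 1), HasDerivAt (p β) (p' β) x) (hz : HasDerivAt z r x) :
    HasDerivAt (fun y => polyDer n (fun β => p β y) (z y))
      (polyDer2 n (fun β => p β x) (z x) * r + polyDer n p' (z x)) x := by
  have h := HasDerivAt.fun_sum (u := Icc 1 (n - 1)) fun β hβ =>
    ((hz.fun_pow (n - β - 1)).const_mul ((n : ℝ) - β)).mul (hp β hβ)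
  refine h.congr_deriv ?_
  rw [polyDer2, polyDer, sum_mul, ← sum_add_distrib]
  refine sum_congr rfl fun β hβ => ?_
  rw [mem_Icc] at hβ
  have e : ((n - β - 1 : ℕ) : ℝ) = (n : ℝ) - β - 1 := by
    rw [Nat.cast_sub (by omega), Nat.cast_sub (by omega)]
    simp
  rw [e, Nat.sub_sub (n - β) 1 1]
  ring

theorem hasDerivAt_mom {S ψ : ℝ → Vec n} {r ψ' : Vec n} {p : ℕ → ℝ → ℝ} {p' : ℕ → ℝ} {x : ℝ}
    (hS : HasDerivAt S r x) (hinj : Function.Injective (S x)) (hψ : HasDerivAt ψ ψ' x)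
    (hp : ∀ β ∈ Icc 1 (n - 1), HasDerivAt (p β) (p' β) x) (i : Fin n) :
    HasDerivAt (fun y => mom (S y) (ψ y) (fun β => p β y) i)
      (momDer (S x) r (ψ x) ψ' (fun β => p β x) p' i) x := by
  have h := ((hasDerivAt_diffProd hS hinj i).mul (hasDerivAt_pi.mp hψ i)).add
    (hasDerivAt_polyDer hp (hasDerivAt_pi.mp hS i))
  refine h.congr_deriv ?_
  rw [sum_sub_mul_inv, momDer]
  ring

theorem sum_nodalDer_mul {R : Vec n} (a : Vec n) (i : Fin n) :
    ∑ j, diffProd R i * ((R i - R j)⁻¹ + if j = i then ∑ k, (R i - R k)⁻¹ else 0) * a j =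
      diffProd R i * (cauchySum R 1 i * a i + cauchySum R a i) := by
  rw [cauchySum_one, cauchySum]
  have h : ∀ j, diffProd R i * ((R i - R j)⁻¹ + if j = i then ∑ k, (R i - R k)⁻¹ else 0) * a j =
      diffProd R i * ((R i - R j)⁻¹ * a j) +
        if j = i then diffProd R i * ((∑ k, (R i - R k)⁻¹) * a j) else 0 := by
    intro j
    split_ifs <;> ring
  rw [sum_congr rfl fun j _ => h j, sum_add_distrib, ← mul_sum]
  simp
  ring

/-- `dens` holds the nonconstant coefficients of `∑_j r^j ψ_j ω_j(z)`, so its derivative at `R^i`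
consists of the numbers `ω_j'(R^i)`. -/
theorem polyDer_dens {R : Vec n} (hR : Function.Injective R) (r ψ : Vec n) (i : Fin n) :
    polyDer n (dens R r ψ) (R i) =
      diffProd R i * (cauchySum R 1 i * (r i * ψ i) + cauchySum R (fun k => r k * ψ k) i) := by
  rw [← sum_nodalDer_mul (fun k => r k * ψ k)]
  simp only [← sum_speed_mul_deriv hR, polyDer, dens, mul_sum, sum_mul]
  rw [sum_comm]
  exact sum_congr rfl fun j _ => sum_congr rfl fun β _ => by ring

theorem sum_tailLoc_mul (g : ℝ → ℝ) (p : ℕ → ℝ) (z : ℝ) :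
    ∑ β ∈ Icc 1 (n - 1), tailLoc n g β z * p β =
      (1 / 2) * deriv g z * polyDer n p z + g z * polyDer2 n p z := by
  rw [polyDer, polyDer2, mul_sum, mul_sum, ← sum_add_distrib]
  exact sum_congr rfl fun β _ => by rw [tailLoc]; ring

/-- The operator `f d/dx + ½ f_x` applied to the momenta. -/
noncomputable def force (f : Fin n → ℝ → ℝ) (R r ψ ψ' : Vec n) (p p' : ℕ → ℝ) (i : Fin n) : ℝ :=
  f i (R i) * momDer R r ψ ψ' p p' i + (1 / 2) * deriv (f i) (R i) * r i * mom R ψ p i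

/-- The sums `∑_γ c_γ^β p_γ + ∑_l (n-β) (R^l)^(n-β-1) f^l ∏_{k≠l}(R^l-R^k) ψ_l`. -/
noncomputable def shiftLoc (f : Fin n → ℝ → ℝ) (c : ℕ → ℕ → Vec n → ℝ) (R ψ : Vec n)
    (p : ℕ → ℝ) (β : ℕ) : ℝ :=
  ∑ γ ∈ Icc 1 (n - 1), c γ β R * p γ +
    ∑ l, ((n : ℝ) - β) * R l ^ (n - β - 1) * (f l (R l) * (diffProd R l * ψ l))

theorem hasDerivAt_param (hI : ∀ i, IsOpen (I i)) (hf : ∀ i, ContDiffOn ℝ ∞ (f i) (I i))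
    {S : ℝ → Vec n} {r : Vec n} {x : ℝ} (hS : HasDerivAt S r x) (hx : S x ∈ domain I) (i : Fin n) :
    HasDerivAt (fun y => f i (S y i)) (deriv (f i) (S x i) * r i) x :=
  HasDerivAt.comp x (differentiableAt_param hI hf hx i).hasDerivAt (hasDerivAt_pi.mp hS i)

/-- The derivatives of `c` supply the terms of the forces that contain `P'` and `P''`. In `∑ c_γ^β
p_γ'` the symmetric part of `c` supplies the term with the derivative of `P` in `x`, and what is
left, `-∑ c_β^γ p_γ'`, belongs to the tail density. Subtracting the tail potential thus leaves the
forces alone. -/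
theorem hasDerivAt_shiftLoc (hI : ∀ i, IsOpen (I i)) (hf : ∀ i, ContDiffOn ℝ ∞ (f i) (I i))
    {c : ℕ → ℕ → Vec n → ℝ} (hc : IsFlux (domain I) f c) {S ψ : ℝ → Vec n} {r ψ' : Vec n}
    {p : ℕ → ℝ → ℝ} {x : ℝ} (hS : HasDerivAt S r x) (hx : S x ∈ domain I)
    (hψ : HasDerivAt ψ ψ' x)
    (hp : ∀ β ∈ Icc 1 (n - 1), HasDerivAt (p β) (dens (S x) r (ψ x) β) x)
    {β : ℕ} (hβ : β ∈ Icc 1 (n - 1)) :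
    HasDerivAt (fun y => shiftLoc f c (S y) (ψ y) (fun γ => p γ y) β)
      (∑ l, ((n : ℝ) - β) * S x l ^ (n - β - 1) *
        force f (S x) r (ψ x) ψ' (fun γ => p γ x) (dens (S x) r (ψ x)) l +
        ∑ j, tailSpeed f c β (S x) j * r j * ψ x j) x := by
  have hSi := hasDerivAt_pi.mp hS
  have h1 := HasDerivAt.fun_sum (u := Icc 1 (n - 1)) fun γ hγ =>
    (hasDerivAt_comp (hc γ hγ β hβ (S x) hx).1 hS).fun_mul (hp γ hγ)
  have h2 := HasDerivAt.fun_sum (u := univ) fun (l : Fin n) _ =>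
    (((hSi l).fun_pow (n - β - 1)).const_mul ((n : ℝ) - β)).fun_mul
      ((hasDerivAt_param hI hf hS hx l).fun_mul
        ((hasDerivAt_diffProd hS hx.2 l).fun_mul (hasDerivAt_pi.mp hψ l)))
  refine (h1.add h2).congr_deriv ?_
  have e : ((n - β - 1 : ℕ) : ℝ) = (n : ℝ) - β - 1 := by
    rw [mem_Icc] at hβ
    rw [Nat.cast_sub (by omega), Nat.cast_sub (by omega)]
    simp
  set R := S x
  set q : ℕ → ℝ := fun γ => p γ x
  -- the terms with `p`
  have hA : ∑ γ ∈ Icc 1 (n - 1), (∑ i, pd i (c γ β) R * r i) * q γ =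
      ∑ l, ((n : ℝ) - β) * R l ^ (n - β - 1) * r l *
        ((1 / 2) * deriv (f l) (R l) * polyDer n q (R l) + f l (R l) * polyDer2 n q (R l)) := by
    simp only [← sum_tailLoc_mul, sum_mul, mul_sum]
    rw [sum_comm]
    exact sum_congr rfl fun l _ => sum_congr rfl fun γ hγ => by
      rw [hc.pd_eq hγ hβ hx]; ring
  -- the terms with the symmetric part of `c`
  have hB : ∑ γ ∈ Icc 1 (n - 1), c γ β R * dens R r (ψ x) γ +
      ∑ γ ∈ Icc 1 (n - 1), c β γ R * dens R r (ψ x) γ =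
      ∑ l, ((n : ℝ) - β) * R l ^ (n - β - 1) * (f l (R l) * polyDer n (dens R r (ψ x)) (R l)) := by
    rw [← sum_add_distrib]
    simp only [polyDer, mul_sum]
    rw [sum_comm]
    refine sum_congr rfl fun γ hγ => ?_
    rw [← add_mul, hc.symm_eq hγ hβ hx, sum_mul]
    exact sum_congr rfl fun l _ => by ring
  have hC : ∑ j, tailSpeed f c β R j * r j * ψ x j =
      ∑ l, diffProd R l * tailLoc n (f l) β (R l) * r l * ψ x l -
        ∑ γ ∈ Icc 1 (n - 1), c β γ R * dens R r (ψ x) γ := by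
    simp only [dens, mul_sum]
    rw [sum_comm, ← sum_sub_distrib]
    refine sum_congr rfl fun j _ => ?_
    rw [tailSpeed_eq, sub_mul, sub_mul, sum_mul, sum_mul]
    congr 1
    exact sum_congr rfl fun γ _ => by ring
  rw [sum_add_distrib, hA, hC]
  have hgoal : ∑ γ ∈ Icc 1 (n - 1), c γ β R * dens R r (ψ x) γ =
      ∑ l, ((n : ℝ) - β) * R l ^ (n - β - 1) *
        (f l (R l) * polyDer n (dens R r (ψ x)) (R l)) -
      ∑ γ ∈ Icc 1 (n - 1), c β γ R * dens R r (ψ x) γ := by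
    rw [← hB]; ring
  rw [hgoal]
  rw [← sub_eq_zero]
  have : ∀ a b s t u w : ℝ, a + (b - s) + t - (u + (w - s)) = a + b + t - (u + w) := by
    intros; ring
  rw [this]
  simp only [← sum_add_distrib, ← sum_sub_distrib]
  refine sum_eq_zero fun l _ => ?_
  rw [sum_sub_mul_inv, force, momDer, mom, tailLoc, e, Nat.sub_sub (n - β) 1 1]
  ring

/-- The local part of the operators, evaluated. -/
noncomputable def locOp (f : Fin n → ℝ → ℝ) (R r ψ ψ' : Vec n) (i : Fin n) : ℝ :=
  diffProd R i ^ 2 * (f i (R i) * (ψ' i + cauchySum R (fun k => r k * ψ k) i -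
    ψ i * cauchySum R r i + cauchySum R 1 i * r i * ψ i) +
    (1 / 2) * deriv (f i) (R i) * r i * ψ i) +
    r i * cauchySum R (fun k => cometric f R k * ψ k) i

/-- The component `a` is separated from `ψ'` so that a Hessian can be inserted with its derivatives
in either order. -/
theorem sum_cometric_mul_conn (hf : Admissible I f) {R : Vec n} (hR : R ∈ domain I)
    (r ψ : Vec n) (a : ℝ) (i : Fin n) (ψ' : Vec n) (ha : ψ' i = a) :
    cometric f R i * a - ∑ j, ∑ k, cometric f R i * conn f j i k R * r k * ψ j =
      locOp f R r ψ ψ' i := by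
  have hG := cometric_ne_zero hf hR i
  have h1 : ∀ j k, cometric f R i * conn f j i k R * r k * ψ j =
      (if j = k then cometric f R i * logDer f R j i * r k * ψ j else 0) +
      (if j = i then cometric f R i * logDer f R j k * r k * ψ j else 0) -
      (if i = k then cometric f R j * logDer f R i j * r k * ψ j else 0) := by
    intro j k
    rw [conn]
    split_ifs <;> field_simp <;> ring
  simp only [h1, sum_sub_distrib, sum_add_distrib, sum_ite_eq, mem_univ, if_true]
  have h2 : ∑ j, cometric f R i * logDer f R j i * r j * ψ j =
      cometric f R i * (-cauchySum R (fun k => r k * ψ k) i) - cometric f R i *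
        (cauchySum R 1 i + (1 / 2) * deriv (f i) (R i) / f i (R i)) * r i * ψ i := by
    have : ∀ j, cometric f R i * logDer f R j i * r j * ψ j =
        cometric f R i * (-((R i - R j)⁻¹ * (r j * ψ j))) -
        if j = i then cometric f R i *
        (cauchySum R 1 j + (1 / 2) * deriv (f j) (R j) / f j (R j)) * r j * ψ j else 0 := by
      intro j
      rw [logDer, cauchySum_one, ← neg_sub (R i) (R j), inv_neg]
      split_ifs <;> ring
    rw [sum_congr rfl fun j _ => this j, sum_sub_distrib, ← mul_sum, sum_neg_distrib, cauchySum]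
    simp
  have h3 : ∑ j, ∑ k, (if j = i then cometric f R i * logDer f R j k * r k * ψ j else 0) =
      cometric f R i * ψ i * (cauchySum R r i -
        (cauchySum R 1 i + (1 / 2) * deriv (f i) (R i) / f i (R i)) * r i) := by
    rw [sum_comm]
    simp only [sum_ite_eq', mem_univ, if_true]
    have : ∀ k, cometric f R i * logDer f R i k * r k * ψ i = cometric f R i * ψ i *
        ((R i - R k)⁻¹ * r k) - if i = k then cometric f R i * ψ i *
        ((cauchySum R 1 i + (1 / 2) * deriv (f i) (R i) / f i (R i)) * r k) else 0 := by
      intro k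
      rw [logDer, cauchySum_one]
      split_ifs <;> ring
    rw [sum_congr rfl fun k _ => this k, sum_sub_distrib, ← mul_sum, sum_ite_eq,
      show ∑ k, (R i - R k)⁻¹ * r k = cauchySum R r i from rfl]
    simp
    ring
  have h4 : ∑ j, cometric f R j * logDer f R i j * r i * ψ j =
      r i * cauchySum R (fun k => cometric f R k * ψ k) i -
      cometric f R i * (cauchySum R 1 i + (1 / 2) * deriv (f i) (R i) / f i (R i)) * r i * ψ i := by
    have : ∀ j, cometric f R j * logDer f R i j * r i * ψ j =
        r i * ((R i - R j)⁻¹ * (cometric f R j * ψ j)) - if i = j then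
        cometric f R j * (cauchySum R 1 i + (1 / 2) * deriv (f i) (R i) / f i (R i)) * r i * ψ j
        else 0 := by
      intro j
      rw [logDer, cauchySum_one]
      split_ifs <;> ring
    rw [sum_congr rfl fun j _ => this j, sum_sub_distrib, ← mul_sum, sum_ite_eq,
      show ∑ k, (R i - R k)⁻¹ * (cometric f R k * ψ k) =
        cauchySum R (fun k => cometric f R k * ψ k) i from rfl]
    simp
  rw [h2, h3, h4, locOp, ha, cometric]
  have := (hf i).2 _ (hR.1 i)
  field_simp
  ring

/-- An identity for arbitrary numbers `p` and `q`. In the operator they are the two families of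
nonlocal primitives; for the Hamiltonian system they are functions of `R`. -/
theorem locOp_add_tails {c : ℕ → ℕ → Vec n → ℝ} {R : Vec n} (hR : Function.Injective R)
    (r ψ ψ' : Vec n) (p q : ℕ → ℝ) (i : Fin n) :
    locOp f R r ψ ψ' i + ∑ β ∈ Icc 1 (n - 1),
        (speed n β R i * r i * q β + tailSpeed f c β R i * r i * p β) =
      diffProd R i * force f R r ψ ψ' p (dens R r ψ) i -
        r i * ∑ β ∈ Icc 1 (n - 1), speed n β R i * (shiftLoc f c R ψ p β - q β) := by
  have h1 : ∑ β ∈ Icc 1 (n - 1), speed n β R i *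
      ∑ l, ((n : ℝ) - β) * R l ^ (n - β - 1) * (f l (R l) * (diffProd R l * ψ l)) =
      cometric f R i * cauchySum R 1 i * ψ i - cauchySum R (fun k => cometric f R k * ψ k) i := by
    have h : ∑ β ∈ Icc 1 (n - 1), speed n β R i *
      ∑ l, ((n : ℝ) - β) * R l ^ (n - β - 1) * (f l (R l) * (diffProd R l * ψ l)) =
      ∑ l, (∑ β ∈ Icc 1 (n - 1), speed n β R i * (((n : ℝ) - β) * R l ^ (n - β - 1))) *
        (f l (R l) * (diffProd R l * ψ l)) := by
      simp only [mul_sum, sum_mul]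
      rw [sum_comm]
      exact sum_congr rfl fun l _ => sum_congr rfl fun β _ => by ring
    rw [h]
    simp only [sum_speed_mul_deriv hR]
    have h2 : ∀ l, diffProd R l * ((R l - R i)⁻¹ + if i = l then ∑ k, (R l - R k)⁻¹ else 0) *
        (f l (R l) * (diffProd R l * ψ l)) = -((R i - R l)⁻¹ * (cometric f R l * ψ l)) +
        if i = l then cometric f R l * (∑ k, (R l - R k)⁻¹) * ψ l else 0 := by
      intro l
      rw [cometric, ← neg_sub (R i) (R l), inv_neg]
      split_ifs <;> ring
    rw [sum_congr rfl fun l _ => h2 l, sum_add_distrib, sum_neg_distrib, sum_ite_eq,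
      cauchySum_one, cauchySum]
    simp
    ring
  have h3 : ∑ β ∈ Icc 1 (n - 1), speed n β R i * ∑ γ ∈ Icc 1 (n - 1), c γ β R * p γ =
      ∑ β ∈ Icc 1 (n - 1), (∑ γ ∈ Icc 1 (n - 1), speed n γ R i * c β γ R) * p β := by
    simp only [mul_sum, sum_mul]
    rw [sum_comm]
    exact sum_congr rfl fun l _ => sum_congr rfl fun β _ => by ring
  have h4 : ∑ β ∈ Icc 1 (n - 1), tailSpeed f c β R i * r i * p β =
      r i * (diffProd R i * ((1 / 2) * deriv (f i) (R i) * polyDer n p (R i) +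
        f i (R i) * polyDer2 n p (R i)) -
      ∑ β ∈ Icc 1 (n - 1), (∑ γ ∈ Icc 1 (n - 1), speed n γ R i * c β γ R) * p β) := by
    rw [← sum_tailLoc_mul, mul_sum, ← sum_sub_distrib, mul_sum]
    exact sum_congr rfl fun β _ => by rw [tailSpeed_eq]; ring
  have h5 : ∑ β ∈ Icc 1 (n - 1), speed n β R i * r i * q β =
      r i * ∑ β ∈ Icc 1 (n - 1), speed n β R i * q β := by
    rw [mul_sum]
    exact sum_congr rfl fun β _ => by ring
  simp only [shiftLoc, mul_sub, mul_add, sum_sub_distrib, sum_add_distrib]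
  simp only [mul_sub, mul_add] at h1 h4
  rw [h1, h3, h4, h5, force, momDer, mom, polyDer_dens hR, locOp, cometric]
  ring

end Hydro

namespace Hydro

open Finset

variable {n : ℕ} {I : Fin n → Set ℝ} {f : Fin n → ℝ → ℝ}

/-! ### The system as a Hamiltonian system -/

theorem pd_comm {h : Vec n → ℝ} {R : Vec n} (hh : ContDiffAt ℝ ∞ h R) (i j : Fin n) :
    pd i (pd j h) R = pd j (pd i h) R := by
  have h2 : ContDiffAt ℝ 2 h R := hh.of_le (WithTop.coe_le_coe.mpr le_top)
  have hs : IsSymmSndFDerivAt ℝ h R := h2.isSymmSndFDerivAt (by simp)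
  have hd : DifferentiableAt ℝ (fderiv ℝ h) R :=
    (h2.fderiv_right (m := 1) (by norm_num)).differentiableAt one_ne_zero
  have key : ∀ i j : Fin n, pd i (pd j h) R =
      fderiv ℝ (fderiv ℝ h) R (Pi.single i 1) (Pi.single j 1) := by
    intro i j
    have h1 : HasFDerivAt (pd j h)
        ((ContinuousLinearMap.apply ℝ ℝ (Pi.single j 1 : Vec n)).comp (fderiv ℝ (fderiv ℝ h) R)) R :=
      (ContinuousLinearMap.apply ℝ ℝ (Pi.single j 1 : Vec n)).hasFDerivAt.comp R hd.hasFDerivAt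
    rw [pd, h1.fderiv]
    rfl
  rw [key, key]
  exact hs.eq _ _

theorem contDiffOn_pd {D : Set (Vec n)} (hD : IsOpen D) {h : Vec n → ℝ}
    (hh : ContDiffOn ℝ ∞ h D) (i : Fin n) : ContDiffOn ℝ ∞ (pd i h) D :=
  ((contDiffOn_infty_iff_fderiv_of_isOpen hD).mp hh).2.clm_apply contDiffOn_const

theorem hasDerivAt_pd_line {D : Set (Vec n)} (hD : IsOpen D) {h : Vec n → ℝ}
    (hh : ContDiffOn ℝ ∞ h D) {R : Vec n} (hR : R ∈ D) (j : Fin n) :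
    HasDerivAt (fun t : ℝ => h (R + t • Pi.single j 1)) (pd j h R) 0 :=
  hasDerivAt_line ((hh.contDiffAt (hD.mem_nhds hR)).differentiableAt (by simp)) j

/-- The potentials `∑_j κ_j(R^j) v_β^j / ∏_{k ≠ j} (R^j - R^k)`; the one with `β = 1` is a
density `h`, the others have the derivatives `v_β^i ∂_i h`. -/
noncomputable def potential (k : Fin n → ℝ → ℝ) (β : ℕ) (R : Vec n) : ℝ :=
  ∑ j, k j (R j) * (speed n β R j * (diffProd R j)⁻¹)

theorem contDiffOn_diffProd_inv (j : Fin n) :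
    ContDiffOn ℝ ∞ (fun R : Vec n => (diffProd R j)⁻¹) (domain I) :=
  (contDiff_diffProd j).contDiffOn.inv fun _ hR => diffProd_ne_zero hR.2 j

theorem contDiffOn_potential {k : Fin n → ℝ → ℝ} (hk : ∀ i, ContDiffOn ℝ ∞ (k i) (I i)) (β : ℕ) :
    ContDiffOn ℝ ∞ (potential k β) (domain I) :=
  ContDiffOn.sum fun j _ => (ContDiffOn.comp_apply_domain (hk j)).mul
    ((contDiff_speed β j).contDiffOn.mul (contDiffOn_diffProd_inv j))

/-- The potentials are the coefficients of the Lagrange interpolation polynomial of the values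
`κ_j(R^j)`. Its `R^i`-derivative has degree below `n` and vanishes at the other nodes, so it is a
multiple of `ω_i`; the common factor is `∂_i h`. -/
theorem pd_potential (hI : ∀ i, IsOpen (I i)) {k : Fin n → ℝ → ℝ}
    (hk : ∀ i, ContDiffOn ℝ ∞ (k i) (I i)) (β : ℕ) {R : Vec n} (hR : R ∈ domain I) (i : Fin n) :
    pd i (potential k β) R = speed n β R i * (deriv (k i) (R i) * (diffProd R i)⁻¹ +
      ∑ j, k j (R j) * (R j - R i)⁻¹ * (diffProd R j)⁻¹ -
      k i (R i) * cauchySum R 1 i * (diffProd R i)⁻¹) := by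
  have hd : DifferentiableAt ℝ (potential k β) R :=
    ((contDiffOn_potential hk β).contDiffAt ((isOpen_domain hI).mem_nhds hR)).differentiableAt
      (by simp)
  have e : R + (0 : ℝ) • (Pi.single i 1 : Vec n) = R := by simp
  refine pd_eq_of_hasDerivAt hd ?_
  have h1 : ∀ j, HasDerivAt (fun t : ℝ => k j ((R + t • (Pi.single i 1 : Vec n)) j))
      (deriv (k j) (R j) * (Pi.single i 1 : Vec n) j) 0 := by
    intro j
    have := hasDerivAt_param (f := k) hI hk (S := fun t : ℝ => R + t • (Pi.single i 1 : Vec n))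
      (r := Pi.single i 1) (x := 0) (by simpa using
        ((hasDerivAt_id (0 : ℝ)).smul_const (Pi.single i 1 : Vec n)).const_add R)
      (by rwa [e]) j
    simpa only [e] using this
  have h2 := HasDerivAt.fun_sum (u := univ) fun (j : Fin n) _ => (h1 j).fun_mul
    ((hasDerivAt_line (differentiable_speed β j R) i).fun_mul
      ((hasDerivAt_line (differentiable_diffProd j R) i).fun_inv
        (by rw [e]; exact diffProd_ne_zero hR.2 j)))
  refine h2.congr_deriv ?_
  simp only [e, pd_speed hR.2, pd_diffProd hR.2]
  have h3 : ∀ j, deriv (k j) (R j) * (Pi.single i 1 : Vec n) j * (speed n β R j *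
      (diffProd R j)⁻¹) + k j (R j) * ((speed n β R i - speed n β R j) * (R j - R i)⁻¹ *
      (diffProd R j)⁻¹ + speed n β R j * (-(diffProd R j *
      ((if j = i then ∑ m, (R j - R m)⁻¹ else 0) - (R j - R i)⁻¹)) / diffProd R j ^ 2)) =
      (if i = j then speed n β R j * (deriv (k j) (R j) * (diffProd R j)⁻¹ -
        k j (R j) * cauchySum R 1 j * (diffProd R j)⁻¹) else 0) +
      speed n β R i * (k j (R j) * (R j - R i)⁻¹ * (diffProd R j)⁻¹) := by
    intro j
    have h0 := diffProd_ne_zero hR.2 j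
    have h4 : ∀ a : ℝ, -(diffProd R j * a) / diffProd R j ^ 2 = -a * (diffProd R j)⁻¹ := by
      intro a
      field_simp
    rw [h4, cauchySum_one]
    by_cases hij : i = j
    · subst hij
      simp
      ring
    · rw [if_neg (Ne.symm hij), if_neg hij, Pi.single_apply, if_neg (Ne.symm hij)]
      ring
  rw [sum_congr rfl fun j _ => h3 j, sum_add_distrib, ← mul_sum]
  simp
  ring

/-- Differentiating the interpolation identity `P(R^i) = κ_i(R^i)` in `R^i` gives `ω_i(R^i) ∂_i h +
P'(R^i) = κ_i'(R^i)`. -/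
theorem mom_potential (hI : ∀ i, IsOpen (I i)) {k : Fin n → ℝ → ℝ}
    (hk : ∀ i, ContDiffOn ℝ ∞ (k i) (I i)) {R : Vec n} (hR : R ∈ domain I) (i : Fin n) :
    mom R (fun j => pd j (potential k 1) R) (fun β => potential k β R) i = deriv (k i) (R i) := by
  have h1 : polyDer n (fun β => potential k β R) (R i) =
      ∑ j, diffProd R i * ((R i - R j)⁻¹ + if j = i then ∑ m, (R i - R m)⁻¹ else 0) *
        (k j (R j) * (diffProd R j)⁻¹) := by
    simp only [← sum_speed_mul_deriv hR.2, polyDer, potential, mul_sum, sum_mul]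
    rw [sum_comm]
    exact sum_congr rfl fun j _ => sum_congr rfl fun β _ => by ring
  have h2 : ∑ j, k j (R j) * (R j - R i)⁻¹ * (diffProd R j)⁻¹ =
      -cauchySum R (fun j => k j (R j) * (diffProd R j)⁻¹) i := by
    rw [cauchySum, ← sum_neg_distrib]
    refine sum_congr rfl fun j _ => ?_
    rw [← neg_sub (R i) (R j), inv_neg]
    ring
  have h0 := diffProd_ne_zero hR.2 i
  rw [mom, pd_potential hI hk 1 hR, speed_one, h1, sum_nodalDer_mul, h2]
  field_simp
  ring

/-- The constants of integration: `s_β` is constant for `n ≠ 2`. -/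
noncomputable def shiftConst (n : ℕ) (β : ℕ) (R : Vec n) : ℝ :=
  if n = 2 then (1 / 2) * ∑ i, R i else if β = 2 then -1 else 0

/-- The value of `f κ'' + ½ f' κ'`. -/
noncomputable def drift (n : ℕ) : ℝ := if n = 2 then 1 / 2 else 0

/-- For `n ≥ 3` the speed `v_2` is among the tails, and the constant `-1` at `β = 2` produces it
with zero forces. For `n = 2` only `v_1` is available, and `½ (R^i - R^k) - ½ (R^1 + R^2)`, with `k
≠ i`, replaces it. For `n = 1` the speed is zero. -/
theorem sum_shiftConst (R : Vec n) (i : Fin n) :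
    diffProd R i * drift n - ∑ β ∈ Icc 1 (n - 1), speed n β R i * shiftConst n β R =
      speed n 2 R i := by
  by_cases h2 : n = 2
  · subst h2
    simp only [drift, shiftConst, if_true]
    rw [show Icc 1 (2 - 1) = {1} from rfl, sum_singleton, speed_one, speed_two, diffProd]
    fin_cases i
    · rw [show (univ : Finset (Fin 2)).erase ((fun i => i) ⟨0, by omega⟩) = {1} from rfl]
      simp
      ring
    · rw [show (univ : Finset (Fin 2)).erase ((fun i => i) ⟨1, by omega⟩) = {0} from rfl]
      simp
      ring
  · simp only [drift, shiftConst, if_neg h2, mul_ite, mul_neg, mul_one, mul_zero, zero_sub,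
      sum_ite_eq', mem_Icc]
    by_cases h : n = 1
    · subst h
      have : i = 0 := Subsingleton.elim _ _
      simp [speed_two, this]
    · have hn := i.pos
      rw [if_pos (by omega)]
      ring

theorem pd_shiftConst {β : ℕ} (hβ : β ∈ Icc 1 (n - 1)) (R : Vec n) (j : Fin n) :
    HasDerivAt (fun t : ℝ => shiftConst n β (R + t • Pi.single j 1))
      (((n : ℝ) - β) * R j ^ (n - β - 1) * drift n) 0 := by
  by_cases h2 : n = 2
  · have hb : β = 1 := by
      rw [mem_Icc] at hβ
      omega
    subst hb
    have e : (n : ℝ) = 2 := by exact_mod_cast h2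
    have e1 : n - 1 - 1 = 0 := by omega
    simp only [shiftConst, drift, if_pos h2, e, e1]
    have h := ((hasDerivAt_id (0 : ℝ)).const_add (∑ i, R i)).const_mul (1 / 2 : ℝ)
    refine (h.congr_of_eventuallyEq (Filter.Eventually.of_forall fun t => ?_)).congr_deriv
      (by norm_num)
    simp [sum_add_distrib, Pi.single_apply]
  · simp only [shiftConst, drift, if_neg h2, mul_zero]
    exact hasDerivAt_const _ _

theorem contDiff_shiftConst (β : ℕ) : ContDiff ℝ ∞ (shiftConst n β) := by
  unfold shiftConst
  split_ifs <;> fun_prop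

theorem contDiffOn_shiftLoc (hI : ∀ i, IsOpen (I i)) (hf : ∀ i, ContDiffOn ℝ ∞ (f i) (I i))
    {c : ℕ → ℕ → Vec n → ℝ} (hc : IsFlux (domain I) f c) {ψ : Vec n → Vec n}
    (hψ : ∀ i, ContDiffOn ℝ ∞ (fun R => ψ R i) (domain I)) {p : ℕ → Vec n → ℝ}
    (hp : ∀ β, ContDiffOn ℝ ∞ (p β) (domain I)) {β : ℕ} (hβ : β ∈ Icc 1 (n - 1)) :
    ContDiffOn ℝ ∞ (fun R => shiftLoc f c R (ψ R) (fun γ => p γ R) β) (domain I) := by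
  unfold shiftLoc
  refine (ContDiffOn.sum fun γ hγ => (hc.contDiffOn hI hf hγ hβ).mul (hp γ)).add
    (ContDiffOn.sum fun l _ => ContDiffOn.mul (by fun_prop) ?_)
  exact (ContDiffOn.comp_apply_domain (hf l)).mul ((contDiff_diffProd l).contDiffOn.mul (hψ l))

/-- A linear first-order equation for `κ'`, solved with the integrating factor `exp E`, where `E' =
f' / (2f)`. -/
theorem exists_potential_param (hI : ∀ i, IsOpen (I i) ∧ (I i).OrdConnected)
    (hf : Admissible I f) (a : ℝ) : ∃ k : Fin n → ℝ → ℝ, ∀ i, ContDiffOn ℝ ∞ (k i) (I i) ∧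
      ∀ r ∈ I i, f i r * deriv (deriv (k i)) r + (1 / 2) * deriv (f i) r * deriv (k i) r = a := by
  have hprim : ∀ (i : Fin n) (g : ℝ → ℝ), ContDiffOn ℝ ∞ g (I i) →
      ∃ G : ℝ → ℝ, ContDiffOn ℝ ∞ G (I i) ∧ ∀ r ∈ I i, HasDerivAt G (g r) r := by
    intro i g hg
    obtain ⟨G, hG⟩ := exists_hasDerivAt_of_contDiffOn (hI i).1 (hI i).2 hg.continuousOn
    refine ⟨G, (contDiffOn_infty_iff_deriv_of_isOpen (hI i).1).mpr
      ⟨fun r hr => (hG r hr).differentiableAt.differentiableWithinAt,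
        hg.congr fun r hr => (hG r hr).deriv⟩, hG⟩
  have hex : ∀ i : Fin n, ∃ k : ℝ → ℝ, ContDiffOn ℝ ∞ k (I i) ∧
      ∀ r ∈ I i, f i r * deriv (deriv k) r + (1 / 2) * deriv (f i) r * deriv k r = a := by
    intro i
    have hfi := (hf i).1
    have hf0 := (hf i).2
    obtain ⟨E, hE, hE'⟩ := hprim i (fun r => (1 / 2) * deriv (f i) r * (f i r)⁻¹)
      ((contDiffOn_const.mul (contDiffOn_deriv (hI i).1 hfi)).mul (hfi.inv hf0))
    obtain ⟨W, hW, hW'⟩ := hprim i (fun r => a * Real.exp (E r) * (f i r)⁻¹)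
      ((contDiffOn_const.mul hE.exp).mul (hfi.inv hf0))
    -- The constant `1` picks one homogeneous solution; any other constant would do.
    obtain ⟨k, hk, hk'⟩ := hprim i (fun r => (1 + W r) * Real.exp (-E r))
      ((contDiffOn_const.add hW).mul hE.neg.exp)
    refine ⟨k, hk, fun r hr => ?_⟩
    · have h1 : deriv k =ᶠ[nhds r] fun r => (1 + W r) * Real.exp (-E r) := by
        filter_upwards [(hI i).1.mem_nhds hr] with u hu using (hk' u hu).deriv
      have h2 := ((hW' r hr).const_add 1).fun_mul (hE' r hr).fun_neg.exp
      rw [h1.deriv_eq, h2.deriv, h1.self_of_nhds]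
      have h3 : Real.exp (E r) * Real.exp (-E r) = 1 := by rw [← Real.exp_add]; simp
      have h4 := hf0 r hr
      have h5 : f i r * (f i r)⁻¹ = 1 := mul_inv_cancel₀ h4
      linear_combination (a * Real.exp (E r) * Real.exp (-E r) -
        (1 + W r) * Real.exp (-E r) * (1 / 2) * deriv (f i) r) * h5 + a * h3
  choose k hk using hex
  exact ⟨k, hk⟩

/-- The local part of `A` applied to `dh` is linear in `R_x`, so the matrix entry is obtained by
taking the `j`-th basis vector as the tangent. The factorization then applies unchanged. -/
theorem hessian_metric (hI : ∀ i, IsOpen (I i)) (hf : Admissible I f) {R : Vec n}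
    (hR : R ∈ domain I) {h : Vec n → ℝ} (hh : ContDiffOn ℝ ∞ h (domain I)) (i j : Fin n) :
    hessian (metric f) h i j R = locOp f R (Pi.single j 1) (fun k => pd k h R)
      (fun k => pd j (pd k h) R) i := by
  have hh' := hh.contDiffAt ((isOpen_domain hI).mem_nhds hR)
  rw [← sum_cometric_mul_conn hf hR (Pi.single j 1) (fun k => pd k h R) (pd i (pd j h) R) i
    (fun k => pd j (pd k h) R) (pd_comm hh' j i), hessian]
  simp only [metric_inv_apply hf hR, ite_mul, zero_mul, sum_ite_eq, mem_univ, if_true,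
    christoffel_metric hI hf hR, Pi.single_apply, mul_ite, mul_one, mul_zero, sum_ite_eq']
  rw [mul_sub, mul_sum]
  simp only [mul_assoc]

theorem isHamiltonianSystem (hI : ∀ i, IsOpen (I i) ∧ (I i).OrdConnected)
    (hf : Admissible I f) {c : ℕ → ℕ → Vec n → ℝ} (hc : IsFlux (domain I) f c) :
    IsHamiltonianSystem (domain I) (metric f) (n - 1) (speed n) (tailSpeed f c) (speed n 2) := by
  have hO : ∀ i, IsOpen (I i) := fun i => (hI i).1
  have hD := isOpen_domain hO
  have hfs : ∀ i, ContDiffOn ℝ ∞ (f i) (I i) := fun i => (hf i).1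
  obtain ⟨k, hk⟩ := exists_potential_param hI hf (drift n)
  have hks : ∀ i, ContDiffOn ℝ ∞ (k i) (I i) := fun i => (hk i).1
  set h : Vec n → ℝ := potential k 1 with hh
  set P : ℕ → Vec n → ℝ := potential k with hP
  set ψ : Vec n → Vec n := fun R i => pd i h R with hψ
  have hPs : ∀ β, ContDiffOn ℝ ∞ (P β) (domain I) := contDiffOn_potential hks
  have hψs : ∀ i, ContDiffOn ℝ ∞ (fun R => ψ R i) (domain I) :=
    fun i => contDiffOn_pd hD (hPs 1) i
  set Q : ℕ → Vec n → ℝ := fun β R => shiftLoc f c R (ψ R) (fun γ => P γ R) β -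
    shiftConst n β R with hQ
  have hQs : ∀ β ∈ Icc 1 (n - 1), ContDiffOn ℝ ∞ (Q β) (domain I) := fun β hβ =>
    (contDiffOn_shiftLoc hO hfs hc hψs hPs hβ).sub (contDiff_shiftConst β).contDiffOn
  have hpdP : ∀ β, ∀ R ∈ domain I, ∀ j, pd j (P β) R = speed n β R j * pd j h R := by
    intro β R hR j
    rw [hP, hh, pd_potential hO hks β hR, pd_potential hO hks 1 hR, speed_one, one_mul]
  have hline : ∀ (R : Vec n) (j : Fin n), HasDerivAt
      (fun t : ℝ => R + t • (Pi.single j 1 : Vec n)) (Pi.single j 1) 0 := fun R j => by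
    simpa using ((hasDerivAt_id (0 : ℝ)).smul_const (Pi.single j 1 : Vec n)).const_add R
  have e : ∀ (R : Vec n) (j : Fin n), R + (0 : ℝ) • (Pi.single j 1 : Vec n) = R := by simp
  have hdens : ∀ β, ∀ R ∈ domain I, ∀ j, pd j (P β) R = dens R (Pi.single j 1) (ψ R) β := by
    intro β R hR j
    rw [hpdP β R hR j, dens]
    simp [Pi.single_apply, hψ]
  have hψline : ∀ R ∈ domain I, ∀ j, HasDerivAt (fun t : ℝ => ψ (R + t • Pi.single j 1))
      (fun i => pd j (pd i h) R) 0 := fun R hR j =>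
    hasDerivAt_pi.mpr fun i => hasDerivAt_pd_line hD (hψs i) hR j
  -- The momenta are `κ_i'(R^i)`, so the force along the `j`-th direction is `f κ'' + ½ f' κ'` times
  -- `δ_ij`.
  have hforce : ∀ R ∈ domain I, ∀ i j, force f R (Pi.single j 1) (ψ R)
      (fun i => pd j (pd i h) R) (fun β => P β R) (dens R (Pi.single j 1) (ψ R)) i =
      if i = j then drift n else 0 := by
    intro R hR i j
    have h1 := hasDerivAt_mom (hline R j) (by rw [e]; exact hR.2) (hψline R hR j)
      (p := fun β t => P β (R + t • Pi.single j 1)) (p' := dens R (Pi.single j 1) (ψ R))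
      (fun β _ => by rw [← hdens β R hR j]; exact hasDerivAt_pd_line hD (hPs β) hR j) i
    have hev : ∀ᶠ t : ℝ in nhds 0, R + t • (Pi.single j 1 : Vec n) ∈ domain I :=
      (hline R j).continuousAt.eventually_mem (by rw [e]; exact hD.mem_nhds hR)
    have h2 := hasDerivAt_param (f := fun i => deriv (k i)) hO
      (fun i => contDiffOn_deriv (hO i) (hks i)) (hline R j) (by rw [e]; exact hR) i
    have h3 := h1.unique (h2.congr_of_eventuallyEq (by
      filter_upwards [hev] with t ht using mom_potential hO hks ht i))
    simp only [e] at h3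
    rw [force, h3, mom_potential hO hks hR i, Pi.single_apply]
    split_ifs with hij
    · rw [← (hk i).2 (R i) (hR.1 i)]
      ring
    · ring
  refine ⟨h, P, Q, hPs 1, fun β hβ => ⟨hPs β, hQs β hβ, fun R hR j => ⟨hpdP β R hR j, ?_⟩⟩,
    fun R hR i j => ?_⟩
  · have hd : DifferentiableAt ℝ (Q β) R :=
      ((hQs β hβ).contDiffAt (hD.mem_nhds hR)).differentiableAt (by simp)
    refine pd_eq_of_hasDerivAt hd ?_
    have h1 := hasDerivAt_shiftLoc hO hfs hc (hline R j) (by rw [e]; exact hR) (hψline R hR j)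
      (p := fun β t => P β (R + t • Pi.single j 1)) (fun β _ => by
        rw [e, ← hdens β R hR j]; exact hasDerivAt_pd_line hD (hPs β) hR j) hβ
    refine (h1.sub (pd_shiftConst hβ R j)).congr_deriv ?_
    simp only [e, hforce R hR]
    simp [Pi.single_apply, hψ]
  · rw [hessian_metric hO hf hR (hPs 1)]
    have h1 := locOp_add_tails (f := f) (c := c) hR.2 (Pi.single j 1) (ψ R)
      (fun i => pd j (pd i h) R) (fun β => P β R) (fun β => Q β R) i
    rw [hforce R hR] at h1
    rw [← eq_sub_iff_add_eq] at h1
    rw [show (fun k => pd k h R) = ψ R from rfl, h1, ← sum_shiftConst R i, Pi.single_apply]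
    have h2 : ∀ β, shiftLoc f c R (ψ R) (fun γ => P γ R) β - Q β R = shiftConst n β R := by
      intro β
      simp only [hQ]
      ring
    simp only [h2]
    split_ifs with hij
    · simp
    · simp

end Hydro

namespace Hydro

open Finset

/-! ### The operator `(d/dx)⁻¹` and integrals with parameters -/

section Calculus

open MeasureTheory Set Filter Topology

/-- Integrals over intervals with fixed endpoints reduce `(d/dx)⁻¹` to the fundamental theorem of
calculus. -/
theorem dInv_eq {u : ℝ → ℝ} (hu : Continuous u) {L : ℝ} (hL : ∀ x, L ≤ |x| → u x = 0) (x : ℝ) :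
    dInv u x = (1 / 2) * ((∫ y in (-L)..x, u y) + ∫ y in L..x, u y) := by
  have hc : HasCompactSupport u := HasCompactSupport.intro (isCompact_Icc (a := -L) (b := L))
    fun y hy => hL y (by
      rw [Set.mem_Icc, not_and_or, not_le, not_le] at hy
      rcases hy with h | h
      · exact le_trans (by linarith) (neg_le_abs y)
      · exact h.le.trans (le_abs_self y))
  have hi : Integrable u := hu.integrable_of_hasCompactSupport hc
  have h1 : ∫ y in Iic (-L), u y = 0 := setIntegral_eq_zero_of_forall_eq_zero fun y hy =>
    hL y (le_trans (by linarith [mem_Iic.mp hy]) (neg_le_abs y))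
  have h2 : ∫ y in Ioi L, u y = 0 := setIntegral_eq_zero_of_forall_eq_zero fun y hy =>
    hL y ((mem_Ioi.mp hy).le.trans (le_abs_self y))
  have h3 := intervalIntegral.integral_Iic_sub_Iic (a := -L) (b := x)
    (hi.integrableOn (s := Iic (-L))) hi.integrableOn
  have h4 := intervalIntegral.integral_interval_add_Ioi (a := L) (b := x)
    (hi.integrableOn (s := Ioi L)) hi.integrableOn
  rw [dInv]
  linarith

theorem hasDerivAt_dInv {u : ℝ → ℝ} (hu : Continuous u) {L : ℝ} (hL : ∀ x, L ≤ |x| → u x = 0)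
    (x : ℝ) : HasDerivAt (dInv u) (u x) x := by
  have h := ((hu.integral_hasStrictDerivAt (-L) x).hasDerivAt.add
    (hu.integral_hasStrictDerivAt L x).hasDerivAt).const_mul (1 / 2 : ℝ)
  have e : dInv u = fun x => (1 / 2) * ((∫ y in (-L)..x, u y) + ∫ y in L..x, u y) :=
    funext (dInv_eq hu hL)
  rw [e]
  exact h.congr_deriv (by ring)

/-- The effect of the kernel `½ sgn`: products of two such primitives agree at `±L`, so they drop
out of boundary differences. -/
theorem dInv_neg {u : ℝ → ℝ} (hu : Continuous u) {L : ℝ} (hL : ∀ x, L ≤ |x| → u x = 0) :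
    dInv u (-L) = -dInv u L := by
  rw [dInv_eq hu hL, dInv_eq hu hL, intervalIntegral.integral_symm L (-L)]
  simp

theorem dInv_linear {u v : ℝ → ℝ} (hu : Continuous u) (hv : Continuous v) {L : ℝ}
    (hLu : ∀ x, L ≤ |x| → u x = 0) (hLv : ∀ x, L ≤ |x| → v x = 0) (a b x : ℝ) :
    dInv (fun y => a * u y + b * v y) x = a * dInv u x + b * dInv v x := by
  rw [dInv_eq hu hLu, dInv_eq hv hLv, dInv_eq (by fun_prop) (L := L) fun y hy => by
    rw [hLu y hy, hLv y hy]; ring]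
  have h : ∀ c, ∫ y in c..x, (a * u y + b * v y) = a * (∫ y in c..x, u y) +
      b * ∫ y in c..x, v y := by
    intro c
    rw [intervalIntegral.integral_add, intervalIntegral.integral_const_mul,
      intervalIntegral.integral_const_mul]
    · exact (continuous_const.mul hu).intervalIntegrable _ _
    · exact (continuous_const.mul hv).intervalIntegrable _ _
  rw [h, h]
  ring

/-- As a convolution, `(d/dx)⁻¹` inherits joint smoothness in `x` and a parameter from convolution
theory. -/
theorem dInv_eq_convolution {u : ℝ → ℝ} (hu : Integrable u) (x : ℝ) :
    dInv u x = convolution (fun y => if 0 ≤ y then (1 / 2 : ℝ) else -(1 / 2)) u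
      (ContinuousLinearMap.mul ℝ ℝ) volume x := by
  rw [convolution_eq_swap]
  have h1 : ∀ t, ContinuousLinearMap.mul ℝ ℝ (if 0 ≤ x - t then (1 / 2 : ℝ) else -(1 / 2)) (u t) =
      (Iic x).indicator (fun t => (1 / 2) * u t) t - (Ioi x).indicator (fun t => (1 / 2) * u t) t
      := by
    intro t
    by_cases h : t ≤ x
    · simp [indicator, h, not_lt.mpr h]
    · simp [indicator, h, not_le.mp h]
  simp only [h1]
  have hi : Integrable fun t => (1 / 2 : ℝ) * u t := hu.const_mul _
  rw [integral_sub (hi.indicator measurableSet_Iic) (hi.indicator measurableSet_Ioi),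
    integral_indicator measurableSet_Iic, integral_indicator measurableSet_Ioi,
    integral_const_mul, integral_const_mul, dInv]
  ring

theorem locallyIntegrable_halfSign :
    LocallyIntegrable (fun y : ℝ => if 0 ≤ y then (1 / 2 : ℝ) else -(1 / 2)) := by
  refine LocallyIntegrable.mono (locallyIntegrable_const (1 / 2 : ℝ) (μ := volume)) ?_ ?_
  · exact (Measurable.ite measurableSet_Ici measurable_const measurable_const).aestronglyMeasurable
  · refine Eventually.of_forall fun y => ?_
    split_ifs <;> simp

/-- `(d/dx)⁻¹` preserves smooth dependence on parameters. -/
theorem contDiff_dInv {u : ℝ → ℝ → ℝ} (hu : ContDiff ℝ ∞ fun z : ℝ × ℝ => u z.1 z.2) {L : ℝ}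
    (hL : ∀ s x, L ≤ |x| → u s x = 0) :
    ContDiff ℝ ∞ fun z : ℝ × ℝ => dInv (u z.1) z.2 := by
  have hk : ∀ s x, x ∉ Icc (-L) L → u s x = 0 := fun s x hx => hL s x (by
      rw [Set.mem_Icc, not_and_or, not_le, not_le] at hx
      rcases hx with h | h
      · exact le_trans (by linarith) (neg_le_abs x)
      · exact h.le.trans (le_abs_self x))
  have hi : ∀ s, Integrable (u s) := fun s =>
    Continuous.integrable_of_hasCompactSupport
      (hu.continuous.comp (Continuous.prodMk continuous_const continuous_id))
      (HasCompactSupport.intro isCompact_Icc (hk s))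
  have h := contDiffOn_convolution_right_with_param (n := ⊤) (ContinuousLinearMap.mul ℝ ℝ)
    (μ := volume) (g := u) (s := univ) isOpen_univ (isCompact_Icc (a := -L) (b := L))
    (fun s x _ hx => hk s x hx) locallyIntegrable_halfSign hu.contDiffOn
  rw [univ_prod_univ, contDiffOn_univ] at h
  have e : (fun z : ℝ × ℝ => dInv (u z.1) z.2) = fun q : ℝ × ℝ => convolution
      (fun y => if 0 ≤ y then (1 / 2 : ℝ) else -(1 / 2)) (u q.1)
      (ContinuousLinearMap.mul ℝ ℝ) volume q.2 :=
    funext fun z => dInv_eq_convolution (hi z.1) z.2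
  rw [e]
  exact h

theorem contDiff_deriv_right {F : ℝ → ℝ → ℝ} (hF : ContDiff ℝ ∞ fun z : ℝ × ℝ => F z.1 z.2) :
    ContDiff ℝ ∞ fun z : ℝ × ℝ => deriv (F z.1) z.2 := by
  have h1 : ContDiff ℝ ∞ (Function.uncurry fun z : ℝ × ℝ => F z.1) :=
    hF.comp ((contDiff_fst.comp contDiff_fst).prodMk contDiff_snd)
  exact (ContDiff.fderiv h1 contDiff_snd le_rfl).clm_apply contDiff_const

theorem contDiff_deriv_left {F : ℝ → ℝ → ℝ} (hF : ContDiff ℝ ∞ fun z : ℝ × ℝ => F z.1 z.2) :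
    ContDiff ℝ ∞ fun z : ℝ × ℝ => deriv (fun s => F s z.2) z.1 :=
  (contDiff_deriv_right (F := fun x s => F s x)
    (hF.comp (contDiff_snd.prodMk contDiff_fst))).comp (contDiff_snd.prodMk contDiff_fst)

theorem ContDiff.slice_right {F : ℝ → ℝ → ℝ} (hF : ContDiff ℝ ∞ fun z : ℝ × ℝ => F z.1 z.2)
    (s : ℝ) : ContDiff ℝ ∞ (F s) :=
  hF.comp (contDiff_const.prodMk contDiff_id)

theorem ContDiff.slice_left {F : ℝ → ℝ → ℝ} (hF : ContDiff ℝ ∞ fun z : ℝ × ℝ => F z.1 z.2)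
    (x : ℝ) : ContDiff ℝ ∞ fun s => F s x :=
  hF.comp (contDiff_id.prodMk contDiff_const)

theorem hasDerivAt_of_contDiff {F : ℝ → ℝ} (hF : ContDiff ℝ ∞ F) (x : ℝ) :
    HasDerivAt F (deriv F x) x :=
  (hF.differentiable (by simp) x).hasDerivAt

theorem hasDerivAt_prod_left {E : Type*} [NormedAddCommGroup E] [NormedSpace ℝ E] {G : ℝ × ℝ → E}
    {s x : ℝ} (hG : DifferentiableAt ℝ G (s, x)) :
    HasDerivAt (fun t => G (t, x)) (fderiv ℝ G (s, x) (1, 0)) s :=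
  HasFDerivAt.comp_hasDerivAt (f := fun t => (t, x)) s hG.hasFDerivAt
    ((hasDerivAt_id s).prodMk (hasDerivAt_const s x))

theorem hasDerivAt_prod_right {E : Type*} [NormedAddCommGroup E] [NormedSpace ℝ E] {G : ℝ × ℝ → E}
    {s x : ℝ} (hG : DifferentiableAt ℝ G (s, x)) :
    HasDerivAt (fun y => G (s, y)) (fderiv ℝ G (s, x) (0, 1)) x :=
  HasFDerivAt.comp_hasDerivAt (f := fun y => (s, y)) x hG.hasFDerivAt
    ((hasDerivAt_const x s).prodMk (hasDerivAt_id x))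

/-- The mixed derivatives of a smooth function of two variables agree. -/
theorem deriv_deriv_comm {F : ℝ → ℝ → ℝ} (hF : ContDiff ℝ ∞ fun z : ℝ × ℝ => F z.1 z.2)
    (s x : ℝ) : deriv (fun t => deriv (F t) x) s = deriv (fun y => deriv (fun t => F t y) s) x := by
  obtain ⟨G, hG⟩ : ∃ G : ℝ × ℝ → ℝ, G = fun z => F z.1 z.2 := ⟨_, rfl⟩
  rw [← hG] at hF
  have hd : Differentiable ℝ G := hF.differentiable (by simp)
  have hr : ∀ t y, deriv (F t) y = fderiv ℝ G (t, y) (0, 1) := fun t y => by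
    rw [← (hasDerivAt_prod_right (hd (t, y))).deriv, hG]
  have hl : ∀ t y, deriv (fun s => F s y) t = fderiv ℝ G (t, y) (1, 0) := fun t y => by
    rw [← (hasDerivAt_prod_left (hd (t, y))).deriv, hG]
  have hd2 : Differentiable ℝ (fderiv ℝ G) :=
    (hF.fderiv_right (m := ∞) (by exact_mod_cast le_rfl)).differentiable (by simp)
  have h2 : ContDiffAt ℝ 2 G (s, x) := hF.contDiffAt.of_le (WithTop.coe_le_coe.mpr le_top)
  have hs : IsSymmSndFDerivAt ℝ G (s, x) := h2.isSymmSndFDerivAt (by simp)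
  simp only [hr, hl]
  have h1 := ((hasDerivAt_prod_left (hd2 (s, x))).clm_apply
    (hasDerivAt_const s ((0 : ℝ), (1 : ℝ)))).deriv
  have h2 := ((hasDerivAt_prod_right (hd2 (s, x))).clm_apply
    (hasDerivAt_const x ((1 : ℝ), (0 : ℝ)))).deriv
  simp only [map_zero, add_zero] at h1 h2
  rw [h1, h2]
  exact hs.eq _ _

theorem hasDerivAt_deriv_left {F : ℝ → ℝ → ℝ} (hF : ContDiff ℝ ∞ fun z : ℝ × ℝ => F z.1 z.2)
    (s x : ℝ) : HasDerivAt (fun y => deriv (fun t => F t y) s)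
      (deriv (fun t => deriv (F t) x) s) x := by
  rw [deriv_deriv_comm hF]
  exact hasDerivAt_of_contDiff (ContDiff.slice_right (F := fun s y => deriv (fun t => F t y) s)
    (contDiff_deriv_left hF) s) x

/-- Differentiation under the integral sign over a compact interval. -/
theorem hasDerivAt_integral {W : Set (ℝ × ℝ)} (hW : IsOpen W) {a b : ℝ}
    (hab : ∀ x ∈ uIcc a b, ((0 : ℝ), x) ∈ W) {H : ℝ → ℝ → ℝ}
    (hH : ContDiffOn ℝ ∞ (fun z : ℝ × ℝ => H z.1 z.2) W) :
    ContinuousOn (fun x => deriv (fun s => H s x) 0) (uIcc a b) ∧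
      HasDerivAt (fun s => ∫ x in a..b, H s x)
        (∫ x in a..b, deriv (fun s => H s x) 0) 0 := by
  set G : ℝ × ℝ → ℝ := fun z => H z.1 z.2 with hG
  have hdW : ∀ z ∈ W, HasDerivAt (fun s => H s z.2) (fderiv ℝ G z (1, 0)) z.1 := fun z hz =>
    hasDerivAt_prod_left ((hH.contDiffAt (hW.mem_nhds hz)).differentiableAt (by simp))
  have hcW : ContinuousOn (fun z => fderiv ℝ G z (1, 0)) W :=
    ((hH.continuousOn_fderiv_of_isOpen hW (by simp)).clm_apply continuousOn_const)
  -- Compactness gives one interval of parameters valid for all `x`, and then a constant bound for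
  -- the parameter derivative.
  obtain ⟨u, v, hu, hv, h0, hvab, huv⟩ := generalized_tube_lemma (isCompact_singleton (x := (0 : ℝ)))
    (isCompact_uIcc (a := a) (b := b)) hW (by
      rintro ⟨s, x⟩ ⟨hs, hx⟩
      simp only [Set.mem_singleton_iff] at hs
      subst hs
      exact hab x hx)
  obtain ⟨ε, hε, hball⟩ := Metric.isOpen_iff.mp hu 0 (h0 rfl)
  have hsub : ∀ s ∈ Metric.closedBall (0 : ℝ) (ε / 2), ∀ x ∈ uIcc a b, (s, x) ∈ W :=
    fun s hs x hx => huv ⟨hball (Metric.closedBall_subset_ball (by linarith) hs), hvab hx⟩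
  have hcont : ∀ s ∈ Metric.closedBall (0 : ℝ) (ε / 2), ContinuousOn (H s) (uIcc a b) :=
    fun s hs => hH.continuousOn.comp (f := fun x => (s, x))
      (Continuous.prodMk continuous_const continuous_id).continuousOn fun x hx => hsub s hs x hx
  have hz : (0 : ℝ) ∈ Metric.closedBall (0 : ℝ) (ε / 2) := Metric.mem_closedBall_self (by linarith)
  have hcont' : ContinuousOn (fun x => fderiv ℝ G ((0 : ℝ), x) (1, 0)) (uIcc a b) :=
    hcW.comp (f := fun x => ((0 : ℝ), x))
      (Continuous.prodMk continuous_const continuous_id).continuousOn fun x hx => hsub 0 hz x hx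
  obtain ⟨C, hC⟩ := ((isCompact_closedBall (0 : ℝ) (ε / 2)).prod
    (isCompact_uIcc (a := a) (b := b))).exists_bound_of_continuousOn
    (hcW.mono fun z hz => hsub z.1 hz.1 z.2 hz.2)
  have heq : ∀ x ∈ uIcc a b, deriv (fun s => H s x) 0 = fderiv ℝ G ((0 : ℝ), x) (1, 0) :=
    fun x hx => (hdW (0, x) (hsub 0 hz x hx)).deriv
  refine ⟨hcont'.congr heq, ?_⟩
  rw [intervalIntegral.integral_congr heq]
  refine (intervalIntegral.hasDerivAt_integral_of_dominated_loc_of_deriv_le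
    (F' := fun s x => fderiv ℝ G (s, x) (1, 0)) (bound := fun _ => C)
    (Metric.closedBall_mem_nhds (0 : ℝ) (half_pos hε)) ?_
    (hcont 0 hz).intervalIntegrable ?_ ?_ intervalIntegrable_const ?_).2
  · filter_upwards [Metric.closedBall_mem_nhds (0 : ℝ) (half_pos hε)] with s hs
    exact ((hcont s hs).mono uIoc_subset_uIcc).aestronglyMeasurable measurableSet_uIoc
  · exact (hcont'.mono uIoc_subset_uIcc).aestronglyMeasurable measurableSet_uIoc
  · exact Eventually.of_forall fun x hx s hs => hC (s, x) ⟨hs, uIoc_subset_uIcc hx⟩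
  · exact Eventually.of_forall fun x hx s hs => hdW (s, x) (hsub s hs x (uIoc_subset_uIcc hx))

end Calculus

end Hydro

namespace Hydro

open Finset

variable {n : ℕ}

/-! ### The symmetry behind the Jacobi identity -/

/-- The Cauchy kernel `1/(R^i - R^k)` is antisymmetric. -/
theorem sum_mul_cauchySum (R a b : Vec n) :
    ∑ i, a i * cauchySum R b i = -∑ i, b i * cauchySum R a i := by
  simp only [cauchySum, mul_sum]
  rw [sum_comm, ← sum_neg_distrib]
  refine sum_congr rfl fun i _ => ?_
  rw [← sum_neg_distrib]
  refine sum_congr rfl fun j _ => ?_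
  rw [← neg_sub (R i) (R j), inv_neg]
  ring

theorem cauchySum_add (R a b : Vec n) (i : Fin n) :
    cauchySum R (fun k => a k + b k) i = cauchySum R a i + cauchySum R b i := by
  simp [cauchySum, mul_add, sum_add_distrib]

/-- The variation of `dens R r φ β` when `R` and `r` have the variations `ξ` and `ξ'`. -/
noncomputable def densVar (R r ξ ξ' φ : Vec n) (β : ℕ) : ℝ :=
  ∑ j, ((∑ k, pd k (fun S => speed n β S j) R * ξ k) * r j + speed n β R j * ξ' j) * φ j

/-- By `pd_speed` derivatives of speeds are divided differences, so weighting with `s_β` turns them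
into divided differences of `ζ`; the index `β` disappears. -/
theorem sum_mul_densVar {R : Vec n} (hR : Function.Injective R) (r ξ ξ' φ : Vec n) {s : ℕ → ℝ}
    {ζ : Vec n} (hζ : ∀ i, ζ i = -∑ β ∈ Icc 1 (n - 1), speed n β R i * s β) :
    ∑ β ∈ Icc 1 (n - 1), s β * densVar R r ξ ξ' φ β =
      -∑ j, φ j * (ζ j * ξ' j + r j * (cauchySum R (fun k => ζ k * ξ k) j -
        ζ j * cauchySum R ξ j)) := by
  simp only [densVar, mul_sum]
  rw [sum_comm, ← sum_neg_distrib]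
  refine sum_congr rfl fun j _ => ?_
  have h1 : cauchySum R (fun k => ζ k * ξ k) j - ζ j * cauchySum R ξ j =
      ∑ k, (R j - R k)⁻¹ * ξ k * (ζ k - ζ j) := by
    rw [cauchySum, cauchySum, mul_sum, ← sum_sub_distrib]
    exact sum_congr rfl fun k _ => by ring
  have h2 : ∀ k, ζ k - ζ j =
      -∑ β ∈ Icc 1 (n - 1), (speed n β R k - speed n β R j) * s β := by
    intro k
    rw [hζ, hζ]
    simp only [sub_mul, sum_sub_distrib]
    ring
  rw [h1]
  simp only [h2]
  rw [hζ j]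
  simp only [pd_speed hR, mul_neg, sum_neg_distrib, neg_mul]
  rw [← neg_add, mul_neg, neg_neg]
  simp only [mul_sum, sum_mul, mul_add, sum_add_distrib, add_mul]
  rw [add_comm]
  congr 1
  · exact sum_congr rfl fun β _ => by ring
  · rw [sum_comm]
    exact sum_congr rfl fun k _ => sum_congr rfl fun β _ => by ring

theorem sum_variation_mul {R : Vec n} (hR : Function.Injective R) (r φ φ' e₁ e₂ ζ ξ : Vec n)
    (hξ : ∀ i, ξ i = diffProd R i * e₁ i + r i * ζ i) (p d : ℕ → ℝ) :
    ∑ i, (momDer R ξ φ 0 p d i - ζ i * momDer R r φ φ' p (dens R r φ) i) * e₂ i =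
      ∑ β ∈ Icc 1 (n - 1), (∑ l, ((n : ℝ) - β) * R l ^ (n - β - 1) * e₂ l) * d β +
      ∑ i, (polyDer2 n p (R i) * diffProd R i * e₁ i * e₂ i +
        diffProd R i * e₂ i * (φ i * (cauchySum R 1 i * ξ i - cauchySum R ξ i) -
        ζ i * (φ' i + 2 * φ i * cauchySum R 1 i * r i - φ i * cauchySum R r i +
        cauchySum R (fun k => r k * φ k) i))) := by
  have h : ∑ β ∈ Icc 1 (n - 1), (∑ l, ((n : ℝ) - β) * R l ^ (n - β - 1) * e₂ l) * d β =
      ∑ i, polyDer n d (R i) * e₂ i := by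
    simp only [polyDer, sum_mul]
    rw [sum_comm]
    exact sum_congr rfl fun i _ => sum_congr rfl fun β _ => by ring
  rw [h, ← sum_add_distrib]
  refine sum_congr rfl fun i _ => ?_
  rw [momDer, momDer, polyDer_dens hR, hξ i, Pi.zero_apply]
  ring

/-- The derivative of `ζ`. -/
noncomputable def shiftDer (R r e ζ : Vec n) (i : Fin n) : ℝ :=
  cauchySum R (fun k => r k * ζ k) i - ζ i * cauchySum R r i -
    cauchySum R 1 i * (diffProd R i * e i) + cauchySum R (fun k => diffProd R k * e k) i

/-- The difference of two variations of the momenta, paired with the forces, is a total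
derivative. -/
theorem sum_variation_sub {R : Vec n} (hR : Function.Injective R)
    (r r' φ φ' e₁ e₂ η₁' η₂' ζ₁ ζ₂ ξ₁ ξ₂ ξ₁' ξ₂' : Vec n) (p d₁ d₂ s₁ s₂ : ℕ → ℝ)
    (hζ₁ : ∀ i, ζ₁ i = -∑ β ∈ Icc 1 (n - 1), speed n β R i * s₁ β)
    (hζ₂ : ∀ i, ζ₂ i = -∑ β ∈ Icc 1 (n - 1), speed n β R i * s₂ β)
    (hξ₁ : ∀ i, ξ₁ i = diffProd R i * e₁ i + r i * ζ₁ i)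
    (hξ₂ : ∀ i, ξ₂ i = diffProd R i * e₂ i + r i * ζ₂ i)
    (hξ₁' : ∀ i, ξ₁' i = η₁' i + (r' i * ζ₁ i + r i * shiftDer R r e₁ ζ₁ i))
    (hξ₂' : ∀ i, ξ₂' i = η₂' i + (r' i * ζ₂ i + r i * shiftDer R r e₂ ζ₂ i)) :
    ∑ β ∈ Icc 1 (n - 1),
        ((∑ l, ((n : ℝ) - β) * R l ^ (n - β - 1) * e₂ l) * d₁ β +
            s₂ β * densVar R r ξ₁ ξ₁' φ β -
          ((∑ l, ((n : ℝ) - β) * R l ^ (n - β - 1) * e₁ l) * d₂ β +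
            s₁ β * densVar R r ξ₂ ξ₂' φ β)) +
      ∑ i, (φ' i * (ζ₂ i * (diffProd R i * e₁ i) - ζ₁ i * (diffProd R i * e₂ i)) +
        φ i * (shiftDer R r e₂ ζ₂ i * (diffProd R i * e₁ i) + ζ₂ i * η₁' i -
          (shiftDer R r e₁ ζ₁ i * (diffProd R i * e₂ i) + ζ₁ i * η₂' i))) =
      ∑ i, (momDer R ξ₁ φ 0 p d₁ i - ζ₁ i * momDer R r φ φ' p (dens R r φ) i) * e₂ i -
      ∑ i, (momDer R ξ₂ φ 0 p d₂ i - ζ₂ i * momDer R r φ φ' p (dens R r φ) i) * e₁ i := by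
  rw [sum_variation_mul hR r φ φ' e₁ e₂ ζ₁ ξ₁ hξ₁, sum_variation_mul hR r φ φ' e₂ e₁ ζ₂ ξ₂ hξ₂,
    sum_sub_distrib, sum_add_distrib, sum_add_distrib, sum_mul_densVar hR r ξ₁ ξ₁' φ hζ₂,
    sum_mul_densVar hR r ξ₂ ξ₂' φ hζ₁]
  -- The one nonpointwise step: antisymmetry of the kernel moves the Cauchy sums onto `r φ`. The
  -- identity then holds summand by summand.
  have hswap : ∀ ζ ξ : Vec n, ∑ j, φ j * (r j * cauchySum R (fun k => ζ k * ξ k) j) =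
      -∑ j, ζ j * ξ j * cauchySum R (fun k => r k * φ k) j := by
    intro ζ ξ
    rw [← sum_mul_cauchySum]
    exact sum_congr rfl fun j _ => by ring
  have hsplit : ∀ ζ ξ ξ' : Vec n, -∑ j, φ j * (ζ j * ξ' j + r j * (cauchySum R
      (fun k => ζ k * ξ k) j - ζ j * cauchySum R ξ j)) =
      -∑ j, (φ j * (ζ j * ξ' j - r j * (ζ j * cauchySum R ξ j)) -
        ζ j * ξ j * cauchySum R (fun k => r k * φ k) j) := by
    intro ζ ξ ξ'
    have : ∀ j, φ j * (ζ j * ξ' j + r j * (cauchySum R (fun k => ζ k * ξ k) j -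
        ζ j * cauchySum R ξ j)) = φ j * (ζ j * ξ' j - r j * (ζ j * cauchySum R ξ j)) +
        φ j * (r j * cauchySum R (fun k => ζ k * ξ k) j) := fun j => by ring
    rw [sum_congr rfl fun j _ => this j, sum_add_distrib, hswap, sum_sub_distrib]
    ring
  rw [hsplit, hsplit]
  have hK : ∀ e ζ ξ : Vec n, (∀ i, ξ i = diffProd R i * e i + r i * ζ i) → ∀ i,
      cauchySum R ξ i = cauchySum R (fun k => diffProd R k * e k) i +
        cauchySum R (fun k => r k * ζ k) i := by
    intro e ζ ξ h i
    rw [← cauchySum_add, funext h]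
  rw [← sub_eq_zero]
  have : ∀ A B C D E F G : ℝ, A + -B - (C + -D) + E - (A + F - (C + G)) =
      -B + D + E - F + G := by
    intros; ring
  rw [this]
  rw [← sum_neg_distrib, ← sum_add_distrib, ← sum_add_distrib, ← sum_sub_distrib,
    ← sum_add_distrib]
  refine sum_eq_zero fun i _ => ?_
  rw [hK e₁ ζ₁ ξ₁ hξ₁, hK e₂ ζ₂ ξ₂ hξ₂, hξ₁', hξ₂', hξ₁, hξ₂, shiftDer, shiftDer]
  ring

end Hydro

namespace Hydro

open Finset

variable {n : ℕ} {I : Fin n → Set ℝ} {f : Fin n → ℝ → ℝ} {c : ℕ → ℕ → Vec n → ℝ}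

/-! ### Momenta, forces and shifts of fields -/

/-- The tangent vector of a field. -/
noncomputable def tang (S : Field n) (x : ℝ) : Vec n := fun i => deriv (fun y => S y i) x

/-- The nonlocal momenta `(d/dx)⁻¹ ∑_j v_β^j R^j_x ψ_j`. -/
noncomputable def pot (S ψ : Field n) (β : ℕ) : ℝ → ℝ :=
  dInv fun y => dens (S y) (tang S y) (ψ y) β

/-- The nonlocal momenta `(d/dx)⁻¹ ∑_j w_β^j R^j_x ψ_j`. -/
noncomputable def tailPot (f : Fin n → ℝ → ℝ) (c : ℕ → ℕ → Vec n → ℝ) (S ψ : Field n) (β : ℕ) :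
    ℝ → ℝ :=
  dInv fun y => ∑ j, tailSpeed f c β (S y) j * tang S y j * ψ y j

/-- The momenta of a covector field. -/
noncomputable def fieldMom (S ψ : Field n) (i : Fin n) (x : ℝ) : ℝ :=
  mom (S x) (ψ x) (fun β => pot S ψ β x) i

/-- The operator `f d/dx + ½ f_x` applied to the momenta of a covector field. -/
noncomputable def fieldForce (f : Fin n → ℝ → ℝ) (S ψ : Field n) (i : Fin n) (x : ℝ) : ℝ :=
  f i (S x i) * deriv (fieldMom S ψ i) x +
    (1 / 2) * deriv (f i) (S x i) * tang S x i * fieldMom S ψ i x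

/-- The coefficients of the part of the operator along the flows with speeds `v_β`. -/
noncomputable def fieldShift (f : Fin n → ℝ → ℝ) (c : ℕ → ℕ → Vec n → ℝ) (S ψ : Field n)
    (β : ℕ) (x : ℝ) : ℝ :=
  shiftLoc f c (S x) (ψ x) (fun γ => pot S ψ γ x) β - tailPot f c S ψ β x

/-- The operators in factorized form. -/
noncomputable def factorOp (f : Fin n → ℝ → ℝ) (c : ℕ → ℕ → Vec n → ℝ) (S ψ : Field n) :
    Field n := fun x i =>
  diffProd (S x) i * fieldForce f S ψ i x -
    tang S x i * ∑ β ∈ Icc 1 (n - 1), speed n β (S x) i * fieldShift f c S ψ β x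

/-! ### Smooth dependence of momenta and forces on a parameter. -/

section Family

variable {S : ℝ → Field n} {ψ : Field n} {L : ℝ}

theorem contDiff_tang (hS : ContDiff ℝ ∞ fun z : ℝ × ℝ => S z.1 z.2) (i : Fin n) :
    ContDiff ℝ ∞ fun z : ℝ × ℝ => tang (S z.1) z.2 i :=
  contDiff_deriv_right (F := fun s x => S s x i) (contDiff_pi.mp hS i)

theorem contDiff_dens (hS : ContDiff ℝ ∞ fun z : ℝ × ℝ => S z.1 z.2) (hψ : ContDiff ℝ ∞ ψ)
    (β : ℕ) :
    ContDiff ℝ ∞ fun z : ℝ × ℝ => dens (S z.1 z.2) (tang (S z.1) z.2) (ψ z.2) β :=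
  ContDiff.sum fun j _ => (((contDiff_speed β j).comp hS).mul (contDiff_tang hS j)).mul
    ((contDiff_pi.mp hψ j).comp contDiff_snd)

theorem contDiff_pot (hS : ContDiff ℝ ∞ fun z : ℝ × ℝ => S z.1 z.2) (hψ : ContDiff ℝ ∞ ψ)
    (hL : ∀ x, L ≤ |x| → ψ x = 0) (β : ℕ) :
    ContDiff ℝ ∞ fun z : ℝ × ℝ => pot (S z.1) ψ β z.2 :=
  contDiff_dInv (L := L) (u := fun s x => dens (S s x) (tang (S s) x) (ψ x) β) (contDiff_dens hS hψ β)
    fun s x hx => by simp [dens, hL x hx]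

theorem contDiff_fieldMom (hS : ContDiff ℝ ∞ fun z : ℝ × ℝ => S z.1 z.2) (hψ : ContDiff ℝ ∞ ψ)
    (hL : ∀ x, L ≤ |x| → ψ x = 0) (i : Fin n) :
    ContDiff ℝ ∞ fun z : ℝ × ℝ => fieldMom (S z.1) ψ i z.2 := by
  have h : ∀ j, ContDiff ℝ ∞ fun z : ℝ × ℝ => S z.1 z.2 j := contDiff_pi.mp hS
  exact (((contDiff_diffProd i).comp hS).mul ((contDiff_pi.mp hψ i).comp contDiff_snd)).add
    (ContDiff.sum fun β _ => (contDiff_const.mul ((h i).pow _)).mul (contDiff_pot hS hψ hL β))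

theorem contDiffOn_fieldForce (hI : ∀ i, IsOpen (I i)) (hf : ∀ i, ContDiffOn ℝ ∞ (f i) (I i))
    (hS : ContDiff ℝ ∞ fun z : ℝ × ℝ => S z.1 z.2) (hψ : ContDiff ℝ ∞ ψ)
    (hL : ∀ x, L ≤ |x| → ψ x = 0) (i : Fin n) :
    ContDiffOn ℝ ∞ (fun z : ℝ × ℝ => fieldForce f (S z.1) ψ i z.2)
      {z | S z.1 z.2 ∈ domain I} := by
  have h1 : ∀ g : ℝ → ℝ, ContDiffOn ℝ ∞ g (I i) →
      ContDiffOn ℝ ∞ (fun z : ℝ × ℝ => g (S z.1 z.2 i)) {z | S z.1 z.2 ∈ domain I} := fun g hg =>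
    ContDiffOn.comp (g := fun R : Vec n => g (R i)) (t := domain I)
      (ContDiffOn.comp_apply_domain hg) hS.contDiffOn fun _ hz => hz
  have h2 := contDiff_fieldMom hS hψ hL i
  exact ((h1 _ (hf i)).mul
    (contDiff_deriv_right (F := fun s => fieldMom (S s) ψ i) h2).contDiffOn).add
    (((contDiffOn_const.mul (h1 _ (contDiffOn_deriv (hI i) (hf i)))).mul
      (contDiff_tang hS i).contDiffOn).mul h2.contDiffOn)

end Family

/-! ### Momenta, forces and shifts of one field. -/

section Single

variable {S ψ : Field n} {L : ℝ}

theorem contDiff_const_family (hS : ContDiff ℝ ∞ S) :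
    ContDiff ℝ ∞ fun z : ℝ × ℝ => (fun _ : ℝ => S) z.1 z.2 :=
  hS.comp contDiff_snd

theorem hasDerivAt_tang (hS : ContDiff ℝ ∞ S) (x : ℝ) : HasDerivAt S (tang S x) x :=
  hasDerivAt_pi.mpr fun i => hasDerivAt_of_contDiff (contDiff_pi.mp hS i) x

theorem contDiff_tang_field (hS : ContDiff ℝ ∞ S) : ContDiff ℝ ∞ (tang S) :=
  contDiff_pi.mpr fun i => ContDiff.slice_right (F := fun _ x => tang S x i)
    (contDiff_tang (S := fun _ => S) (contDiff_const_family hS) i) 0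

theorem contDiff_dens_field (hS : ContDiff ℝ ∞ S) (hψ : ContDiff ℝ ∞ ψ) (β : ℕ) :
    ContDiff ℝ ∞ fun x => dens (S x) (tang S x) (ψ x) β :=
  ContDiff.slice_right (F := fun _ x => dens (S x) (tang S x) (ψ x) β)
    (contDiff_dens (S := fun _ => S) (contDiff_const_family hS) hψ β) 0

theorem dens_eq_zero (hL : ∀ x, L ≤ |x| → ψ x = 0) (β : ℕ) (x : ℝ) (hx : L ≤ |x|) :
    dens (S x) (tang S x) (ψ x) β = 0 := by
  simp [dens, hL x hx]

theorem contDiff_pot_field (hS : ContDiff ℝ ∞ S) (hψ : ContDiff ℝ ∞ ψ)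
    (hL : ∀ x, L ≤ |x| → ψ x = 0) (β : ℕ) : ContDiff ℝ ∞ (pot S ψ β) :=
  ContDiff.slice_right (F := fun _ x => pot S ψ β x)
    (contDiff_pot (S := fun _ => S) (contDiff_const_family hS) hψ hL β) 0

theorem hasDerivAt_pot (hS : ContDiff ℝ ∞ S) (hψ : ContDiff ℝ ∞ ψ)
    (hL : ∀ x, L ≤ |x| → ψ x = 0) (β : ℕ) (x : ℝ) :
    HasDerivAt (pot S ψ β) (dens (S x) (tang S x) (ψ x) β) x :=
  hasDerivAt_dInv (contDiff_dens_field hS hψ β).continuous (dens_eq_zero hL β) x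

theorem pot_neg (hS : ContDiff ℝ ∞ S) (hψ : ContDiff ℝ ∞ ψ)
    (hL : ∀ x, L ≤ |x| → ψ x = 0) (β : ℕ) : pot S ψ β (-L) = -pot S ψ β L :=
  dInv_neg (contDiff_dens_field hS hψ β).continuous (dens_eq_zero hL β)

theorem contDiff_fieldMom_field (hS : ContDiff ℝ ∞ S) (hψ : ContDiff ℝ ∞ ψ)
    (hL : ∀ x, L ≤ |x| → ψ x = 0) (i : Fin n) : ContDiff ℝ ∞ (fieldMom S ψ i) :=
  ContDiff.slice_right (F := fun _ x => fieldMom S ψ i x)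
    (contDiff_fieldMom (S := fun _ => S) (contDiff_const_family hS) hψ hL i) 0

theorem deriv_fieldMom (hS : ContDiff ℝ ∞ S) (hψ : ContDiff ℝ ∞ ψ)
    (hL : ∀ x, L ≤ |x| → ψ x = 0) {x : ℝ} (hx : Function.Injective (S x)) (i : Fin n) :
    deriv (fieldMom S ψ i) x = momDer (S x) (tang S x) (ψ x) (tang ψ x)
      (fun β => pot S ψ β x) (dens (S x) (tang S x) (ψ x)) i :=
  (hasDerivAt_mom (hasDerivAt_tang hS x) hx (hasDerivAt_tang hψ x)
    (fun β _ => hasDerivAt_pot hS hψ hL β x) i).deriv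

theorem fieldForce_eq (hS : ContDiff ℝ ∞ S) (hψ : ContDiff ℝ ∞ ψ)
    (hL : ∀ x, L ≤ |x| → ψ x = 0) {x : ℝ} (hx : Function.Injective (S x)) (i : Fin n) :
    fieldForce f S ψ i x = force f (S x) (tang S x) (ψ x) (tang ψ x)
      (fun β => pot S ψ β x) (dens (S x) (tang S x) (ψ x)) i := by
  rw [fieldForce, force, deriv_fieldMom hS hψ hL hx]
  rfl

theorem contDiffOn_fieldForce_field (hI : ∀ i, IsOpen (I i))
    (hf : ∀ i, ContDiffOn ℝ ∞ (f i) (I i)) (hS : ContDiff ℝ ∞ S) (hψ : ContDiff ℝ ∞ ψ)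
    (hL : ∀ x, L ≤ |x| → ψ x = 0) (i : Fin n) :
    ContDiffOn ℝ ∞ (fieldForce f S ψ i) (S ⁻¹' domain I) :=
  ContDiffOn.comp (f := fun x => ((0 : ℝ), x)) (t := {z : ℝ × ℝ | S z.2 ∈ domain I})
    (contDiffOn_fieldForce (S := fun _ => S) hI hf (contDiff_const_family hS) hψ hL i)
    (contDiff_const.prodMk contDiff_id).contDiffOn fun _ hx => hx

/-- Outside `[-L, L]` the field may leave the domain, where the tail speeds are not controlled, but
there `ψ = 0`. -/
theorem contDiff_tailDens (hI : ∀ i, IsOpen (I i)) (hf : ∀ i, ContDiffOn ℝ ∞ (f i) (I i))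
    (hc : IsFlux (domain I) f c) (hS : ContDiff ℝ ∞ S) (hSD : ∀ x, |x| ≤ L → S x ∈ domain I)
    (hψ : ContDiff ℝ ∞ ψ) (hL : ∀ x, L ≤ |x| → ψ x = 0) {β : ℕ} (hβ : β ∈ Icc 1 (n - 1)) :
    ContDiff ℝ ∞ fun y => ∑ j, tailSpeed f c β (S y) j * tang S y j * ψ y j := by
  rw [contDiff_iff_contDiffAt]
  intro x
  rcases le_or_gt |x| L with hx | hx
  · refine ContDiffAt.sum fun j _ => ContDiffAt.mul (ContDiffAt.mul ?_ ?_) ?_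
    · exact ContDiffAt.comp x (((contDiffOn_tailSpeed hI hf hc hβ j).contDiffAt
        ((isOpen_domain hI).mem_nhds (hSD x hx)))) hS.contDiffAt
    · exact (contDiff_pi.mp (contDiff_tang_field hS) j).contDiffAt
    · exact (contDiff_pi.mp hψ j).contDiffAt
  · refine (contDiffAt_const (c := (0 : ℝ))).congr_of_eventuallyEq ?_
    filter_upwards [continuous_abs.continuousAt.eventually (eventually_gt_nhds hx)] with y hy
    simp [hL y hy.le]

theorem tailDens_eq_zero (hL : ∀ x, L ≤ |x| → ψ x = 0) (β : ℕ) (x : ℝ) (hx : L ≤ |x|) :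
    ∑ j, tailSpeed f c β (S x) j * tang S x j * ψ x j = 0 := by
  simp [hL x hx]

theorem hasDerivAt_tailPot (hI : ∀ i, IsOpen (I i)) (hf : ∀ i, ContDiffOn ℝ ∞ (f i) (I i))
    (hc : IsFlux (domain I) f c) (hS : ContDiff ℝ ∞ S) (hSD : ∀ x, |x| ≤ L → S x ∈ domain I)
    (hψ : ContDiff ℝ ∞ ψ) (hL : ∀ x, L ≤ |x| → ψ x = 0) {β : ℕ} (hβ : β ∈ Icc 1 (n - 1))
    (x : ℝ) :
    HasDerivAt (tailPot f c S ψ β) (∑ j, tailSpeed f c β (S x) j * tang S x j * ψ x j) x :=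
  hasDerivAt_dInv (contDiff_tailDens hI hf hc hS hSD hψ hL hβ).continuous (tailDens_eq_zero hL β) x

theorem tailPot_neg (hI : ∀ i, IsOpen (I i)) (hf : ∀ i, ContDiffOn ℝ ∞ (f i) (I i))
    (hc : IsFlux (domain I) f c) (hS : ContDiff ℝ ∞ S) (hSD : ∀ x, |x| ≤ L → S x ∈ domain I)
    (hψ : ContDiff ℝ ∞ ψ) (hL : ∀ x, L ≤ |x| → ψ x = 0) {β : ℕ} (hβ : β ∈ Icc 1 (n - 1)) :
    tailPot f c S ψ β (-L) = -tailPot f c S ψ β L :=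
  dInv_neg (contDiff_tailDens hI hf hc hS hSD hψ hL hβ).continuous (tailDens_eq_zero hL β)

theorem contDiff_tailPot (hI : ∀ i, IsOpen (I i)) (hf : ∀ i, ContDiffOn ℝ ∞ (f i) (I i))
    (hc : IsFlux (domain I) f c) (hS : ContDiff ℝ ∞ S) (hSD : ∀ x, |x| ≤ L → S x ∈ domain I)
    (hψ : ContDiff ℝ ∞ ψ) (hL : ∀ x, L ≤ |x| → ψ x = 0) {β : ℕ} (hβ : β ∈ Icc 1 (n - 1)) :
    ContDiff ℝ ∞ (tailPot f c S ψ β) :=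
  ContDiff.slice_right (F := fun _ x => tailPot f c S ψ β x)
    (contDiff_dInv (L := L) (u := fun _ y => ∑ j, tailSpeed f c β (S y) j * tang S y j * ψ y j)
      ((contDiff_tailDens hI hf hc hS hSD hψ hL hβ).comp contDiff_snd)
      fun _ => tailDens_eq_zero hL β) 0

/-- The tail density in `hasDerivAt_shiftLoc` cancels against the derivative of `tailPot`; only the
forces remain. -/
theorem hasDerivAt_fieldShift (hI : ∀ i, IsOpen (I i)) (hf : ∀ i, ContDiffOn ℝ ∞ (f i) (I i))
    (hc : IsFlux (domain I) f c) (hS : ContDiff ℝ ∞ S) (hSD : ∀ x, |x| ≤ L → S x ∈ domain I)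
    (hψ : ContDiff ℝ ∞ ψ) (hL : ∀ x, L ≤ |x| → ψ x = 0) {β : ℕ} (hβ : β ∈ Icc 1 (n - 1))
    {x : ℝ} (hx : S x ∈ domain I) :
    HasDerivAt (fieldShift f c S ψ β)
      (∑ l, ((n : ℝ) - β) * S x l ^ (n - β - 1) * fieldForce f S ψ l x) x := by
  refine ((hasDerivAt_shiftLoc hI hf hc (hasDerivAt_tang hS x) hx (hasDerivAt_tang hψ x)
    (fun β _ => hasDerivAt_pot hS hψ hL β x) hβ).sub
    (hasDerivAt_tailPot hI hf hc hS hSD hψ hL hβ x)).congr_deriv ?_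
  rw [add_sub_cancel_right]
  exact sum_congr rfl fun l _ => by rw [fieldForce_eq hS hψ hL hx.2]

theorem contDiffOn_fieldShift (hI : ∀ i, IsOpen (I i)) (hf : ∀ i, ContDiffOn ℝ ∞ (f i) (I i))
    (hc : IsFlux (domain I) f c) (hS : ContDiff ℝ ∞ S) (hSD : ∀ x, |x| ≤ L → S x ∈ domain I)
    (hψ : ContDiff ℝ ∞ ψ) (hL : ∀ x, L ≤ |x| → ψ x = 0) {β : ℕ} (hβ : β ∈ Icc 1 (n - 1)) :
    ContDiffOn ℝ ∞ (fieldShift f c S ψ β) (S ⁻¹' domain I) := by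
  have hSi := contDiff_pi.mp hS
  refine ContDiffOn.sub (ContDiffOn.add (ContDiffOn.sum fun γ hγ => ContDiffOn.mul
    ((hc.contDiffOn hI hf hγ hβ).comp hS.contDiffOn fun _ hx => hx)
    (contDiff_pot_field hS hψ hL γ).contDiffOn) (ContDiffOn.sum fun l _ => ContDiffOn.mul
    (contDiff_const.mul ((hSi l).pow _)).contDiffOn (ContDiffOn.mul
    ((ContDiffOn.comp_apply_domain (hf l)).comp hS.contDiffOn fun _ hx => hx)
    (((contDiff_diffProd l).comp hS).mul (contDiff_pi.mp hψ l)).contDiffOn)))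
    (contDiff_tailPot hI hf hc hS hSD hψ hL hβ).contDiffOn

theorem contDiffOn_factorOp (hI : ∀ i, IsOpen (I i)) (hf : ∀ i, ContDiffOn ℝ ∞ (f i) (I i))
    (hc : IsFlux (domain I) f c) (hS : ContDiff ℝ ∞ S) (hSD : ∀ x, |x| ≤ L → S x ∈ domain I)
    (hψ : ContDiff ℝ ∞ ψ) (hL : ∀ x, L ≤ |x| → ψ x = 0) :
    ContDiffOn ℝ ∞ (factorOp f c S ψ) (S ⁻¹' domain I) :=
  contDiffOn_pi.mpr fun i => (((contDiff_diffProd i).comp hS).contDiffOn.mul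
    (contDiffOn_fieldForce_field hI hf hS hψ hL i)).sub
    (((contDiff_pi.mp (contDiff_tang_field hS) i).contDiffOn).mul
    (ContDiffOn.sum fun β hβ => ((contDiff_speed β i).comp hS).contDiffOn.mul
      (contDiffOn_fieldShift hI hf hc hS hSD hψ hL hβ)))

end Single

end Hydro

namespace Hydro

open Finset

variable {n : ℕ} {I : Fin n → Set ℝ} {f : Fin n → ℝ → ℝ} {c : ℕ → ℕ → Vec n → ℝ}

/-! ### The bracket of an operator in factorized form -/

/-- `A` is given by `factorOp f c` wherever the field takes values in the domain. -/
def Represents (I : Fin n → Set ℝ) (f : Fin n → ℝ → ℝ) (c : ℕ → ℕ → Vec n → ℝ)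
    (A : Field n → Field n → Field n) : Prop :=
  ∀ (S ψ : Field n) (L : ℝ), ContDiff ℝ ∞ S → (∀ x, |x| ≤ L → S x ∈ domain I) →
    ContDiff ℝ ∞ ψ → (∀ x, L ≤ |x| → ψ x = 0) → ∀ x, |x| ≤ L → A S ψ x = factorOp f c S ψ x

/-- The boundary terms of the bracket. -/
noncomputable def bdry (c : ℕ → ℕ → Vec n → ℝ) (S φ ψ : Field n) (x : ℝ) : ℝ :=
  ∑ β ∈ Icc 1 (n - 1), ∑ γ ∈ Icc 1 (n - 1), c γ β (S x) * pot S φ β x * pot S ψ γ x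

theorem exists_bound {φ : Field n} (hφ : IsTest φ) :
    ∃ L, 0 ≤ L ∧ ∀ M, L ≤ M → ∀ x, M ≤ |x| → φ x = 0 := by
  obtain ⟨r, hr⟩ := hφ.2.isCompact.isBounded.subset_closedBall (0 : ℝ)
  -- The extra `1` excludes the endpoints `|x| = r`, which the closed ball contains.
  refine ⟨max 0 (r + 1), le_max_left _ _, fun M hM x hx => ?_⟩
  by_contra h
  have h1 := hr (subset_tsupport φ h)
  rw [mem_closedBall_zero_iff, Real.norm_eq_abs] at h1
  linarith [le_max_right 0 (r + 1)]

theorem polyDer_mul_polyDer (hc : IsFlux (domain I) f c) {R : Vec n} (hR : R ∈ domain I)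
    (a b : ℕ → ℝ) :
    ∑ i, f i (R i) * polyDer n a (R i) * polyDer n b (R i) =
      ∑ β ∈ Icc 1 (n - 1), ∑ γ ∈ Icc 1 (n - 1), (c γ β R + c β γ R) * a β * b γ := by
  have h : ∀ β ∈ Icc 1 (n - 1), ∀ γ ∈ Icc 1 (n - 1), (c γ β R + c β γ R) * a β * b γ =
      ∑ i, f i (R i) * ((((n : ℝ) - β) * R i ^ (n - β - 1) * a β) *
        (((n : ℝ) - γ) * R i ^ (n - γ - 1) * b γ)) := fun β hβ γ hγ => by
    rw [hc.symm_eq hγ hβ hR, sum_mul, sum_mul]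
    exact sum_congr rfl fun i _ => by ring
  rw [sum_congr rfl fun β hβ => sum_congr rfl fun γ hγ => h β hβ γ hγ,
    sum_congr rfl fun β _ => sum_comm, sum_comm]
  refine sum_congr rfl fun i _ => ?_
  rw [mul_assoc, polyDer, polyDer, sum_mul_sum, mul_sum]
  exact sum_congr rfl fun β _ => by rw [mul_sum]

theorem sum_pd_mul_mul (hc : IsFlux (domain I) f c) {R : Vec n} (hR : R ∈ domain I)
    (a b : ℕ → ℝ) (i : Fin n) :
    ∑ β ∈ Icc 1 (n - 1), ∑ γ ∈ Icc 1 (n - 1), pd i (c γ β) R * a β * b γ =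
      ((1 / 2) * deriv (f i) (R i) * polyDer n b (R i) + f i (R i) * polyDer2 n b (R i)) *
        polyDer n a (R i) := by
  rw [← sum_tailLoc_mul, polyDer, sum_mul_sum, sum_comm]
  refine sum_congr rfl fun γ hγ => sum_congr rfl fun β hβ => ?_
  rw [hc.pd_eq hγ hβ hR]
  ring

section Bracket

variable {S φ ψ : Field n} {L : ℝ} {A : Field n → Field n → Field n}

theorem abs_le_of_mem_uIcc (hL : 0 ≤ L) {x : ℝ} (hx : x ∈ Set.uIcc (-L) L) : |x| ≤ L := by
  rw [Set.uIcc_of_le (by linarith)] at hx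
  exact abs_le.mpr hx

/-- The integrand differs from the pairing of momenta with forces by the derivative of `∑_β p_β
s_β`. At `±L` the local covector terms vanish and `p_β` times the tail potential is the same at both
ends, which leaves `bdry`. The field is needed in the domain only on `[-L, L]`: a line `R + s Aχ`
need not stay there for all `x`. -/
theorem bracket_eq (hI : ∀ i, IsOpen (I i)) (hf : ∀ i, ContDiffOn ℝ ∞ (f i) (I i))
    (hc : IsFlux (domain I) f c) (hA : Represents I f c A) (hL : 0 ≤ L) (hS : ContDiff ℝ ∞ S)
    (hSD : ∀ x, |x| ≤ L → S x ∈ domain I) (hφ : ContDiff ℝ ∞ φ) (hψ : ContDiff ℝ ∞ ψ)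
    (hφL : ∀ x, L ≤ |x| → φ x = 0) (hψL : ∀ x, L ≤ |x| → ψ x = 0) :
    bracket A S φ ψ = (∫ x in (-L)..L, ∑ i, fieldMom S φ i x * fieldForce f S ψ i x) -
      (bdry c S φ ψ L - bdry c S φ ψ (-L)) := by
  have hD : ∀ x ∈ Set.uIcc (-L) L, S x ∈ domain I := fun x hx => hSD x (abs_le_of_mem_uIcc hL hx)
  have h1 : bracket A S φ ψ = ∫ x in (-L)..L, ∑ i, φ x i * A S ψ x i := by
    refine (intervalIntegral.integral_eq_integral_of_support_subset fun x hx => ?_).symm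
    by_contra h
    refine hx ?_
    have : L ≤ |x| := by
      rw [Set.mem_Ioc, not_and_or, not_lt, not_le] at h
      rcases h with h | h
      · exact le_trans (by linarith) (neg_le_abs x)
      · exact h.le.trans (le_abs_self x)
    simp [hφL x this]
  set G : ℝ → ℝ := fun x => ∑ β ∈ Icc 1 (n - 1), pot S φ β x * fieldShift f c S ψ β x with hG
  set G' : ℝ → ℝ := fun x => ∑ β ∈ Icc 1 (n - 1), (dens (S x) (tang S x) (φ x) β *
    fieldShift f c S ψ β x + pot S φ β x *
      ∑ l, ((n : ℝ) - β) * S x l ^ (n - β - 1) * fieldForce f S ψ l x) with hG'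
  have hGd : ∀ x ∈ Set.uIcc (-L) L, HasDerivAt G (G' x) x := fun x hx =>
    HasDerivAt.fun_sum fun β hβ => (hasDerivAt_pot hS hφ hφL β x).fun_mul
      (hasDerivAt_fieldShift hI hf hc hS hSD hψ hψL hβ (hD x hx))
  have h2 : ∀ x ∈ Set.uIcc (-L) L, ∑ i, φ x i * A S ψ x i =
      ∑ i, fieldMom S φ i x * fieldForce f S ψ i x - G' x := by
    intro x hx
    rw [hA S ψ L hS hSD hψ hψL x (abs_le_of_mem_uIcc hL hx)]
    have e1 : ∑ i, φ x i * (tang S x i * ∑ β ∈ Icc 1 (n - 1), speed n β (S x) i *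
        fieldShift f c S ψ β x) =
        ∑ β ∈ Icc 1 (n - 1), dens (S x) (tang S x) (φ x) β * fieldShift f c S ψ β x := by
      simp only [dens, mul_sum, sum_mul]
      rw [sum_comm]
      exact sum_congr rfl fun β _ => sum_congr rfl fun i _ => by ring
    have e2 : ∑ β ∈ Icc 1 (n - 1), pot S φ β x *
        ∑ l, ((n : ℝ) - β) * S x l ^ (n - β - 1) * fieldForce f S ψ l x =
        ∑ i, polyDer n (fun β => pot S φ β x) (S x i) * fieldForce f S ψ i x := by
      simp only [polyDer, mul_sum, sum_mul]
      rw [sum_comm]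
      exact sum_congr rfl fun β _ => sum_congr rfl fun i _ => by ring
    simp only [hG', sum_add_distrib, e2, ← e1, factorOp, mul_sub, sum_sub_distrib]
    rw [← sub_eq_zero]
    have : ∀ a b d e : ℝ, a - b - (d - (b + e)) = a + e - d := by intros; ring
    rw [this, ← sum_add_distrib, ← sum_sub_distrib]
    refine sum_eq_zero fun i _ => ?_
    rw [fieldMom, mom]
    ring
  have hcf : ∀ i, ContinuousOn (fieldForce f S ψ i) (Set.uIcc (-L) L) := fun i =>
    (contDiffOn_fieldForce_field hI hf hS hψ hψL i).continuousOn.mono hD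
  have hcM : ContinuousOn (fun x => ∑ i, fieldMom S φ i x * fieldForce f S ψ i x)
      (Set.uIcc (-L) L) := continuousOn_finsetSum _ fun i _ =>
    (contDiff_fieldMom_field hS hφ hφL i).continuous.continuousOn.mul (hcf i)
  have hcG : ContinuousOn G' (Set.uIcc (-L) L) := by
    refine continuousOn_finsetSum _ fun β hβ => ((contDiff_dens_field hS hφ
      β).continuous.continuousOn.mul ((contDiffOn_fieldShift hI hf hc hS hSD hψ hψL
      hβ).continuousOn.mono hD)).add ((contDiff_pot_field hS hφ hφL β).continuous.continuousOn.mul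
      (continuousOn_finsetSum _ fun l _ => ContinuousOn.mul ?_ (hcf l)))
    exact (continuous_const.mul ((contDiff_pi.mp hS l).continuous.pow _)).continuousOn
  rw [h1, intervalIntegral.integral_congr h2, intervalIntegral.integral_sub
    hcM.intervalIntegrable hcG.intervalIntegrable,
    intervalIntegral.integral_eq_sub_of_hasDerivAt hGd hcG.intervalIntegrable]
  have hLL : L ≤ |L| := le_abs_self L
  have hLL' : L ≤ |(-L)| := by rw [abs_neg]; exact hLL
  have e3 : ∀ x, L ≤ |x| → G x = bdry c S φ ψ x - ∑ β ∈ Icc 1 (n - 1),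
      pot S φ β x * tailPot f c S ψ β x := by
    intro x hx
    simp only [hG, bdry, fieldShift, shiftLoc, hψL x hx, Pi.zero_apply, mul_zero, sum_const_zero,
      add_zero, mul_sub, sum_sub_distrib, mul_sum]
    congr 1
    exact sum_congr rfl fun β _ => sum_congr rfl fun γ _ => by ring
  rw [e3 L hLL, e3 (-L) hLL']
  have e4 : ∑ β ∈ Icc 1 (n - 1), pot S φ β (-L) * tailPot f c S ψ β (-L) =
      ∑ β ∈ Icc 1 (n - 1), pot S φ β L * tailPot f c S ψ β L :=
    sum_congr rfl fun β hβ => by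
      rw [pot_neg hS hφ hφL, tailPot_neg hI hf hc hS hSD hψ hψL hβ]
      ring
  rw [e4]
  ring

/-- The symmetrized density is the derivative of `∑ f Φ^φ Φ^ψ`. At `±L` the momenta are `P'(R^i)`,
and by the Gram form of `c + cᵀ` this function is the symmetrized boundary term. -/
theorem bracket_skew (hI : ∀ i, IsOpen (I i)) (hf : ∀ i, ContDiffOn ℝ ∞ (f i) (I i))
    (hc : IsFlux (domain I) f c) (hA : Represents I f c A) (hL : 0 ≤ L) (hS : ContDiff ℝ ∞ S)
    (hSD : ∀ x, |x| ≤ L → S x ∈ domain I) (hφ : ContDiff ℝ ∞ φ) (hψ : ContDiff ℝ ∞ ψ)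
    (hφL : ∀ x, L ≤ |x| → φ x = 0) (hψL : ∀ x, L ≤ |x| → ψ x = 0) :
    bracket A S φ ψ = -bracket A S ψ φ := by
  have hD : ∀ x ∈ Set.uIcc (-L) L, S x ∈ domain I := fun x hx => hSD x (abs_le_of_mem_uIcc hL hx)
  have hcM : ∀ φ ψ : Field n, ContDiff ℝ ∞ φ → ContDiff ℝ ∞ ψ → (∀ x, L ≤ |x| → φ x = 0) →
      (∀ x, L ≤ |x| → ψ x = 0) → ContinuousOn
      (fun x => ∑ i, fieldMom S φ i x * fieldForce f S ψ i x) (Set.uIcc (-L) L) :=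
    fun φ ψ hφ hψ hφL hψL => continuousOn_finsetSum _ fun i _ =>
      (contDiff_fieldMom_field hS hφ hφL i).continuous.continuousOn.mul
      ((contDiffOn_fieldForce_field hI hf hS hψ hψL i).continuousOn.mono hD)
  have hi1 := (hcM φ ψ hφ hψ hφL hψL).intervalIntegrable (μ := MeasureTheory.volume)
  have hi2 := (hcM ψ φ hψ hφ hψL hφL).intervalIntegrable (μ := MeasureTheory.volume)
  have hd : ∀ x ∈ Set.uIcc (-L) L, HasDerivAt
      (fun x => ∑ i, f i (S x i) * (fieldMom S φ i x * fieldMom S ψ i x))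
      (∑ i, fieldMom S φ i x * fieldForce f S ψ i x +
        ∑ i, fieldMom S ψ i x * fieldForce f S φ i x) x := by
    intro x hx
    refine (HasDerivAt.fun_sum fun i _ => (hasDerivAt_param hI hf (hasDerivAt_tang hS x)
      (hD x hx) i).fun_mul ((hasDerivAt_of_contDiff (contDiff_fieldMom_field hS hφ hφL i) x).fun_mul
      (hasDerivAt_of_contDiff (contDiff_fieldMom_field hS hψ hψL i) x))).congr_deriv ?_
    rw [← sum_add_distrib]
    exact sum_congr rfl fun i _ => by rw [fieldForce, fieldForce]; ring
  have hsum := intervalIntegral.integral_eq_sub_of_hasDerivAt hd (hi1.add hi2)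
  rw [intervalIntegral.integral_add hi1 hi2] at hsum
  rw [bracket_eq hI hf hc hA hL hS hSD hφ hψ hφL hψL, bracket_eq hI hf hc hA hL hS hSD hψ hφ hψL hφL]
  have hb : ∀ x, |x| ≤ L → L ≤ |x| → ∑ i, f i (S x i) * (fieldMom S φ i x * fieldMom S ψ i x) =
      bdry c S φ ψ x + bdry c S ψ φ x := by
    intro x hx hx'
    have h1 : ∑ i, f i (S x i) * (fieldMom S φ i x * fieldMom S ψ i x) =
        ∑ i, f i (S x i) * polyDer n (fun β => pot S φ β x) (S x i) *
          polyDer n (fun β => pot S ψ β x) (S x i) :=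
      sum_congr rfl fun i _ => by
        simp only [fieldMom, mom, hφL x hx', hψL x hx', Pi.zero_apply, mul_zero, zero_add]
        ring
    rw [h1, polyDer_mul_polyDer hc (hSD x hx), bdry, bdry, sum_comm (s := Icc 1 (n - 1)) (t :=
      Icc 1 (n - 1)) (f := fun β γ => c γ β (S x) * pot S ψ β x * pot S φ γ x), ← sum_add_distrib]
    refine sum_congr rfl fun β _ => ?_
    rw [← sum_add_distrib]
    exact sum_congr rfl fun γ _ => by ring
  have e1 := hb L (abs_of_nonneg hL).le (abs_of_nonneg hL).ge
  have e2 := hb (-L) (by rw [abs_neg]; exact (abs_of_nonneg hL).le)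
    (by rw [abs_neg]; exact (abs_of_nonneg hL).ge)
  linarith

end Bracket

end Hydro

namespace Hydro

open Finset

variable {n : ℕ} {I : Fin n → Set ℝ} {f : Fin n → ℝ → ℝ} {c : ℕ → ℕ → Vec n → ℝ}

/-! ### Variation along Hamiltonian vector fields -/

/-- A field with values in the domain, for parameters with a choice of the functions `c`. -/
structure FluxField (I : Fin n → Set ℝ) (f : Fin n → ℝ → ℝ) (c : ℕ → ℕ → Vec n → ℝ)
    (R : Field n) : Prop where
  isOpen : ∀ i, IsOpen (I i)
  contDiffOn : ∀ i, ContDiffOn ℝ ∞ (f i) (I i)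
  isFlux : IsFlux (domain I) f c
  contDiff : ContDiff ℝ ∞ R
  mem : ∀ x, R x ∈ domain I

/-- Smooth covector fields that vanish off `(-L, L)`. -/
structure TestOn (L : ℝ) (φ : Field n) : Prop where
  contDiff : ContDiff ℝ ∞ φ
  eq_zero : ∀ x, L ≤ |x| → φ x = 0

/-- The speeds of the part of the operator along `R_x`. -/
noncomputable def drag (f : Fin n → ℝ → ℝ) (c : ℕ → ℕ → Vec n → ℝ) (R χ : Field n) (x : ℝ) :
    Vec n := fun i => -∑ β ∈ Icc 1 (n - 1), speed n β (R x) i * fieldShift f c R χ β x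

/-- The variation of a field along the vector field of the covector `χ`. -/
noncomputable def flowLine (f : Fin n → ℝ → ℝ) (c : ℕ → ℕ → Vec n → ℝ) (R χ : Field n) (s : ℝ) :
    Field n := fun x => R x + s • factorOp f c R χ x

/-- The variation of `pot R φ β` along the vector field of `χ`. -/
noncomputable def varPot (f : Fin n → ℝ → ℝ) (c : ℕ → ℕ → Vec n → ℝ) (R φ χ : Field n) (β : ℕ)
    (x : ℝ) : ℝ := deriv (fun s => pot (flowLine f c R χ s) φ β x) 0

/-- The variation of `fieldMom R φ i` along the vector field of `χ`. -/
noncomputable def varMom (f : Fin n → ℝ → ℝ) (c : ℕ → ℕ → Vec n → ℝ) (R φ χ : Field n) (i : Fin n)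
    (x : ℝ) : ℝ := deriv (fun s => fieldMom (flowLine f c R χ s) φ i x) 0

section Variation

variable {R φ ψ χ : Field n} {L : ℝ}

theorem factorOp_eq (R χ : Field n) (x : ℝ) (i : Fin n) :
    factorOp f c R χ x i =
      diffProd (R x) i * fieldForce f R χ i x + tang R x i * drag f c R χ x i := by
  rw [factorOp, drag]
  ring

theorem FluxField.contDiff_factorOp (hR : FluxField I f c R) (hχ : TestOn L χ) :
    ContDiff ℝ ∞ (factorOp f c R χ) := by
  have h := contDiffOn_factorOp hR.isOpen hR.contDiffOn hR.isFlux hR.contDiff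
    (fun x _ => hR.mem x) hχ.contDiff hχ.eq_zero
  rwa [show R ⁻¹' domain I = Set.univ from Set.eq_univ_of_forall hR.mem, contDiffOn_univ] at h

theorem FluxField.contDiff_fieldForce (hR : FluxField I f c R) (hχ : TestOn L χ) (i : Fin n) :
    ContDiff ℝ ∞ (fieldForce f R χ i) := by
  have h := contDiffOn_fieldForce_field hR.isOpen hR.contDiffOn hR.contDiff hχ.contDiff
    hχ.eq_zero i
  rwa [show R ⁻¹' domain I = Set.univ from Set.eq_univ_of_forall hR.mem, contDiffOn_univ] at h

theorem FluxField.hasDerivAt_fieldShift (hR : FluxField I f c R) (hχ : TestOn L χ) {β : ℕ}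
    (hβ : β ∈ Icc 1 (n - 1)) (x : ℝ) :
    HasDerivAt (fieldShift f c R χ β)
      (∑ l, ((n : ℝ) - β) * R x l ^ (n - β - 1) * fieldForce f R χ l x) x :=
  Hydro.hasDerivAt_fieldShift hR.isOpen hR.contDiffOn hR.isFlux hR.contDiff
    (fun x _ => hR.mem x) hχ.contDiff hχ.eq_zero hβ (hR.mem x)

theorem FluxField.contDiff_flowLine (hR : FluxField I f c R) (hχ : TestOn L χ) :
    ContDiff ℝ ∞ fun z : ℝ × ℝ => flowLine f c R χ z.1 z.2 :=
  (hR.contDiff.comp contDiff_snd).add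
    (contDiff_fst.smul ((hR.contDiff_factorOp hχ).comp contDiff_snd))

theorem FluxField.contDiff_flowLine_apply (hR : FluxField I f c R) (hχ : TestOn L χ) (s : ℝ) :
    ContDiff ℝ ∞ (flowLine f c R χ s) :=
  hR.contDiff.add ((hR.contDiff_factorOp hχ).const_smul s)

theorem flowLine_zero (R χ : Field n) : flowLine f c R χ 0 = R := by
  funext x
  simp [flowLine]

theorem hasDerivAt_flowLine (R χ : Field n) (x s : ℝ) :
    HasDerivAt (fun s => flowLine f c R χ s x) (factorOp f c R χ x) s := by
  simpa [flowLine] using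
    ((hasDerivAt_id s).smul_const (factorOp f c R χ x)).const_add (R x)

theorem FluxField.tang_flowLine (hR : FluxField I f c R) (hχ : TestOn L χ) (s x : ℝ) :
    tang (flowLine f c R χ s) x = tang R x + s • tang (factorOp f c R χ) x := by
  funext i
  have h1 := hasDerivAt_pi.mp (hasDerivAt_tang hR.contDiff x) i
  have h2 := hasDerivAt_pi.mp (hasDerivAt_tang (hR.contDiff_factorOp hχ) x) i
  exact (h1.add (h2.const_mul s)).deriv

theorem FluxField.hasDerivAt_tang_flowLine (hR : FluxField I f c R) (hχ : TestOn L χ) (x s : ℝ) :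
    HasDerivAt (fun s => tang (flowLine f c R χ s) x) (tang (factorOp f c R χ) x) s := by
  simp only [hR.tang_flowLine hχ]
  simpa using ((hasDerivAt_id s).smul_const (tang (factorOp f c R χ) x)).const_add (tang R x)

/-- The derivatives of the speeds give divided differences of `drag`; the derivatives of the shifts,
weighted with the speeds, give `ω_i'(R^l) η_l`. -/
theorem FluxField.hasDerivAt_drag (hR : FluxField I f c R) (hχ : TestOn L χ) (x : ℝ) (i : Fin n) :
    HasDerivAt (fun y => drag f c R χ y i) (shiftDer (R x) (tang R x)
      (fun l => fieldForce f R χ l x) (drag f c R χ x) i) x := by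
  have h := (HasDerivAt.fun_sum (u := Icc 1 (n - 1)) fun β hβ =>
    (hasDerivAt_comp (differentiable_speed β i (R x)) (hasDerivAt_tang hR.contDiff x)).fun_mul
      (hR.hasDerivAt_fieldShift hχ hβ x)).fun_neg
  refine h.congr_deriv ?_
  have hinj := (hR.mem x).2
  have h1 : ∑ β ∈ Icc 1 (n - 1), (∑ k, pd k (fun S => speed n β S i) (R x) * tang R x k) *
      fieldShift f c R χ β x = drag f c R χ x i * cauchySum (R x) (tang R x) i -
      cauchySum (R x) (fun k => tang R x k * drag f c R χ x k) i := by
    simp only [pd_speed hinj, cauchySum, mul_sum, sum_mul]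
    rw [sum_comm, ← sum_sub_distrib]
    refine sum_congr rfl fun k _ => ?_
    have h0 : drag f c R χ x i - drag f c R χ x k =
        ∑ β ∈ Icc 1 (n - 1), (speed n β (R x) k - speed n β (R x) i) * fieldShift f c R χ β x := by
      simp only [drag, sub_mul, sum_sub_distrib]
      ring
    rw [show drag f c R χ x i * ((R x i - R x k)⁻¹ * tang R x k) -
      (R x i - R x k)⁻¹ * (tang R x k * drag f c R χ x k) =
      (R x i - R x k)⁻¹ * tang R x k * (drag f c R χ x i - drag f c R χ x k) by ring, h0, mul_sum]
    exact sum_congr rfl fun β _ => by ring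
  have h2 : ∑ β ∈ Icc 1 (n - 1), speed n β (R x) i *
      ∑ l, ((n : ℝ) - β) * R x l ^ (n - β - 1) * fieldForce f R χ l x =
      cauchySum (R x) 1 i * (diffProd (R x) i * fieldForce f R χ i x) -
      cauchySum (R x) (fun k => diffProd (R x) k * fieldForce f R χ k x) i := by
    have h : ∑ β ∈ Icc 1 (n - 1), speed n β (R x) i *
      ∑ l, ((n : ℝ) - β) * R x l ^ (n - β - 1) * fieldForce f R χ l x =
      ∑ l, (∑ β ∈ Icc 1 (n - 1), speed n β (R x) i * (((n : ℝ) - β) * R x l ^ (n - β - 1))) *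
        fieldForce f R χ l x := by
      simp only [mul_sum, sum_mul]
      rw [sum_comm]
      exact sum_congr rfl fun l _ => sum_congr rfl fun β _ => by ring
    have h3 : ∀ l, diffProd (R x) l * ((R x l - R x i)⁻¹ + if i = l then
        ∑ k, (R x l - R x k)⁻¹ else 0) * fieldForce f R χ l x =
        (if i = l then (∑ k, (R x l - R x k)⁻¹) * (diffProd (R x) l * fieldForce f R χ l x)
          else 0) - (R x i - R x l)⁻¹ * (diffProd (R x) l * fieldForce f R χ l x) := by
      intro l
      rw [← neg_sub (R x i) (R x l), inv_neg]
      split_ifs <;> ring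
    rw [h]
    simp only [sum_speed_mul_deriv hinj]
    rw [sum_congr rfl fun l _ => h3 l, sum_sub_distrib, sum_ite_eq, cauchySum_one, cauchySum]
    simp
  rw [sum_add_distrib, h1, h2, shiftDer]
  ring

theorem FluxField.contDiff_pot_flowLine (hR : FluxField I f c R) (hφ : TestOn L φ)
    (hχ : TestOn L χ) (β : ℕ) :
    ContDiff ℝ ∞ fun z : ℝ × ℝ => pot (flowLine f c R χ z.1) φ β z.2 :=
  contDiff_pot (hR.contDiff_flowLine hχ) hφ.contDiff hφ.eq_zero β

theorem FluxField.contDiff_fieldMom_flowLine (hR : FluxField I f c R) (hφ : TestOn L φ)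
    (hχ : TestOn L χ) (i : Fin n) :
    ContDiff ℝ ∞ fun z : ℝ × ℝ => fieldMom (flowLine f c R χ z.1) φ i z.2 :=
  contDiff_fieldMom (hR.contDiff_flowLine hχ) hφ.contDiff hφ.eq_zero i

theorem FluxField.hasDerivAt_pot_flowLine (hR : FluxField I f c R) (hφ : TestOn L φ)
    (hχ : TestOn L χ) (β : ℕ) (x : ℝ) :
    HasDerivAt (fun s => pot (flowLine f c R χ s) φ β x) (varPot f c R φ χ β x) 0 :=
  hasDerivAt_of_contDiff (ContDiff.slice_left (F := fun s x => pot (flowLine f c R χ s) φ β x)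
    (hR.contDiff_pot_flowLine hφ hχ β) x) 0

theorem FluxField.hasDerivAt_fieldMom_flowLine (hR : FluxField I f c R) (hφ : TestOn L φ)
    (hχ : TestOn L χ) (i : Fin n) (x : ℝ) :
    HasDerivAt (fun s => fieldMom (flowLine f c R χ s) φ i x) (varMom f c R φ χ i x) 0 :=
  hasDerivAt_of_contDiff (ContDiff.slice_left
    (F := fun s x => fieldMom (flowLine f c R χ s) φ i x)
    (hR.contDiff_fieldMom_flowLine hφ hχ i) x) 0

theorem FluxField.varMom_eq (hR : FluxField I f c R) (hφ : TestOn L φ) (hχ : TestOn L χ)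
    (i : Fin n) (x : ℝ) :
    varMom f c R φ χ i x = momDer (R x) (factorOp f c R χ x) (φ x) 0 (fun β => pot R φ β x)
      (fun β => varPot f c R φ χ β x) i := by
  have h := hasDerivAt_mom (hasDerivAt_flowLine (f := f) (c := c) R χ x 0)
    (by rw [flowLine_zero]; exact (hR.mem x).2) (hasDerivAt_const 0 (φ x))
    (p := fun β s => pot (flowLine f c R χ s) φ β x)
    (fun β _ => hR.hasDerivAt_pot_flowLine hφ hχ β x) i
  simp only [flowLine_zero] at h
  exact h.deriv

theorem FluxField.hasDerivAt_varPot (hR : FluxField I f c R) (hφ : TestOn L φ) (hχ : TestOn L χ)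
    (β : ℕ) (x : ℝ) :
    HasDerivAt (varPot f c R φ χ β) (densVar (R x) (tang R x) (factorOp f c R χ x)
      (tang (factorOp f c R χ) x) (φ x) β) x := by
  have h := hasDerivAt_deriv_left (F := fun s x => pot (flowLine f c R χ s) φ β x)
    (hR.contDiff_pot_flowLine hφ hχ β) 0 x
  refine h.congr_deriv ?_
  have h1 : ∀ t, deriv (pot (flowLine f c R χ t) φ β) x =
      dens (flowLine f c R χ t x) (tang (flowLine f c R χ t) x) (φ x) β := fun t =>
    (hasDerivAt_pot (hR.contDiff_flowLine_apply hχ t) hφ.contDiff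
      hφ.eq_zero β x).deriv
  simp only [h1]
  have h2 := HasDerivAt.fun_sum (u := univ) fun (j : Fin n) _ =>
    ((hasDerivAt_comp (S := fun s => flowLine f c R χ s x) (x := 0)
    (differentiable_speed β j (flowLine f c R χ 0 x)) (hasDerivAt_flowLine R χ x 0)).fun_mul
    (hasDerivAt_pi.mp (hR.hasDerivAt_tang_flowLine hχ x 0) j)).mul_const (φ x j)
  simp only [flowLine_zero] at h2
  exact h2.deriv

theorem FluxField.hasDerivAt_varMom (hR : FluxField I f c R) (hφ : TestOn L φ) (hχ : TestOn L χ)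
    (i : Fin n) (x : ℝ) :
    HasDerivAt (varMom f c R φ χ i)
      (deriv (fun s => deriv (fieldMom (flowLine f c R χ s) φ i) x) 0) x :=
  hasDerivAt_deriv_left (F := fun s x => fieldMom (flowLine f c R χ s) φ i x)
    (hR.contDiff_fieldMom_flowLine hφ hχ i) 0 x

/-- A primitive of `∑_i (Δ_χ Φ_i η_i^ψ - Δ_ψ Φ_i η_i^χ)`. -/
noncomputable def symmPrim (f : Fin n → ℝ → ℝ) (c : ℕ → ℕ → Vec n → ℝ) (R φ χ ψ : Field n)
    (x : ℝ) : ℝ :=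
  ∑ β ∈ Icc 1 (n - 1), (fieldShift f c R ψ β x * varPot f c R φ χ β x -
      fieldShift f c R χ β x * varPot f c R φ ψ β x) +
    ∑ i, φ x i * (drag f c R ψ x i * (diffProd (R x) i * fieldForce f R χ i x) -
      drag f c R χ x i * (diffProd (R x) i * fieldForce f R ψ i x))

/-- The variation of the momenta relative to the transport by `drag`. -/
noncomputable def relVar (f : Fin n → ℝ → ℝ) (c : ℕ → ℕ → Vec n → ℝ) (R φ χ : Field n) (i : Fin n)
    (x : ℝ) : ℝ := varMom f c R φ χ i x - drag f c R χ x i * deriv (fieldMom R φ i) x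

theorem FluxField.contDiff_eta (hR : FluxField I f c R) (hχ : TestOn L χ) (i : Fin n) :
    ContDiff ℝ ∞ fun x => diffProd (R x) i * fieldForce f R χ i x :=
  ((contDiff_diffProd i).comp hR.contDiff).mul (hR.contDiff_fieldForce hχ i)

theorem FluxField.tang_factorOp (hR : FluxField I f c R) (hχ : TestOn L χ) (i : Fin n) (x : ℝ) :
    tang (factorOp f c R χ) x i = deriv (fun x => diffProd (R x) i * fieldForce f R χ i x) x +
      (tang (tang R) x i * drag f c R χ x i + tang R x i * shiftDer (R x) (tang R x)
        (fun l => fieldForce f R χ l x) (drag f c R χ x) i) := by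
  have h := (hasDerivAt_of_contDiff (hR.contDiff_eta hχ i) x).fun_add
    ((hasDerivAt_pi.mp (hasDerivAt_tang (contDiff_tang_field hR.contDiff) x) i).fun_mul
      (hR.hasDerivAt_drag hχ x i))
  rw [← h.deriv, tang]
  simp only [factorOp_eq]

/-- Pointwise this is `sum_variation_sub`. Transport by `drag` is subtracted from the variations so
that only this symmetric pairing is left. -/
theorem FluxField.hasDerivAt_symmPrim (hR : FluxField I f c R) (hφ : TestOn L φ)
    (hχ : TestOn L χ) (hψ : TestOn L ψ) (x : ℝ) :
    HasDerivAt (symmPrim f c R φ χ ψ)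
      (∑ i, relVar f c R φ χ i x * fieldForce f R ψ i x -
        ∑ i, relVar f c R φ ψ i x * fieldForce f R χ i x) x := by
  have h1 := HasDerivAt.fun_sum (u := Icc 1 (n - 1)) fun β hβ =>
    ((hR.hasDerivAt_fieldShift hψ hβ x).fun_mul (hR.hasDerivAt_varPot hφ hχ β x)).fun_sub
      ((hR.hasDerivAt_fieldShift hχ hβ x).fun_mul (hR.hasDerivAt_varPot hφ hψ β x))
  have h2 := HasDerivAt.fun_sum (u := univ) fun (i : Fin n) _ =>
    (hasDerivAt_pi.mp (hasDerivAt_tang hφ.contDiff x) i).fun_mul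
      (((hR.hasDerivAt_drag hψ x i).fun_mul
        (hasDerivAt_of_contDiff (hR.contDiff_eta hχ i) x)).fun_sub
      ((hR.hasDerivAt_drag hχ x i).fun_mul
        (hasDerivAt_of_contDiff (hR.contDiff_eta hψ i) x)))
  refine (h1.fun_add h2).congr_deriv ?_
  simp only [relVar, hR.varMom_eq hφ hχ, hR.varMom_eq hφ hψ,
    deriv_fieldMom hR.contDiff hφ.contDiff hφ.eq_zero (hR.mem x).2]
  exact sum_variation_sub (hR.mem x).2 (tang R x) (tang (tang R) x) (φ x) (tang φ x)
    (fun i => fieldForce f R χ i x) (fun i => fieldForce f R ψ i x) _ _ (drag f c R χ x)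
    (drag f c R ψ x) (factorOp f c R χ x) (factorOp f c R ψ x) (tang (factorOp f c R χ) x)
    (tang (factorOp f c R ψ) x) (fun β => pot R φ β x) (fun β => varPot f c R φ χ β x)
    (fun β => varPot f c R φ ψ β x) (fun β => fieldShift f c R χ β x)
    (fun β => fieldShift f c R ψ β x) (fun _ => rfl) (fun _ => rfl) (factorOp_eq R χ x)
    (factorOp_eq R ψ x) (fun i => hR.tang_factorOp hχ i x) (fun i => hR.tang_factorOp hψ i x)

end Variation

end Hydro

namespace Hydro

open Finset

variable {n : ℕ} {I : Fin n → Set ℝ} {f : Fin n → ℝ → ℝ} {c : ℕ → ℕ → Vec n → ℝ}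

/-! ### The Jacobi identity -/

/-- The density of the bracket. -/
noncomputable def density (f : Fin n → ℝ → ℝ) (S φ ψ : Field n) (x : ℝ) : ℝ :=
  ∑ i, fieldMom S φ i x * fieldForce f S ψ i x

/-- The variation of `density` is, up to terms with a cyclic symmetry, the derivative of this. -/
noncomputable def locPrim (f : Fin n → ℝ → ℝ) (c : ℕ → ℕ → Vec n → ℝ) (R φ ψ χ : Field n)
    (x : ℝ) : ℝ :=
  ∑ i, ((1 / 2) * deriv (f i) (R x i) * factorOp f c R χ x i * fieldMom R φ i x *
    fieldMom R ψ i x + f i (R x i) * fieldMom R φ i x * varMom f c R ψ χ i x)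

/-- The pairing `∑ c_β^γ a_β b_γ`. -/
noncomputable def fluxPair (c : ℕ → ℕ → Vec n → ℝ) (R : Vec n) (a b : ℕ → ℝ) : ℝ :=
  ∑ β ∈ Icc 1 (n - 1), ∑ γ ∈ Icc 1 (n - 1), c γ β R * a β * b γ

/-- The terms of the variation of `density` that cancel in the cyclic sum. -/
noncomputable def cyclicTerm (f : Fin n → ℝ → ℝ) (R φ ψ χ : Field n) (i : Fin n) (x : ℝ) : ℝ :=
  (1 / 2) * deriv (f i) (R x i) * (diffProd (R x) i * fieldForce f R χ i x) *
    (fieldMom R φ i x * deriv (fieldMom R ψ i) x - deriv (fieldMom R φ i) x * fieldMom R ψ i x)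

/-- Both parts of the force lead to a 3×3 determinant in the momenta and their derivatives with a
repeated row. -/
theorem cyclicTerm_sum (f : Fin n → ℝ → ℝ) (R φ ψ χ : Field n) (i : Fin n) (x : ℝ) :
    cyclicTerm f R φ ψ χ i x + cyclicTerm f R ψ χ φ i x + cyclicTerm f R χ φ ψ i x = 0 := by
  simp only [cyclicTerm, fieldForce]
  ring

section Jacobi

variable {R φ ψ χ : Field n} {L : ℝ} {A : Field n → Field n → Field n}

theorem FluxField.exists_hasDerivAt_density (hR : FluxField I f c R) (hφ : TestOn L φ)
    (hψ : TestOn L ψ) (hχ : TestOn L χ) (x : ℝ) :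
    ∃ u, HasDerivAt (locPrim f c R φ ψ χ) u x ∧
      HasDerivAt (fun s => density f (flowLine f c R χ s) φ ψ x)
        (u + (∑ i, relVar f c R φ χ i x * fieldForce f R ψ i x -
          ∑ i, relVar f c R ψ χ i x * fieldForce f R φ i x) +
          ∑ i, cyclicTerm f R φ ψ χ i x) 0 := by
  have hx := hR.mem x
  have hf' : ∀ i, ContDiffOn ℝ ∞ (deriv (f i)) (I i) := fun i =>
    contDiffOn_deriv (hR.isOpen i) (hR.contDiffOn i)
  have hT := hasDerivAt_tang hR.contDiff x
  have hS := hasDerivAt_flowLine (f := f) (c := c) R χ x 0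
  have hx' : flowLine f c R χ 0 x ∈ domain I := by rwa [flowLine_zero]
  have h1 := HasDerivAt.fun_sum (u := univ) fun (i : Fin n) _ =>
    (((((hasDerivAt_param hR.isOpen hf' hT hx i).const_mul (1 / 2)).fun_mul
      (hasDerivAt_pi.mp (hasDerivAt_tang (hR.contDiff_factorOp hχ) x) i)).fun_mul
      (hasDerivAt_of_contDiff
        (contDiff_fieldMom_field hR.contDiff hφ.contDiff hφ.eq_zero i) x)).fun_mul
      (hasDerivAt_of_contDiff
        (contDiff_fieldMom_field hR.contDiff hψ.contDiff hψ.eq_zero i) x)).fun_add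
    (((hasDerivAt_param hR.isOpen hR.contDiffOn hT hx i).fun_mul
      (hasDerivAt_of_contDiff
        (contDiff_fieldMom_field hR.contDiff hφ.contDiff hφ.eq_zero i) x)).fun_mul
      (hR.hasDerivAt_varMom hψ hχ i x))
  have hd : ∀ i, HasDerivAt (fun s => deriv (fieldMom (flowLine f c R χ s) ψ i) x)
      (deriv (fun s => deriv (fieldMom (flowLine f c R χ s) ψ i) x) 0) 0 := fun i =>
    hasDerivAt_of_contDiff (ContDiff.slice_left
      (F := fun s x => deriv (fieldMom (flowLine f c R χ s) ψ i) x)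
      (contDiff_deriv_right (F := fun s x => fieldMom (flowLine f c R χ s) ψ i x)
        (hR.contDiff_fieldMom_flowLine hψ hχ i)) x) 0
  have h2 := HasDerivAt.fun_sum (u := univ) fun (i : Fin n) _ =>
    (hR.hasDerivAt_fieldMom_flowLine hφ hχ i x).fun_mul
    (((hasDerivAt_param hR.isOpen hR.contDiffOn hS hx' i).fun_mul (hd i)).fun_add
      ((((hasDerivAt_param hR.isOpen hf' hS hx' i).const_mul (1 / 2)).fun_mul
        (hasDerivAt_pi.mp (hR.hasDerivAt_tang_flowLine hχ x 0) i)).fun_mul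
        (hR.hasDerivAt_fieldMom_flowLine hψ hχ i x)))
  refine ⟨_, h1, h2.congr_deriv ?_⟩
  simp only [flowLine_zero]
  rw [← sum_sub_distrib, ← sum_add_distrib, ← sum_add_distrib]
  refine sum_congr rfl fun i _ => ?_
  simp only [relVar, cyclicTerm, fieldForce, factorOp_eq]
  ring

/-- Values of a Hamiltonian vector field are not compactly supported, so the parameter can be
uniform only over compact sets of `x`. -/
theorem FluxField.exists_nhds_mem (hR : FluxField I f c R) (hχ : TestOn L χ) (M : ℝ) :
    ∀ᶠ s in nhds (0 : ℝ), ∀ x, |x| ≤ M → flowLine f c R χ s x ∈ domain I := by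
  have hW : IsOpen {z : ℝ × ℝ | flowLine f c R χ z.1 z.2 ∈ domain I} :=
    (isOpen_domain hR.isOpen).preimage (hR.contDiff_flowLine hχ).continuous
  obtain ⟨u, v, hu, -, h0, hv, huv⟩ := generalized_tube_lemma (isCompact_singleton (x := (0 : ℝ)))
    (isCompact_Icc (a := -M) (b := M)) hW (by
      rintro ⟨s, x⟩ ⟨hs, -⟩
      simp only [Set.mem_singleton_iff] at hs
      subst hs
      simpa only [Set.mem_ofPred_eq, flowLine_zero] using hR.mem x)
  filter_upwards [hu.mem_nhds (h0 rfl)] with s hs x hx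
  exact huv (Set.mk_mem_prod hs (hv (abs_le.mp hx)))

/-- The variation of the boundary terms. -/
noncomputable def bdryVar (f : Fin n → ℝ → ℝ) (c : ℕ → ℕ → Vec n → ℝ) (R φ ψ χ : Field n)
    (x : ℝ) : ℝ :=
  ∑ i, factorOp f c R χ x i * ((1 / 2) * deriv (f i) (R x i) *
      polyDer n (fun β => pot R ψ β x) (R x i) +
      f i (R x i) * polyDer2 n (fun β => pot R ψ β x) (R x i)) *
      polyDer n (fun β => pot R φ β x) (R x i) +
    fluxPair c (R x) (fun β => varPot f c R φ χ β x) (fun β => pot R ψ β x) +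
    fluxPair c (R x) (fun β => pot R φ β x) (fun β => varPot f c R ψ χ β x)

theorem FluxField.hasDerivAt_bdry (hR : FluxField I f c R) (hφ : TestOn L φ) (hψ : TestOn L ψ)
    (hχ : TestOn L χ) (x : ℝ) :
    HasDerivAt (fun s => bdry c (flowLine f c R χ s) φ ψ x) (bdryVar f c R φ ψ χ x) 0 := by
  have hx' : flowLine f c R χ 0 x ∈ domain I := by rw [flowLine_zero]; exact hR.mem x
  have h := HasDerivAt.fun_sum (u := Icc 1 (n - 1)) fun β hβ =>
    HasDerivAt.fun_sum (u := Icc 1 (n - 1)) fun γ hγ =>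
    ((hasDerivAt_comp (S := fun s => flowLine f c R χ s x) (x := 0)
      (hR.isFlux γ hγ β hβ _ hx').1 (hasDerivAt_flowLine R χ x 0)).fun_mul
      (hR.hasDerivAt_pot_flowLine hφ hχ β x)).fun_mul (hR.hasDerivAt_pot_flowLine hψ hχ γ x)
  refine h.congr_deriv ?_
  simp only [flowLine_zero]
  have h1 : ∑ i, factorOp f c R χ x i * ((1 / 2) * deriv (f i) (R x i) *
      polyDer n (fun β => pot R ψ β x) (R x i) +
      f i (R x i) * polyDer2 n (fun β => pot R ψ β x) (R x i)) *
      polyDer n (fun β => pot R φ β x) (R x i) =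
      ∑ β ∈ Icc 1 (n - 1), ∑ γ ∈ Icc 1 (n - 1),
        (∑ i, pd i (c γ β) (R x) * factorOp f c R χ x i) * pot R φ β x * pot R ψ γ x := by
    simp only [mul_assoc (factorOp f c R χ x _), ← sum_pd_mul_mul hR.isFlux (hR.mem x), mul_sum,
      sum_mul]
    rw [sum_comm]
    refine sum_congr rfl fun β _ => ?_
    rw [sum_comm]
    exact sum_congr rfl fun γ _ => sum_congr rfl fun i _ => by ring
  rw [bdryVar, h1, fluxPair, fluxPair]
  simp only [← sum_add_distrib]
  exact sum_congr rfl fun β _ => sum_congr rfl fun γ _ => by ring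

theorem FluxField.contDiffOn_density (hR : FluxField I f c R) (hφ : TestOn L φ)
    (hψ : TestOn L ψ) (hχ : TestOn L χ) :
    ContDiffOn ℝ ∞ (fun z : ℝ × ℝ => density f (flowLine f c R χ z.1) φ ψ z.2)
      {z | flowLine f c R χ z.1 z.2 ∈ domain I} :=
  ContDiffOn.sum fun i _ => (hR.contDiff_fieldMom_flowLine hφ hχ i).contDiffOn.mul
    (contDiffOn_fieldForce hR.isOpen hR.contDiffOn (hR.contDiff_flowLine hχ) hψ.contDiff
      hψ.eq_zero i)

theorem FluxField.hasDerivAt_bracket (hR : FluxField I f c R) (hA : Represents I f c A)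
    (hL : 0 ≤ L) (hφ : TestOn L φ) (hψ : TestOn L ψ) (hχ : TestOn L χ) :
    ContinuousOn (fun x => deriv (fun s => density f (flowLine f c R χ s) φ ψ x) 0)
      (Set.uIcc (-L) L) ∧
    HasDerivAt (fun s => bracket A (flowLine f c R χ s) φ ψ)
      ((∫ x in (-L)..L, deriv (fun s => density f (flowLine f c R χ s) φ ψ x) 0) -
        (bdryVar f c R φ ψ χ L - bdryVar f c R φ ψ χ (-L))) 0 := by
  have hW : IsOpen {z : ℝ × ℝ | flowLine f c R χ z.1 z.2 ∈ domain I} :=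
    (isOpen_domain hR.isOpen).preimage (hR.contDiff_flowLine hχ).continuous
  have h := hasDerivAt_integral hW (a := -L) (b := L) (fun x _ => by
      simpa only [Set.mem_ofPred_eq, flowLine_zero] using hR.mem x)
    (H := fun s x => density f (flowLine f c R χ s) φ ψ x)
    (hR.contDiffOn_density hφ hψ hχ)
  refine ⟨h.1, (h.2.fun_sub ((hR.hasDerivAt_bdry hφ hψ hχ L).fun_sub
    (hR.hasDerivAt_bdry hφ hψ hχ (-L)))).congr_of_eventuallyEq ?_⟩
  filter_upwards [hR.exists_nhds_mem hχ L] with s hs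
  exact bracket_eq hR.isOpen hR.contDiffOn hR.isFlux hA hL (hR.contDiff_flowLine_apply hχ s) hs
    hφ.contDiff hψ.contDiff hφ.eq_zero hψ.eq_zero

theorem FluxField.varPot_neg (hR : FluxField I f c R) (hφ : TestOn L φ) (hχ : TestOn L χ) (β : ℕ) :
    varPot f c R φ χ β (-L) = -varPot f c R φ χ β L := by
  rw [varPot, varPot, ← deriv.fun_neg]
  congr 1
  funext s
  exact pot_neg (hR.contDiff_flowLine_apply hχ s) hφ.contDiff hφ.eq_zero β

/-- Off the supports both expressions are bilinear in the nonlocal primitives; the Gram form of `c +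
cᵀ` reduces their difference to an antisymmetric combination of `fluxPair`, which `symmPrim_eq`
cancels in the cyclic sum. -/
theorem FluxField.locPrim_sub_bdryVar (hR : FluxField I f c R) (hφ : TestOn L φ)
    (hψ : TestOn L ψ) (hχ : TestOn L χ) {x : ℝ} (hx : L ≤ |x|) :
    locPrim f c R φ ψ χ x - bdryVar f c R φ ψ χ x =
      fluxPair c (R x) (fun β => varPot f c R ψ χ β x) (fun β => pot R φ β x) -
      fluxPair c (R x) (fun β => varPot f c R φ χ β x) (fun β => pot R ψ β x) := by
  have h1 : locPrim f c R φ ψ χ x = ∑ i, factorOp f c R χ x i * ((1 / 2) * deriv (f i) (R x i) *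
      polyDer n (fun β => pot R ψ β x) (R x i) +
      f i (R x i) * polyDer2 n (fun β => pot R ψ β x) (R x i)) *
      polyDer n (fun β => pot R φ β x) (R x i) +
      ∑ i, f i (R x i) * polyDer n (fun β => pot R φ β x) (R x i) *
        polyDer n (fun β => varPot f c R ψ χ β x) (R x i) := by
    rw [← sum_add_distrib, locPrim]
    refine sum_congr rfl fun i _ => ?_
    rw [hR.varMom_eq hψ hχ, fieldMom, fieldMom, mom, mom, momDer, hφ.eq_zero x hx,
      hψ.eq_zero x hx]
    simp only [Pi.zero_apply, mul_zero, zero_mul, zero_add]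
    ring
  rw [h1, polyDer_mul_polyDer hR.isFlux (hR.mem x), bdryVar]
  have h2 : ∑ β ∈ Icc 1 (n - 1), ∑ γ ∈ Icc 1 (n - 1), (c γ β (R x) + c β γ (R x)) *
      pot R φ β x * varPot f c R ψ χ γ x =
      fluxPair c (R x) (fun β => pot R φ β x) (fun β => varPot f c R ψ χ β x) +
      fluxPair c (R x) (fun β => varPot f c R ψ χ β x) (fun β => pot R φ β x) := by
    rw [fluxPair, fluxPair, sum_comm (s := Icc 1 (n - 1)) (t := Icc 1 (n - 1))
      (f := fun β γ => c γ β (R x) * varPot f c R ψ χ β x * pot R φ γ x)]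
    simp only [← sum_add_distrib]
    exact sum_congr rfl fun β _ => sum_congr rfl fun γ _ => by ring
  rw [h2]
  ring

theorem symmPrim_eq (hφ : TestOn L φ) (hχ : TestOn L χ)
    (hψ : TestOn L ψ) {x : ℝ} (hx : L ≤ |x|) :
    symmPrim f c R φ χ ψ x =
      fluxPair c (R x) (fun β => varPot f c R φ χ β x) (fun β => pot R ψ β x) -
      fluxPair c (R x) (fun β => varPot f c R φ ψ β x) (fun β => pot R χ β x) -
      ∑ β ∈ Icc 1 (n - 1), (tailPot f c R ψ β x * varPot f c R φ χ β x -
        tailPot f c R χ β x * varPot f c R φ ψ β x) := by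
  simp only [symmPrim, hφ.eq_zero x hx, Pi.zero_apply, zero_mul, sum_const_zero, add_zero,
    fieldShift, shiftLoc, hχ.eq_zero x hx, hψ.eq_zero x hx, mul_zero, fluxPair]
  rw [← sum_sub_distrib, ← sum_sub_distrib]
  refine sum_congr rfl fun β _ => ?_
  rw [sub_mul, sub_mul, sum_mul, sum_mul]
  have h : ∀ (b : ℕ → ℝ) (v : ℝ), ∑ γ ∈ Icc 1 (n - 1), c γ β (R x) * v * b γ =
      ∑ γ ∈ Icc 1 (n - 1), c γ β (R x) * b γ * v := fun b v =>
    sum_congr rfl fun γ _ => by ring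
  rw [h, h]
  ring

theorem FluxField.jacobi (hR : FluxField I f c R) (hA : Represents I f c A) (hL : 0 ≤ L)
    (hφ : TestOn L φ) (hψ : TestOn L ψ) (hχ : TestOn L χ) :
    ∃ a b d : ℝ, HasDerivAt (fun s => bracket A (flowLine f c R χ s) φ ψ) a 0 ∧
      HasDerivAt (fun s => bracket A (flowLine f c R φ s) ψ χ) b 0 ∧
      HasDerivAt (fun s => bracket A (flowLine f c R ψ s) χ φ) d 0 ∧ a + b + d = 0 := by
  obtain ⟨hc1, h1⟩ := hR.hasDerivAt_bracket hA hL hφ hψ hχ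
  obtain ⟨hc2, h2⟩ := hR.hasDerivAt_bracket hA hL hψ hχ hφ
  obtain ⟨hc3, h3⟩ := hR.hasDerivAt_bracket hA hL hχ hφ hψ
  refine ⟨_, _, _, h1, h2, h3, ?_⟩
  -- The six pairings from the three variations are regrouped by the covector whose momentum varies;
  -- each group has a `symmPrim` as primitive.
  set G : ℝ → ℝ := fun x => locPrim f c R φ ψ χ x + locPrim f c R ψ χ φ x +
    locPrim f c R χ φ ψ x + (symmPrim f c R φ χ ψ x + symmPrim f c R ψ φ χ x +
    symmPrim f c R χ ψ φ x) with hG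
  have hd : ∀ x ∈ Set.uIcc (-L) L, HasDerivAt G
      (deriv (fun s => density f (flowLine f c R χ s) φ ψ x) 0 +
      deriv (fun s => density f (flowLine f c R φ s) ψ χ x) 0 +
      deriv (fun s => density f (flowLine f c R ψ s) χ φ x) 0) x := by
    intro x _
    obtain ⟨u1, hu1, hv1⟩ := hR.exists_hasDerivAt_density hφ hψ hχ x
    obtain ⟨u2, hu2, hv2⟩ := hR.exists_hasDerivAt_density hψ hχ hφ x
    obtain ⟨u3, hu3, hv3⟩ := hR.exists_hasDerivAt_density hχ hφ hψ x
    refine (((hu1.fun_add hu2).fun_add hu3).fun_add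
      (((hR.hasDerivAt_symmPrim hφ hχ hψ x).fun_add (hR.hasDerivAt_symmPrim hψ hφ hχ x)).fun_add
      (hR.hasDerivAt_symmPrim hχ hψ hφ x))).congr_deriv ?_
    rw [hv1.deriv, hv2.deriv, hv3.deriv]
    have h0 : ∑ i, cyclicTerm f R φ ψ χ i x + ∑ i, cyclicTerm f R ψ χ φ i x +
        ∑ i, cyclicTerm f R χ φ ψ i x = 0 := by
      rw [← sum_add_distrib, ← sum_add_distrib]
      exact sum_eq_zero fun i _ => cyclicTerm_sum f R φ ψ χ i x
    linarith
  have hi1 := hc1.intervalIntegrable (μ := MeasureTheory.volume)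
  have hi2 := hc2.intervalIntegrable (μ := MeasureTheory.volume)
  have hi3 := hc3.intervalIntegrable (μ := MeasureTheory.volume)
  have hint := intervalIntegral.integral_eq_sub_of_hasDerivAt hd ((hi1.add hi2).add hi3)
  rw [intervalIntegral.integral_add (hi1.add hi2) hi3, intervalIntegral.integral_add hi1 hi2]
    at hint
  -- At the ends only products of a tail potential and a varied potential are left. Both factors
  -- change sign between `L` and `-L`, so the two ends cancel.
  have hb : ∀ x, L ≤ |x| → G x - (bdryVar f c R φ ψ χ x + bdryVar f c R ψ χ φ x +
      bdryVar f c R χ φ ψ x) = -∑ β ∈ Icc 1 (n - 1),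
      ((tailPot f c R ψ β x * varPot f c R φ χ β x - tailPot f c R χ β x * varPot f c R φ ψ β x) +
      (tailPot f c R χ β x * varPot f c R ψ φ β x - tailPot f c R φ β x * varPot f c R ψ χ β x) +
      (tailPot f c R φ β x * varPot f c R χ ψ β x - tailPot f c R ψ β x * varPot f c R χ φ β x))
      := by
    intro x hx
    have e1 := hR.locPrim_sub_bdryVar hφ hψ hχ hx
    have e2 := hR.locPrim_sub_bdryVar hψ hχ hφ hx
    have e3 := hR.locPrim_sub_bdryVar hχ hφ hψ hx
    have e4 := symmPrim_eq (f := f) (c := c) (R := R) hφ hχ hψ hx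
    have e5 := symmPrim_eq (f := f) (c := c) (R := R) hψ hφ hχ hx
    have e6 := symmPrim_eq (f := f) (c := c) (R := R) hχ hψ hφ hx
    simp only [hG]
    rw [e4, e5, e6, sum_add_distrib, sum_add_distrib]
    linarith
  have ht : ∀ φ, TestOn L φ → ∀ β ∈ Icc 1 (n - 1), tailPot f c R φ β (-L) = -tailPot f c R φ β L :=
    fun φ hφ β hβ => tailPot_neg hR.isOpen hR.contDiffOn hR.isFlux hR.contDiff
      (fun x _ => hR.mem x) hφ.contDiff hφ.eq_zero hβ
  have e1 := hb L (abs_of_nonneg hL).ge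
  have e2 := hb (-L) (by rw [abs_neg]; exact (abs_of_nonneg hL).ge)
  rw [sum_congr rfl fun β hβ => by
    rw [ht φ hφ β hβ, ht ψ hψ β hβ, ht χ hχ β hβ, hR.varPot_neg hφ hχ, hR.varPot_neg hφ hψ,
      hR.varPot_neg hψ hφ, hR.varPot_neg hψ hχ, hR.varPot_neg hχ hψ, hR.varPot_neg hχ hφ,
      neg_mul_neg, neg_mul_neg, neg_mul_neg, neg_mul_neg, neg_mul_neg, neg_mul_neg], ← e1] at e2
  linarith

end Jacobi

end Hydro

namespace Hydro

open Finset

variable {n : ℕ} {I : Fin n → Set ℝ} {f : Fin n → ℝ → ℝ} {c : ℕ → ℕ → Vec n → ℝ}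

/-! ### The operators of the family are Hamiltonian and compatible -/

/-- The only place in the proof of the Hamiltonian property where `f ≠ 0` is used: it makes the
inverse matrix of the metric equal to `cometric`. -/
theorem represents_familyOp (hI : ∀ i, IsOpen (I i)) (hf : Admissible I f) :
    Represents I f c (familyOp f c) := by
  intro S ψ L hS hSD hψ hL x hx
  funext i
  have hxD := hSD x hx
  have h1 := locOp_add_tails (f := f) (c := c) hxD.2 (tang S x) (ψ x) (tang ψ x)
    (fun β => pot S ψ β x) (fun β => tailPot f c S ψ β x) i
  rw [← fieldForce_eq hS hψ hL hxD.2] at h1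
  rw [show factorOp f c S ψ x i = diffProd (S x) i * fieldForce f S ψ i x -
    tang S x i * ∑ β ∈ Icc 1 (n - 1), speed n β (S x) i *
      (shiftLoc f c (S x) (ψ x) (fun γ => pot S ψ γ x) β - tailPot f c S ψ β x) from rfl, ← h1,
    ← sum_cometric_mul_conn hf hxD (tang S x) (ψ x) (tang ψ x i) i (tang ψ x) rfl]
  rw [familyOp, nonlocalOp]
  simp only [metric_inv_apply hf hxD, christoffel_metric hI hf hxD, ite_mul, zero_mul]
  congr 1
  congr 1
  · simp [tang]
  · refine sum_congr rfl fun j _ => ?_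
    rw [sum_comm]
    exact sum_congr rfl fun k _ => by simp [tang]

/-- Linear combinations of the parameters. -/
def combF (p q : ℝ) (f₁ f₂ : Fin n → ℝ → ℝ) : Fin n → ℝ → ℝ := fun i r => p * f₁ i r + q * f₂ i r

/-- Linear combinations of the functions `c`. -/
def combC (p q : ℝ) (c₁ c₂ : ℕ → ℕ → Vec n → ℝ) : ℕ → ℕ → Vec n → ℝ :=
  fun β γ R => p * c₁ β γ R + q * c₂ β γ R

/-! ### Linearity of the factorized operator in the parameters. -/

section Comb

variable {f₁ f₂ : Fin n → ℝ → ℝ} {c₁ c₂ : ℕ → ℕ → Vec n → ℝ}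

theorem contDiffOn_combF (h₁ : ∀ i, ContDiffOn ℝ ∞ (f₁ i) (I i))
    (h₂ : ∀ i, ContDiffOn ℝ ∞ (f₂ i) (I i)) (p q : ℝ) (i : Fin n) :
    ContDiffOn ℝ ∞ (combF p q f₁ f₂ i) (I i) :=
  (contDiffOn_const.mul (h₁ i)).add (contDiffOn_const.mul (h₂ i))

theorem deriv_combF (hI : ∀ i, IsOpen (I i)) (h₁ : ∀ i, ContDiffOn ℝ ∞ (f₁ i) (I i))
    (h₂ : ∀ i, ContDiffOn ℝ ∞ (f₂ i) (I i)) (p q : ℝ) (i : Fin n) {r : ℝ} (hr : r ∈ I i) :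
    deriv (combF p q f₁ f₂ i) r = p * deriv (f₁ i) r + q * deriv (f₂ i) r := by
  have hd : ∀ g : ℝ → ℝ, ContDiffOn ℝ ∞ g (I i) → HasDerivAt g (deriv g r) r := fun g hg =>
    ((hg.contDiffAt ((hI i).mem_nhds hr)).differentiableAt (by simp)).hasDerivAt
  exact (((hd _ (h₁ i)).const_mul p).add ((hd _ (h₂ i)).const_mul q)).deriv

theorem isFlux_comb (hI : ∀ i, IsOpen (I i)) (h₁ : ∀ i, ContDiffOn ℝ ∞ (f₁ i) (I i))
    (h₂ : ∀ i, ContDiffOn ℝ ∞ (f₂ i) (I i)) (hc₁ : IsFlux (domain I) f₁ c₁)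
    (hc₂ : IsFlux (domain I) f₂ c₂) (p q : ℝ) :
    IsFlux (domain I) (combF p q f₁ f₂) (combC p q c₁ c₂) := by
  intro β hβ γ hγ R hR
  obtain ⟨d1, e1, s1⟩ := hc₁ β hβ γ hγ R hR
  obtain ⟨d2, e2, s2⟩ := hc₂ β hβ γ hγ R hR
  have hd : DifferentiableAt ℝ (combC p q c₁ c₂ β γ) R := (d1.const_mul p).add (d2.const_mul q)
  refine ⟨hd, fun i => ?_, ?_⟩
  · rw [deriv_combF hI h₁ h₂ p q i (hR.1 i), combF]
    have h : pd i (combC p q c₁ c₂ β γ) R = p * pd i (c₁ β γ) R + q * pd i (c₂ β γ) R :=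
      pd_eq_of_hasDerivAt hd
        (((hasDerivAt_line d1 i).const_mul p).fun_add ((hasDerivAt_line d2 i).const_mul q))
    rw [h, e1, e2]
    ring
  · rw [show combC p q c₁ c₂ β γ R + combC p q c₁ c₂ γ β R =
      p * (c₁ β γ R + c₁ γ β R) + q * (c₂ β γ R + c₂ γ β R) by simp only [combC]; ring, s1, s2,
      mul_sum, mul_sum, ← sum_add_distrib]
    exact sum_congr rfl fun k _ => by rw [combF]; ring

theorem tailSpeed_comb (hI : ∀ i, IsOpen (I i)) (h₁ : ∀ i, ContDiffOn ℝ ∞ (f₁ i) (I i))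
    (h₂ : ∀ i, ContDiffOn ℝ ∞ (f₂ i) (I i)) (p q : ℝ) (β : ℕ) {R : Vec n} (hR : R ∈ domain I)
    (i : Fin n) :
    tailSpeed (combF p q f₁ f₂) (combC p q c₁ c₂) β R i =
      p * tailSpeed f₁ c₁ β R i + q * tailSpeed f₂ c₂ β R i := by
  have h : ∑ γ ∈ Icc 1 (n - 1), speed n γ R i * combC p q c₁ c₂ β γ R =
      p * ∑ γ ∈ Icc 1 (n - 1), speed n γ R i * c₁ β γ R +
      q * ∑ γ ∈ Icc 1 (n - 1), speed n γ R i * c₂ β γ R := by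
    rw [mul_sum, mul_sum, ← sum_add_distrib]
    exact sum_congr rfl fun γ _ => by rw [combC]; ring
  rw [tailSpeed, tailSpeed, tailSpeed, deriv_combF hI h₁ h₂ p q i (hR.1 i), h, combF]
  ring

theorem factorOp_comb (hI : ∀ i, IsOpen (I i)) (h₁ : ∀ i, ContDiffOn ℝ ∞ (f₁ i) (I i))
    (h₂ : ∀ i, ContDiffOn ℝ ∞ (f₂ i) (I i)) (hc₁ : IsFlux (domain I) f₁ c₁)
    (hc₂ : IsFlux (domain I) f₂ c₂) (p q : ℝ) {S ψ : Field n} {L : ℝ} (hS : ContDiff ℝ ∞ S)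
    (hSD : ∀ x, |x| ≤ L → S x ∈ domain I) (hψ : ContDiff ℝ ∞ ψ) (hL : ∀ x, L ≤ |x| → ψ x = 0)
    {x : ℝ} (hx : |x| ≤ L) :
    factorOp (combF p q f₁ f₂) (combC p q c₁ c₂) S ψ x =
      p • factorOp f₁ c₁ S ψ x + q • factorOp f₂ c₂ S ψ x := by
  funext i
  have hF : fieldForce (combF p q f₁ f₂) S ψ i x =
      p * fieldForce f₁ S ψ i x + q * fieldForce f₂ S ψ i x := by
    rw [fieldForce, fieldForce, fieldForce, deriv_combF hI h₁ h₂ p q i ((hSD x hx).1 i), combF]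
    ring
  have hT : ∀ β ∈ Icc 1 (n - 1), tailPot (combF p q f₁ f₂) (combC p q c₁ c₂) S ψ β x =
      p * tailPot f₁ c₁ S ψ β x + q * tailPot f₂ c₂ S ψ β x := by
    intro β hβ
    rw [tailPot, tailPot, tailPot, ← dInv_linear
      (contDiff_tailDens hI h₁ hc₁ hS hSD hψ hL hβ).continuous
      (contDiff_tailDens hI h₂ hc₂ hS hSD hψ hL hβ).continuous
      (tailDens_eq_zero hL β) (tailDens_eq_zero hL β)]
    congr 1
    funext y
    rcases le_or_gt |y| L with hy | hy
    · rw [mul_sum, mul_sum, ← sum_add_distrib]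
      exact sum_congr rfl fun j _ => by rw [tailSpeed_comb hI h₁ h₂ p q β (hSD y hy) j]; ring
    · simp [hL y hy.le]
  have hL' : ∀ β, shiftLoc (combF p q f₁ f₂) (combC p q c₁ c₂) (S x) (ψ x)
      (fun γ => pot S ψ γ x) β = p * shiftLoc f₁ c₁ (S x) (ψ x) (fun γ => pot S ψ γ x) β +
      q * shiftLoc f₂ c₂ (S x) (ψ x) (fun γ => pot S ψ γ x) β := by
    intro β
    simp only [shiftLoc, mul_add, mul_sum]
    rw [add_add_add_comm]
    simp only [← sum_add_distrib]
    congr 1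
    · exact sum_congr rfl fun γ _ => by rw [combC]; ring
    · exact sum_congr rfl fun l _ => by rw [combF]; ring
  have hG : ∑ β ∈ Icc 1 (n - 1), speed n β (S x) i *
      fieldShift (combF p q f₁ f₂) (combC p q c₁ c₂) S ψ β x =
      p * ∑ β ∈ Icc 1 (n - 1), speed n β (S x) i * fieldShift f₁ c₁ S ψ β x +
      q * ∑ β ∈ Icc 1 (n - 1), speed n β (S x) i * fieldShift f₂ c₂ S ψ β x := by
    rw [mul_sum, mul_sum, ← sum_add_distrib]
    refine sum_congr rfl fun β hβ => ?_
    rw [fieldShift, fieldShift, fieldShift, hT β hβ, hL']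
    ring
  simp only [Pi.add_apply, Pi.smul_apply, smul_eq_mul, factorOp, hF, hG]
  ring

theorem represents_comb (hI : ∀ i, IsOpen (I i)) (h₁ : ∀ i, ContDiffOn ℝ ∞ (f₁ i) (I i))
    (h₂ : ∀ i, ContDiffOn ℝ ∞ (f₂ i) (I i)) (hc₁ : IsFlux (domain I) f₁ c₁)
    (hc₂ : IsFlux (domain I) f₂ c₂) {A₁ A₂ : Field n → Field n → Field n}
    (hA₁ : Represents I f₁ c₁ A₁) (hA₂ : Represents I f₂ c₂ A₂) (p q : ℝ) :
    Represents I (combF p q f₁ f₂) (combC p q c₁ c₂) fun R ψ => p • A₁ R ψ + q • A₂ R ψ := by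
  intro S ψ L hS hSD hψ hL x hx
  rw [factorOp_comb hI h₁ h₂ hc₁ hc₂ p q hS hSD hψ hL hx, ← hA₁ S ψ L hS hSD hψ hL x hx,
    ← hA₂ S ψ L hS hSD hψ hL x hx]
  rfl

end Comb

/-! ### Linearity of the factorized operator in the covector. -/

section Linear

variable {R φ ψ : Field n} {L : ℝ}

theorem FluxField.factorOp_linear (hR : FluxField I f c R) (hφ : TestOn L φ) (hψ : TestOn L ψ)
    (p q : ℝ) :
    factorOp f c R (p • φ + q • ψ) = p • factorOp f c R φ + q • factorOp f c R ψ := by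
  have hP : ∀ β x, pot R (p • φ + q • ψ) β x = p * pot R φ β x + q * pot R ψ β x := by
    intro β x
    rw [pot, pot, pot, ← dInv_linear (contDiff_dens_field hR.contDiff hφ.contDiff β).continuous
      (contDiff_dens_field hR.contDiff hψ.contDiff β).continuous
      (dens_eq_zero hφ.eq_zero β) (dens_eq_zero hψ.eq_zero β)]
    congr 1
    funext y
    simp only [dens, mul_sum, ← sum_add_distrib, Pi.add_apply, Pi.smul_apply, smul_eq_mul]
    exact sum_congr rfl fun j _ => by ring
  have hT : ∀ β ∈ Icc 1 (n - 1), ∀ x, tailPot f c R (p • φ + q • ψ) β x =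
      p * tailPot f c R φ β x + q * tailPot f c R ψ β x := by
    intro β hβ x
    rw [tailPot, tailPot, tailPot, ← dInv_linear
      (contDiff_tailDens hR.isOpen hR.contDiffOn hR.isFlux hR.contDiff (fun x _ => hR.mem x)
        hφ.contDiff hφ.eq_zero hβ).continuous
      (contDiff_tailDens hR.isOpen hR.contDiffOn hR.isFlux hR.contDiff (fun x _ => hR.mem x)
        hψ.contDiff hψ.eq_zero hβ).continuous
      (tailDens_eq_zero hφ.eq_zero β) (tailDens_eq_zero hψ.eq_zero β)]
    congr 1
    funext y
    simp only [mul_sum, ← sum_add_distrib, Pi.add_apply, Pi.smul_apply, smul_eq_mul]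
    exact sum_congr rfl fun j _ => by ring
  have hM : ∀ i, fieldMom R (p • φ + q • ψ) i =
      fun x => p * fieldMom R φ i x + q * fieldMom R ψ i x := by
    intro i
    funext x
    have h : polyDer n (fun β => p * pot R φ β x + q * pot R ψ β x) (R x i) =
        p * polyDer n (fun β => pot R φ β x) (R x i) +
        q * polyDer n (fun β => pot R ψ β x) (R x i) := by
      simp only [polyDer, mul_sum, ← sum_add_distrib]
      exact sum_congr rfl fun β _ => by ring
    simp only [fieldMom, mom, hP, Pi.add_apply, Pi.smul_apply, smul_eq_mul, h]
    ring
  have hF : ∀ i x, fieldForce f R (p • φ + q • ψ) i x =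
      p * fieldForce f R φ i x + q * fieldForce f R ψ i x := by
    intro i x
    have hd := ((hasDerivAt_of_contDiff (contDiff_fieldMom_field hR.contDiff hφ.contDiff
      hφ.eq_zero i) x).const_mul p).fun_add ((hasDerivAt_of_contDiff (contDiff_fieldMom_field
      hR.contDiff hψ.contDiff hψ.eq_zero i) x).const_mul q)
    rw [fieldForce, hM, hd.deriv, fieldForce, fieldForce]
    ring
  have hG : ∀ β ∈ Icc 1 (n - 1), ∀ x, fieldShift f c R (p • φ + q • ψ) β x =
      p * fieldShift f c R φ β x + q * fieldShift f c R ψ β x := by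
    intro β hβ x
    have h1 : ∑ γ ∈ Icc 1 (n - 1), c γ β (R x) * (p * pot R φ γ x + q * pot R ψ γ x) =
        p * ∑ γ ∈ Icc 1 (n - 1), c γ β (R x) * pot R φ γ x +
        q * ∑ γ ∈ Icc 1 (n - 1), c γ β (R x) * pot R ψ γ x := by
      simp only [mul_sum, ← sum_add_distrib]
      exact sum_congr rfl fun γ _ => by ring
    have h2 : ∀ g : Fin n → ℝ, ∑ l, g l * (f l (R x l) * (diffProd (R x) l *
        (p * φ x l + q * ψ x l))) =
        p * ∑ l, g l * (f l (R x l) * (diffProd (R x) l * φ x l)) +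
        q * ∑ l, g l * (f l (R x l) * (diffProd (R x) l * ψ x l)) := by
      intro g
      simp only [mul_sum, ← sum_add_distrib]
      exact sum_congr rfl fun l _ => by ring
    simp only [fieldShift, shiftLoc, hT β hβ, hP, Pi.add_apply, Pi.smul_apply, smul_eq_mul, h1, h2]
    ring
  funext x i
  simp only [factorOp, hF, Pi.add_apply, Pi.smul_apply, smul_eq_mul]
  rw [sum_congr rfl fun β hβ => by rw [hG β hβ, mul_add], sum_add_distrib,
    sum_congr rfl fun β _ => mul_left_comm _ _ _, ← mul_sum,
    sum_congr rfl fun β _ => mul_left_comm _ _ _, ← mul_sum]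
  ring

end Linear

/-- Only smoothness of `f` is assumed, so that the statement covers linear combinations whose
parameters have zeros. -/
theorem isHamiltonian_of_represents (hI : ∀ i, IsOpen (I i))
    (hf : ∀ i, ContDiffOn ℝ ∞ (f i) (I i)) (hc : IsFlux (domain I) f c)
    {A : Field n → Field n → Field n} (hA : Represents I f c A) :
    IsHamiltonian (domain I) A := by
  intro R hR
  have hR' : FluxField I f c R := ⟨hI, hf, hc, hR.1, hR.2⟩
  have htest : ∀ ψ : Field n, IsTest ψ → ∃ L, 0 ≤ L ∧ ∀ M, L ≤ M → TestOn M ψ := fun ψ hψ => by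
    obtain ⟨L, hL, h⟩ := exists_bound hψ
    exact ⟨L, hL, fun M hM => ⟨hψ.1, h M hM⟩⟩
  have hAR : ∀ ψ : Field n, IsTest ψ → A R ψ = factorOp f c R ψ := fun ψ hψ => by
    obtain ⟨L, hL, h⟩ := htest ψ hψ
    funext x
    have ht := h (max L |x|) (le_max_left _ _)
    exact hA R ψ (max L |x|) hR.1 (fun x _ => hR.2 x) ht.contDiff ht.eq_zero x (le_max_right _ _)
  have hline : ∀ ψ : Field n, IsTest ψ → ∀ s : ℝ, R + s • A R ψ = flowLine f c R ψ s := fun ψ hψ s => by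
    rw [hAR ψ hψ]
    rfl
  refine ⟨fun ψ hψ => ?_, fun ψ χ hψ hχ p q => ?_, fun φ ψ hφ hψ => ?_, fun φ ψ χ hφ hψ hχ => ?_⟩
  · obtain ⟨L, -, h⟩ := htest ψ hψ
    rw [hAR ψ hψ]
    exact hR'.contDiff_factorOp (h L le_rfl)
  · have hlin : IsTest (p • ψ + q • χ) :=
      ⟨(hψ.1.const_smul p).add (hχ.1.const_smul q),
        (hψ.2.smul_left (f := fun _ => p)).add (hχ.2.smul_left (f := fun _ => q))⟩
    obtain ⟨L₁, h01, h1⟩ := htest ψ hψ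
    obtain ⟨L₂, h02, h2⟩ := htest χ hχ
    rw [hAR _ hlin, hAR ψ hψ, hAR χ hχ]
    exact hR'.factorOp_linear (h1 (L₁ + L₂) (by linarith)) (h2 (L₁ + L₂) (by linarith)) p q
  · obtain ⟨L₁, h01, h1⟩ := htest φ hφ
    obtain ⟨L₂, h02, h2⟩ := htest ψ hψ
    have h1' := h1 (L₁ + L₂) (by linarith)
    have h2' := h2 (L₁ + L₂) (by linarith)
    exact bracket_skew hI hf hc hA (by linarith) hR.1 (fun x _ => hR.2 x) h1'.contDiff h2'.contDiff
      h1'.eq_zero h2'.eq_zero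
  · obtain ⟨L₁, h01, h1⟩ := htest φ hφ
    obtain ⟨L₂, h02, h2⟩ := htest ψ hψ
    obtain ⟨L₃, h03, h3⟩ := htest χ hχ
    simp only [hline φ hφ, hline ψ hψ, hline χ hχ]
    exact hR'.jacobi hA (L := L₁ + L₂ + L₃) (by linarith) (h1 _ (by linarith)) (h2 _ (by linarith))
      (h3 _ (by linarith))

theorem isHamiltonian_familyOp (hI : ∀ i, IsOpen (I i)) (hf : Admissible I f)
    (hc : IsFlux (domain I) f c) : IsHamiltonian (domain I) (familyOp f c) :=
  isHamiltonian_of_represents hI (fun i => (hf i).1) hc (represents_familyOp hI hf)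

theorem compatible_familyOp (hI : ∀ i, IsOpen (I i)) {f₁ f₂ : Fin n → ℝ → ℝ}
    {c₁ c₂ : ℕ → ℕ → Vec n → ℝ} (h₁ : Admissible I f₁) (h₂ : Admissible I f₂)
    (hc₁ : IsFlux (domain I) f₁ c₁) (hc₂ : IsFlux (domain I) f₂ c₂) :
    Compatible (domain I) (familyOp f₁ c₁) (familyOp f₂ c₂) := fun p q =>
  have h₁' := fun i => (h₁ i).1
  have h₂' := fun i => (h₂ i).1
  isHamiltonian_of_represents hI (contDiffOn_combF h₁' h₂' p q)
    (isFlux_comb hI h₁' h₂' hc₁ hc₂ p q)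
    (represents_comb hI h₁' h₂' hc₁ hc₂ (represents_familyOp hI h₁) (represents_familyOp hI h₂) p q)

end Hydro

/-! ### Assembly of the theorem. -/

theorem mainTheorem4 (n : ℕ) [NeZero n] :
    -- the system, its commuting flows, their properties
    (∀ R i, Hydro.speed n 2 R i = R i - ∑ m, R m) ∧
    (∀ β ∈ Finset.Icc 1 n, Hydro.LinearlyDegenerate (Hydro.speed n β)) ∧
    Hydro.SemiHamiltonian {R : Hydro.Vec n | Function.Injective R} (Hydro.speed n 2) ∧
    (∀ β ∈ Finset.Icc 1 n, ∀ γ ∈ Finset.Icc 1 n,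
      Hydro.FlowsCommute Set.univ (Hydro.speed n β) (Hydro.speed n γ)) ∧
    -- the reciprocal transformation between the linear flows and these flows
    (∀ ε : Fin n → ℝ, Function.Injective ε →
      (∀ R : Hydro.Vec n, Function.Injective R →
        Hydro.recip ε R * Hydro.recipInv ε R = 1 ∧
        ∀ (f : Fin n → ℝ → ℝ) (i : Fin n), Hydro.metric f R i i =
          (∑ ν : Fin n, Hydro.recipInv ε R ν 0 * Hydro.linSpeed ε (ν + 1) R i) ^ 2 /
            f i (R i)) ∧
      (∀ (U : Set (Hydro.Vec n)) (R : Hydro.Vec n → Hydro.Vec n), IsOpen U →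
        ContDiffOn ℝ 1 R U → (∀ t ∈ U, Function.Injective (R t)) →
        Hydro.SolvesFlows (Hydro.linSpeed ε) U R →
        Hydro.FormsClosed (Hydro.recip ε) U R ∧
        ∀ t ∈ U, ∃ Φ : OpenPartialHomeomorph (Hydro.Vec n) (Hydro.Vec n),
          t ∈ Φ.source ∧ Φ.source ⊆ U ∧ Hydro.IsReciprocal (Hydro.recip ε) R Φ) ∧
      (∀ (U : Set (Hydro.Vec n)) (R : Hydro.Vec n → Hydro.Vec n), IsOpen U →
        ContDiffOn ℝ 1 R U → (∀ t ∈ U, Function.Injective (R t)) →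
        Hydro.SolvesFlows (Hydro.speed n) U R →
        Hydro.FormsClosed (Hydro.recipInv ε) U R ∧
        ∀ t ∈ U, ∃ Ψ : OpenPartialHomeomorph (Hydro.Vec n) (Hydro.Vec n),
          t ∈ Ψ.source ∧ Ψ.source ⊆ U ∧ Hydro.IsReciprocal (Hydro.recipInv ε) R Ψ) ∧
      (∀ (Φ : OpenPartialHomeomorph (Hydro.Vec n) (Hydro.Vec n))
        (R : Hydro.Vec n → Hydro.Vec n),
        ContDiffOn ℝ 1 R Φ.source → (∀ t ∈ Φ.source, Function.Injective (R t)) →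
        Hydro.IsReciprocal (Hydro.recip ε) R Φ →
        Hydro.IsReciprocal (Hydro.recipInv ε) (R ∘ Φ.symm) Φ.symm ∧
        (Hydro.SolvesFlows (Hydro.linSpeed ε) Φ.source R ↔
          Hydro.SolvesFlows (Hydro.speed n) Φ.target (R ∘ Φ.symm)))) ∧
    -- the Hamiltonian operators
    (∀ I : Fin n → Set ℝ, (∀ i, IsOpen (I i) ∧ (I i).OrdConnected) →
      (∀ f : Fin n → ℝ → ℝ, Hydro.Admissible I f →
        (∃ c, Hydro.IsFlux (Hydro.domain I) f c) ∧
        (∀ i j, i ≠ j → ∀ R ∈ Hydro.domain I,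
          Hydro.pd j (fun S => Real.log (Real.sqrt |Hydro.metric f S i i|)) R =
            Hydro.pd j (fun S => Hydro.speed n 2 S i) R /
              (Hydro.speed n 2 R j - Hydro.speed n 2 R i)) ∧
        ∀ c, Hydro.IsFlux (Hydro.domain I) f c →
          Hydro.IsHamiltonian (Hydro.domain I) (Hydro.familyOp f c) ∧
          Hydro.IsHamiltonianSystem (Hydro.domain I) (Hydro.metric f) (n - 1)
            (Hydro.speed n) (Hydro.tailSpeed f c) (Hydro.speed n 2) ∧
          (∀ β ∈ Finset.Icc 1 (n - 1), ∀ γ ∈ Finset.Icc 1 (n - 1),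
            Hydro.FlowsCommute (Hydro.domain I) (Hydro.tailSpeed f c β)
              (Hydro.tailSpeed f c γ)) ∧
          (∀ β ∈ Finset.Icc 1 (n - 1), ∀ γ ∈ Finset.Icc 1 n,
            Hydro.FlowsCommute (Hydro.domain I) (Hydro.tailSpeed f c β)
              (Hydro.speed n γ)) ∧
          ∀ R ∈ Hydro.domain I, ∀ i j k l : Fin n,
            Hydro.curvature (Hydro.metric f) i j k l R =
              (∑ β ∈ Finset.Icc 1 (n - 1),
                (Hydro.speed n β R i * Hydro.tailSpeed f c β R j +
                 Hydro.speed n β R j * Hydro.tailSpeed f c β R i)) *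
              ((if i = k then 1 else 0) * (if j = l then 1 else 0) -
               (if i = l then 1 else 0) * (if j = k then 1 else 0))) ∧
      (∀ f₁ f₂ : Fin n → ℝ → ℝ, Hydro.Admissible I f₁ → Hydro.Admissible I f₂ →
        ∀ c₁ c₂, Hydro.IsFlux (Hydro.domain I) f₁ c₁ → Hydro.IsFlux (Hydro.domain I) f₂ c₂ →
          Hydro.Compatible (Hydro.domain I) (Hydro.familyOp f₁ c₁)
            (Hydro.familyOp f₂ c₂))) := by
  refine ⟨Hydro.speed_two, fun β _ => Hydro.linearlyDegenerate_speed β,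
    Hydro.semiHamiltonian_speed_two, fun β _ γ _ => Hydro.flowsCommute_speed Set.univ β γ,
    fun ε hε => ⟨fun R hR => ⟨Hydro.recip_mul_recipInv hε hR, fun f i =>
        Hydro.metric_eq_recipInv hε R f i⟩,
      fun U R hU hR hinj h => ?_, fun U R hU hR hinj h => ?_,
      fun Φ R hR hinj hΦ => ⟨hΦ.symm fun t ht => Hydro.recip_mul_recipInv hε (hinj t ht),
        Hydro.solvesFlows_iff hε hR hinj hΦ⟩⟩,
    fun I hI => ⟨fun f hf => ?_, fun f₁ f₂ h₁ h₂ c₁ c₂ hc₁ hc₂ =>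
      Hydro.compatible_familyOp (fun i => (hI i).1) h₁ h₂ hc₁ hc₂⟩⟩
  · have hcl := Hydro.formsClosed_recip hU hR h
    exact ⟨hcl, fun t ht => Hydro.exists_isReciprocal (b := Hydro.recipInv ε) hU hR
      (fun t _ β γ => Hydro.contDiffAt_recip ε (R t) β γ)
      (fun t ht => Hydro.recip_mul_recipInv hε (hinj t ht)) hcl ht⟩
  · have hcl := Hydro.formsClosed_recipInv ε hU hR hinj h
    exact ⟨hcl, fun t ht => Hydro.exists_isReciprocal (b := Hydro.recip ε) hU hR
      (fun t ht β γ => Hydro.contDiffAt_recipInv ε (hinj t ht) β γ)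
      (fun t ht => mul_eq_one_comm.mp (Hydro.recip_mul_recipInv hε (hinj t ht))) hcl ht⟩
  · have hO : ∀ i, IsOpen (I i) := fun i => (hI i).1
    have hfs := fun i => (hf i).1
    refine ⟨Hydro.exists_isFlux hI hfs, fun i j hij R hR => ?_, fun c hc =>
      ⟨Hydro.isHamiltonian_familyOp hO hf hc, Hydro.isHamiltonianSystem hI hf hc,
        fun β hβ γ hγ => Hydro.flowsCommute_of_isInvolutive
          (Hydro.isInvolutive_tailSpeed hO hfs hc hβ) (Hydro.isInvolutive_tailSpeed hO hfs hc hγ),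
        fun β hβ γ _ => Hydro.flowsCommute_of_isInvolutive
          (Hydro.isInvolutive_tailSpeed hO hfs hc hβ) (Hydro.isInvolutive_speed _ γ),
        fun R hR i j k l => Hydro.curvature_eq hO hf hc hR i j k l⟩⟩
    rw [Hydro.pd_log_sqrt_metric hO hf hR, Hydro.logDer_of_ne hij, Hydro.pd_speed_two hij,
      Hydro.speed_two_sub, ← neg_sub (R i) (R j), neg_div_neg_eq, one_div]
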